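/- For $\xi\in\mathbb{R}^2$ write $\xi^\perp=(-\xi_2,\xi_1)$ and let $$G(\xi)=\frac1{4\pi}e^{-|\xi|^2/4},\qquad v^G(\xi)=\frac1{2\pi}\frac{\xi^\perp}{|\xi|^2}\bigl(1-e^{-|\xi|^2/4}\bigr)$$ (with $v^G(0)=0$). Let $X=L^2(\mathbb{R}^2,G^{-1}d\xi)$, a space of real-valued functions, or of complex-valued functions for the complexified space, with norm $\|w\|_X=\bigl(\int_{\mathbb{R}^2}G^{-1}|w|^2\,d\xi\bigr)^{1/2}$, and let $$X_0=\Bigl\{w\in X:\int_{\mathbb{R}^2}w\,d\xi=0\Bigr\},\qquad X_1=\Bigl\{w\in X_0:\int_{\mathbb{R}^2}\xi_i w\,d\xi=0,\ i=1,2\Bigr\}.$$ Let, in the sense of distributions, $$\mathcal{L}w=\Delta w+\tfrac12\,\xi\cdot\nabla w+w,\qquad \Lambda w=v^G\cdot\nabla w+(K*w)\cdot\nabla G,$$ where $(K*w)(\xi)=\frac1{2\pi}\int_{\mathbb{R}^2}\frac{(\xi-\eta)^\perp}{|\xi-\eta|^2}w(\eta)\,d\eta$ is the Biot--Savart velocity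 field of $w$, and let $D(\mathcal{L})=\{w\in X:\Delta w\in X,\ \xi\cdot\nabla w\in X\}$. Then, for every $\alpha\in\mathbb{R}$, the formula $w\mapsto(\mathcal{L}-\alpha\Lambda)w$ defines an operator in $X$ with domain $D(\mathcal{L})$; this operator is the infinitesimal generator of exactly one strongly continuous semigroup $(e^{\tau(\mathcal{L}-\alpha\Lambda)})_{\tau\ge0}$ of bounded linear operators on $X$. This semigroup leaves the subspaces $X_0$ and $X_1$ invariant, and $$\|e^{\tau(\mathcal{L}-\alpha\Lambda)}\|_{Z\to Z}\le e^{-\mu\tau}\qquad\text{for all }\tau\ge0,$$ where $\mu=0$ if $Z=X$, $\mu=\frac12$ if $Z=X_0$, and $\mu=1$ if $Z=X_1$. -/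

import Mathlib

open MeasureTheory Filter Topology
open scoped ENNReal NNReal ContDiff

noncomputable section

namespace OseenVortex

/-! ### The plane, the Oseen vortex and the Gaussian space -/

/-- The plane `ℝ²` with its Euclidean norm and Lebesgue measure. -/
abbrev Plane : Type := EuclideanSpace ℝ (Fin 2)

/-- `x^⊥ = (-x₂, x₁)`. -/
def perp (x : Plane) : Plane := !₂[-x 1, x 0]

/-- The (classical) partial derivative `∂ᵢ f`. -/
def partialD (i : Fin 2) (f : Plane → ℝ) (ξ : Plane) : ℝ :=
  fderiv ℝ f ξ (EuclideanSpace.single i 1)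

/-- The vorticity profile `G(ξ) = (4π)⁻¹ exp(-|ξ|²/4)` of the Oseen vortex. -/
def oseenG (ξ : Plane) : ℝ := 1 / (4 * Real.pi) * Real.exp (-‖ξ‖ ^ 2 / 4)

/-- The velocity profile `v^G(ξ) = (2π)⁻¹ |ξ|⁻² (1 - exp(-|ξ|²/4)) ξ^⊥` of the Oseen vortex
(the formula gives the correct value `0` at the origin). -/
def oseenV (ξ : Plane) : Plane :=
  (1 / (2 * Real.pi) * ((1 - Real.exp (-‖ξ‖ ^ 2 / 4)) / ‖ξ‖ ^ 2)) • perp ξ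

/-- The measure `G(ξ)⁻¹ dξ`. -/
def gaussMeasure : Measure Plane :=
  (volume : Measure Plane).withDensity fun ξ => ENNReal.ofReal (oseenG ξ)⁻¹

/-- The Gaussian space `X = L²(ℝ², G⁻¹ dξ)` of `𝕜`-valued functions, with the norm coming from
the scalar product `∫ G⁻¹ w₁ w₂ dξ` (`∫ G⁻¹ w₁ \bar{w₂} dξ` in the complexified space). -/
abbrev X (𝕜 : Type*) [RCLike 𝕜] : Type _ := Lp 𝕜 2 gaussMeasure

/-! ### Distributions on the plane -/

/-- Test functions: real-valued, smooth, with compact support. -/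
def IsTest (φ : Plane → ℝ) : Prop := ContDiff ℝ ∞ φ ∧ HasCompactSupport φ

/-- Functionals acting on functions `φ : ℝ² → ℝ`; only their values on test functions matter. -/
abbrev Distr (𝕜 : Type*) : Type _ := (Plane → ℝ) → 𝕜

section Distr

variable {𝕜 : Type*} [RCLike 𝕜]

/-- The distribution `φ ↦ ∫ f φ dξ` defined by a locally integrable function `f`. -/
def ofFun (f : Plane → 𝕜) : Distr 𝕜 := fun φ => ∫ ξ, φ ξ • f ξ

/-- The distributional derivative `⟨∂ᵢ T, φ⟩ = -⟨T, ∂ᵢ φ⟩`. -/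
def derivD (i : Fin 2) (T : Distr 𝕜) : Distr 𝕜 := fun φ => -T (partialD i φ)

/-- The product `⟨a T, φ⟩ = ⟨T, a φ⟩` of a distribution with a smooth function `a`. -/
def mulD (a : Plane → ℝ) (T : Distr 𝕜) : Distr 𝕜 := fun φ => T (a * φ)

/-- `T` is (given by) the function `f`, i.e. `T = f` as distributions. -/
def EqFun (T : Distr 𝕜) (f : Plane → 𝕜) : Prop := ∀ φ, IsTest φ → T φ = ofFun f φ

/-- `Δ T`. -/
def laplacianD (T : Distr 𝕜) : Distr 𝕜 := ∑ i, derivD i (derivD i T)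

/-- `a · ∇ T` for a smooth vector field `a`. -/
def transportD (a : Plane → Plane) (T : Distr 𝕜) : Distr 𝕜 :=
  ∑ i, mulD (fun ξ => a ξ i) (derivD i T)

/-! ### The linearized operator -/

/-- The Biot-Savart law: the velocity field `K * w`, that is
`(2π)⁻¹ ∫ (ξ - η)^⊥ |ξ - η|⁻² w(η) dη`; here its `i`-th component. -/
def biotSavart (w : Plane → 𝕜) (i : Fin 2) (ξ : Plane) : 𝕜 :=
  (1 / (2 * Real.pi)) • ∫ η, (perp (ξ - η) i / ‖ξ - η‖ ^ 2) • w η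

/-- `𝓛 w = Δ w + ½ ξ · ∇ w + w`, in the sense of distributions. -/
def opL (w : X 𝕜) : Distr 𝕜 :=
  laplacianD (ofFun w) + (1 / 2 : ℝ) • transportD id (ofFun w) + ofFun w

/-- `Λ w = v^G · ∇ w + (K * w) · ∇ G`, in the sense of distributions. -/
def opΛ (w : X 𝕜) : Distr 𝕜 :=
  transportD oseenV (ofFun w) +
    ofFun fun ξ => ∑ i, partialD i oseenG ξ • biotSavart w i ξ

/-- The domain `D(𝓛) = {w ∈ X | Δ w ∈ X, ξ · ∇ w ∈ X}`. -/
def domL (𝕜 : Type*) [RCLike 𝕜] : Set (X 𝕜) :=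
  {w | (∃ g : X 𝕜, EqFun (laplacianD (ofFun w)) g) ∧
    ∃ g : X 𝕜, EqFun (transportD id (ofFun w)) g}

/-- The graph of the operator `𝓛 - α Λ` in `X`, with domain `D(𝓛)`. -/
def linearizedGraph (𝕜 : Type*) [RCLike 𝕜] (α : ℝ) : Set (X 𝕜 × X 𝕜) :=
  {p | p.1 ∈ domL 𝕜 ∧ EqFun (opL p.1 - α • opΛ p.1) p.2}

end Distr

/-! ### Strongly continuous semigroups -/

/-- Strongly continuous semigroups of bounded operators on `E`. -/
structure C0Semigroup (𝕜 E : Type*) [RCLike 𝕜] [NormedAddCommGroup E] [NormedSpace 𝕜 E] where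
  toFun : ℝ≥0 → E →L[𝕜] E
  map_zero : toFun 0 = ContinuousLinearMap.id 𝕜 E
  map_add : ∀ s t, toFun (s + t) = (toFun s).comp (toFun t)
  continuous_zero : ∀ x, Tendsto (fun t => toFun t x) (𝓝 0) (𝓝 x)

namespace C0Semigroup

variable {𝕜 E : Type*} [RCLike 𝕜] [NormedAddCommGroup E] [NormedSpace 𝕜 E]

/-- The graph of the infinitesimal generator: the pairs `(x, y)` such that
`(S(t) x - x) / t → y` as `t → 0+`. -/
def generatorGraph (S : C0Semigroup 𝕜 E) : Set (E × E) :=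
  {p | Tendsto (fun t : ℝ≥0 => ((t : ℝ) : 𝕜)⁻¹ • (S.toFun t p.1 - p.1)) (𝓝[>] 0) (𝓝 p.2)}

/-- The subspace `Z` is invariant under the semigroup, and the restriction of the semigroup to
`Z` satisfies `‖S(τ)‖_{Z → Z} ≤ exp(-μ τ)` for all `τ ≥ 0`. -/
def DecaysOn (S : C0Semigroup 𝕜 E) (Z : Submodule 𝕜 E) (μ : ℝ) : Prop :=
  ∀ τ : ℝ≥0, ∃ h : Set.MapsTo (S.toFun τ) Z Z,
    ‖(S.toFun τ).restrict h‖ ≤ Real.exp (-μ * τ)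

end C0Semigroup

/-! ### The subspaces `X₀` and `X₁` -/

section Subspaces

variable {𝕜 : Type*} [RCLike 𝕜]

theorem oseenG_pos (ξ : Plane) : 0 < oseenG ξ := by unfold oseenG; positivity

theorem measurable_oseenG : Measurable oseenG := by unfold oseenG; fun_prop

theorem volume_ac_gaussMeasure : (volume : Measure Plane) ≪ gaussMeasure := by
  refine withDensity_absolutelyContinuous' ?_ ?_
  · exact (measurable_oseenG.inv.ennreal_ofReal).aemeasurable
  · exact Eventually.of_forall fun ξ => by simpa using oseenG_pos ξ

theorem integrable_sq_mul_oseenG {p : Plane → ℝ} (hp : Measurable p)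
    (hb : ∀ ξ, |p ξ| ≤ 1 + ‖ξ‖) : Integrable fun ξ => p ξ ^ 2 * oseenG ξ := by
  have h0 : Integrable fun ξ : Plane => Real.exp (-(1 / 8) * ‖ξ‖ ^ 2) := by
    have h := GaussianFourier.integrable_cexp_neg_mul_sq_norm_add (V := Plane) (b := (1 / 8 : ℂ))
      (by norm_num) 0 0
    refine h.norm.congr (Eventually.of_forall fun ξ => ?_)
    simp [Complex.norm_exp, ← Complex.ofReal_pow]
  refine (h0.const_mul 18).mono'
    ((hp.pow_const 2).mul measurable_oseenG).aestronglyMeasurable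
    (Eventually.of_forall fun ξ => ?_)
  have hG := oseenG_pos ξ
  rw [Real.norm_eq_abs, abs_of_nonneg (by positivity)]
  have h1 : p ξ ^ 2 ≤ 2 + 2 * ‖ξ‖ ^ 2 := by
    have := sq_le_sq' (by linarith [abs_nonneg (p ξ), norm_nonneg ξ]) (hb ξ)
    rw [sq_abs] at this
    nlinarith [sq_nonneg (1 - ‖ξ‖)]
  have h2 : 1 + ‖ξ‖ ^ 2 / 8 ≤ Real.exp (1 / 8 * ‖ξ‖ ^ 2) := by
    linarith [Real.add_one_le_exp (1 / 8 * ‖ξ‖ ^ 2)]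
  have h3 : oseenG ξ ≤ Real.exp (-(1 / 8) * ‖ξ‖ ^ 2) * Real.exp (-(1 / 8) * ‖ξ‖ ^ 2) := by
    rw [← Real.exp_add, oseenG]
    have h4 : 1 / (4 * Real.pi) ≤ 1 := by
      rw [div_le_one (by positivity)]; linarith [Real.pi_gt_three]
    calc _ ≤ 1 * Real.exp (-‖ξ‖ ^ 2 / 4) := by gcongr
      _ = _ := by rw [one_mul]; congr 1; ring
  have h5 : Real.exp (1 / 8 * ‖ξ‖ ^ 2) * Real.exp (-(1 / 8) * ‖ξ‖ ^ 2) = 1 := by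
    rw [← Real.exp_add]; simp
  have h6 := Real.exp_pos (-(1 / 8) * ‖ξ‖ ^ 2)
  calc p ξ ^ 2 * oseenG ξ
      ≤ (18 * Real.exp (1 / 8 * ‖ξ‖ ^ 2)) *
        (Real.exp (-(1 / 8) * ‖ξ‖ ^ 2) * Real.exp (-(1 / 8) * ‖ξ‖ ^ 2)) := by
        apply mul_le_mul _ h3 hG.le (by positivity)
        nlinarith [sq_nonneg ‖ξ‖]
    _ = 18 * (Real.exp (1 / 8 * ‖ξ‖ ^ 2) * Real.exp (-(1 / 8) * ‖ξ‖ ^ 2)) *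
        Real.exp (-(1 / 8) * ‖ξ‖ ^ 2) := by ring
    _ = 18 * Real.exp (-(1 / 8) * ‖ξ‖ ^ 2) := by rw [h5, mul_one]

/-- Functions in `X` are integrable against weights of linear growth. -/
theorem integrable_smul_X {p : Plane → ℝ} (hp : Measurable p) (hb : ∀ ξ, |p ξ| ≤ 1 + ‖ξ‖)
    (w : X 𝕜) : Integrable fun ξ => p ξ • w ξ := by
  have hd : Measurable fun ξ => ENNReal.ofReal (oseenG ξ)⁻¹ :=
    measurable_oseenG.inv.ennreal_ofReal
  have hf : ∀ᵐ ξ ∂(volume : Measure Plane), ENNReal.ofReal (oseenG ξ)⁻¹ < ⊤ :=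
    Eventually.of_forall fun ξ => ENNReal.ofReal_lt_top
  have hr : ∀ ξ, (ENNReal.ofReal (oseenG ξ)⁻¹).toReal = (oseenG ξ)⁻¹ := fun ξ =>
    ENNReal.toReal_ofReal (inv_nonneg.2 (oseenG_pos ξ).le)
  have h1 : MemLp (fun ξ => p ξ * oseenG ξ) 2 gaussMeasure := by
    have hm : AEStronglyMeasurable (fun ξ => p ξ * oseenG ξ) gaussMeasure :=
      (hp.mul measurable_oseenG).aestronglyMeasurable
    rw [memLp_two_iff_integrable_sq hm, gaussMeasure,
      integrable_withDensity_iff_integrable_smul' hd hf]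
    refine (integrable_sq_mul_oseenG hp hb).congr (Eventually.of_forall fun ξ => ?_)
    have := (oseenG_pos ξ).ne'
    simp only [hr, smul_eq_mul]
    field_simp
  have h2 : Integrable (fun ξ => (p ξ * oseenG ξ) • w ξ) gaussMeasure := by
    have h3 : MemLp (fun ξ => w ξ) 2 gaussMeasure := Lp.memLp w
    have h4 := MemLp.smul (r := 1) h3 h1
    exact memLp_one_iff_integrable.1 h4
  refine ((integrable_withDensity_iff_integrable_smul' hd hf).1 h2).congr (Eventually.of_forall fun ξ => ?_)
  have := (oseenG_pos ξ).ne'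
  simp only [hr, smul_smul]
  congr 1
  field_simp

theorem integral_smul_add {p : Plane → ℝ} (hp : Measurable p) (hb : ∀ ξ, |p ξ| ≤ 1 + ‖ξ‖)
    (w₁ w₂ : X 𝕜) : ∫ ξ, p ξ • (w₁ + w₂) ξ = (∫ ξ, p ξ • w₁ ξ) + ∫ ξ, p ξ • w₂ ξ := by
  rw [← integral_add (integrable_smul_X hp hb w₁) (integrable_smul_X hp hb w₂)]
  refine integral_congr_ae ?_
  filter_upwards [volume_ac_gaussMeasure.ae_le (Lp.coeFn_add w₁ w₂)] with ξ h
  rw [h, Pi.add_apply, smul_add]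

theorem integral_smul_smul (p : Plane → ℝ) (c : 𝕜) (w : X 𝕜) :
    ∫ ξ, p ξ • (c • w) ξ = c • ∫ ξ, p ξ • w ξ := by
  rw [← integral_smul]
  refine integral_congr_ae ?_
  filter_upwards [volume_ac_gaussMeasure.ae_le (Lp.coeFn_smul c w)] with ξ h
  rw [h, Pi.smul_apply, smul_comm]

/-- The moments `∫ p w dξ` of `w ∈ X`, for `p` of linear growth, as a linear form. -/
def momentForm (𝕜 : Type*) [RCLike 𝕜] (p : Plane → ℝ) (hp : Measurable p)
    (hb : ∀ ξ, |p ξ| ≤ 1 + ‖ξ‖) : X 𝕜 →ₗ[𝕜] 𝕜 where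
  toFun w := ∫ ξ, p ξ • w ξ
  map_add' := integral_smul_add hp hb
  map_smul' := integral_smul_smul p

theorem moment_one (w : X 𝕜) : ∫ ξ, w ξ =
    momentForm 𝕜 (fun _ => 1) measurable_const (fun ξ => by simp) w := by
  simp [momentForm]

theorem moment_coord (i : Fin 2) (w : X 𝕜) : ∫ ξ : Plane, ξ i • w ξ =
    momentForm 𝕜 (fun ξ => ξ i) (by fun_prop)
      (fun ξ => (PiLp.norm_apply_le ξ i).trans (by linarith [norm_nonneg ξ])) w := rfl

/-- `X₀ = {w ∈ X | ∫ w dξ = 0}`. -/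
def X0 (𝕜 : Type*) [RCLike 𝕜] : Submodule 𝕜 (X 𝕜) where
  carrier := {w | ∫ ξ, w ξ = 0}
  zero_mem' := by
    simp only [Set.mem_ofPred_eq, moment_one, _root_.map_zero]
  add_mem' := fun {a b} ha hb => by
    simp only [Set.mem_ofPred_eq, moment_one] at ha hb ⊢
    rw [_root_.map_add, ha, hb, add_zero]
  smul_mem' := fun c a ha => by
    simp only [Set.mem_ofPred_eq, moment_one] at ha ⊢
    rw [_root_.map_smul, ha, smul_zero]

/-- `X₁ = {w ∈ X₀ | ∫ ξᵢ w dξ = 0 for i = 1, 2}`. -/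
def X1 (𝕜 : Type*) [RCLike 𝕜] : Submodule 𝕜 (X 𝕜) where
  carrier := {w | w ∈ X0 𝕜 ∧ ∀ i : Fin 2, ∫ ξ : Plane, ξ i • w ξ = 0}
  zero_mem' := by
    simp only [Set.mem_ofPred_eq, moment_coord, _root_.map_zero]
    exact ⟨zero_mem _, fun _ => trivial⟩
  add_mem' := fun {a b} ha hb => by
    simp only [Set.mem_ofPred_eq, moment_coord] at ha hb ⊢
    exact ⟨add_mem ha.1 hb.1, fun i => by rw [_root_.map_add, ha.2, hb.2, add_zero]⟩
  smul_mem' := fun c a ha => by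
    simp only [Set.mem_ofPred_eq, moment_coord] at ha ⊢
    exact ⟨Submodule.smul_mem _ c ha.1, fun i => by rw [_root_.map_smul, ha.2, smul_zero]⟩

end Subspaces

end OseenVortex

end

noncomputable section

namespace OseenVortex

namespace C0Semigroup

/-! ### Strongly continuous semigroups: local bounds, continuity of orbits, the generator -/

section Banach

variable {𝕜 E : Type*} [RCLike 𝕜] [NormedAddCommGroup E] [NormedSpace 𝕜 E]

/-! In the space `X` the operator 𝓛 is a harmonic oscillator and Λ is skew-symmetric, so αΛ does not
enter the energy balance and every decay rate is a spectral gap of 𝓛.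

Diagonalization of 𝓛. The functions H_k G, with H_k products of Hermite polynomials for the weight
exp(-x²/4), form after normalization a Hilbert basis of `X` (`hermBasis`), and 𝓛 acts on H_k G as
multiplication by -(k₀+k₁)/2 (`deg`). Pairing w against H_k G in `X` is the integral of H_k w, since
G⁻¹ cancels G. Distributional identities tested against cut-off Hermite polynomials therefore become
identities between coefficients, and the distributional domain D(𝓛) is exactly the maximal domain of
the diagonal operator (`mem_domL_iff`).

Skewness of Λ. The field v^G is divergence-free and tangent to circles, so v^G·∇ annihilates G and
is skew for the weight G⁻¹ (`integral_transp_mul`). Since ∇G = -(ξ/2)G, the nonlocal term has the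
quadratic form -(4π)⁻¹∬ ū(ξ) κ(ξ,η) w(η) dξ dη with κ = (ξ₁η₂-ξ₂η₁)/|ξ-η|², which is antisymmetric
and bounded on `X` by a Schur-type estimate (`exists_bound_formIntegrand`, `swirlForm_skew`).

Generation. One derivative costs (1-𝓛)^{1/2}, and v^G is bounded, so ‖Λw‖² is at most a constant
times ⟨(1-𝓛)w, w⟩ (`exists_norm_sq_lambdaOp_le`). Hence αΛ(l-𝓛)⁻¹ has norm less than 1 for large l,
l-𝓛+αΛ is onto by a Neumann series (`exists_sub_eq_of_bound`), and the Lumer-Phillips theorem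
(`exists_semigroup_of_dissipative`) applies. Uniqueness is an energy estimate for the difference of
two orbits (`C0Semigroup.eq_of_generatorGraph_eq`).

Decay. Λ annihilates G, ξ₁G and ξ₂G (`lambdaOp_hermFun`), which is checked by computing the
Biot-Savart integral of an affine function times G. By skewness the range of Λ is orthogonal to
these vectors, so the corresponding Hermite coefficients solve scalar linear equations and stay zero
if they start at zero. This gives invariance of `X0` and `X1`, where the remaining eigenvalues of -𝓛
are at least 1/2 and 1; the energy identity then yields the rates (`decaysOn_diagOp_sub`). -/

theorem ext_toFun {S T : C0Semigroup 𝕜 E} (h : S.toFun = T.toFun) : S = T := by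
  cases S; cases T; cases h; rfl

theorem apply_add (S : C0Semigroup 𝕜 E) (s t : ℝ≥0) (x : E) :
    S.toFun (s + t) x = S.toFun s (S.toFun t x) := by rw [S.map_add]; rfl

theorem apply_zero (S : C0Semigroup 𝕜 E) (x : E) : S.toFun 0 x = x := by rw [S.map_zero]; rfl

/-- Unboundedness near 0 would produce times tₙ → 0 with ‖S(tₙ)‖ unbounded, whereas each sequence
S(tₙ)x converges; this contradicts the uniform boundedness principle. -/
theorem exists_bound_near_zero [CompleteSpace E] (S : C0Semigroup 𝕜 E) :
    ∃ M : ℝ, ∃ δ : ℝ≥0, 0 < δ ∧ ∀ t ≤ δ, ‖S.toFun t‖ ≤ M := by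
  by_contra! h
  have h1 : ∀ n : ℕ, ∃ t : ℝ≥0, t ≤ 1 / ((n : ℝ≥0) + 1) ∧ (n : ℝ) < ‖S.toFun t‖ := fun n =>
    h n (1 / ((n : ℝ≥0) + 1)) (by positivity)
  choose t ht hn using h1
  have ht0 : Tendsto t atTop (𝓝 0) :=
    tendsto_of_tendsto_of_tendsto_of_le_of_le tendsto_const_nhds
      (tendsto_one_div_add_atTop_nhds_zero_nat (𝕜 := ℝ≥0)) (fun _ => zero_le) ht
  obtain ⟨C, hC⟩ := banach_steinhaus (g := fun n => S.toFun (t n)) fun x => by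
    obtain ⟨C, hC⟩ := ((S.continuous_zero x).comp ht0).norm.bddAbove_range
    exact ⟨C, fun i => hC ⟨i, rfl⟩⟩
  obtain ⟨n, hCn⟩ := exists_nat_gt C
  exact absurd (hC n) (not_le.2 (hCn.trans (hn n)))

theorem exists_bound [CompleteSpace E] (S : C0Semigroup 𝕜 E) (T : ℝ≥0) :
    ∃ M : ℝ, 0 ≤ M ∧ ∀ t ≤ T, ‖S.toFun t‖ ≤ M := by
  obtain ⟨M, δ, hδ, hM⟩ := S.exists_bound_near_zero
  have key : ∀ n : ℕ, ∃ M' : ℝ, 0 ≤ M' ∧ ∀ t ≤ n * δ, ‖S.toFun t‖ ≤ M' := by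
    intro n
    have hM0 : 0 ≤ M := (norm_nonneg _).trans (hM 0 zero_le)
    induction n with
    | zero => exact ⟨M, hM0, fun t ht => hM t (ht.trans (by simp))⟩
    | succ n ih =>
      obtain ⟨M', h0, h⟩ := ih
      refine ⟨M * M' + M, by positivity, fun t ht => ?_⟩
      rcases le_total t δ with h1 | h1
      · exact (hM t h1).trans (by nlinarith [mul_nonneg hM0 h0])
      · obtain ⟨s, rfl⟩ := exists_add_of_le h1
        rw [S.map_add]
        have hs : s ≤ n * δ := by
          push_cast at ht
          rw [add_mul, one_mul, add_comm] at ht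
          exact le_of_add_le_add_right ht
        refine (ContinuousLinearMap.opNorm_comp_le _ _).trans ?_
        have := mul_le_mul (hM δ le_rfl) (h s hs) (norm_nonneg _) hM0
        linarith
  obtain ⟨n, hn⟩ := exists_nat_ge (T / δ)
  obtain ⟨M', h0, h⟩ := key n
  exact ⟨M', h0, fun t ht => h t (ht.trans ((div_le_iff₀ hδ).1 hn))⟩

theorem norm_apply_sub_apply_le {S : C0Semigroup 𝕜 E} {T : ℝ≥0} {M : ℝ}
    (h : ∀ t ≤ T, ‖S.toFun t‖ ≤ M) {s t : ℝ≥0} (hs : s ≤ T) (ht : t ≤ T) (x : E) :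
    ‖S.toFun t x - S.toFun s x‖ ≤ M * ‖S.toFun (nndist s t) x - x‖ := by
  wlog hst : s ≤ t generalizing s t
  · rw [norm_sub_rev, nndist_comm]
    exact this ht hs (le_of_not_ge hst)
  obtain ⟨d, rfl⟩ := exists_add_of_le hst
  have hd : nndist s (s + d) = d := by
    ext
    simp [NNReal.dist_eq]
  rw [hd, S.apply_add, ← map_sub]
  exact (S.toFun s).le_of_opNorm_le (h s hs) _

/-- Continuity at 0 is the only topological axiom. For s ≤ t one has S(t)x - S(s)x = S(s)(S(t-s)x -
x), and a local bound on ‖S‖ turns this into continuity from both sides. -/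
theorem continuous_apply [CompleteSpace E] (S : C0Semigroup 𝕜 E) (x : E) :
    Continuous fun t => S.toFun t x := by
  rw [continuous_iff_continuousAt]
  intro s
  obtain ⟨M, -, hM⟩ := S.exists_bound (s + 1)
  rw [ContinuousAt, tendsto_iff_norm_sub_tendsto_zero]
  have h0 : Tendsto (fun t => M * ‖S.toFun (nndist s t) x - x‖) (𝓝 s) (𝓝 0) := by
    have h1 : Tendsto (fun t => nndist s t) (𝓝 s) (𝓝 0) := by
      have : Continuous fun t : ℝ≥0 => nndist s t := by fun_prop
      simpa using this.tendsto s
    have h2 := (tendsto_iff_norm_sub_tendsto_zero.1 ((S.continuous_zero x).comp h1)).const_mul M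
    simpa using h2
  refine squeeze_zero' (Eventually.of_forall fun _ => norm_nonneg _) ?_ h0
  have h1 : ∀ᶠ t in 𝓝 s, t ≤ s + 1 := (eventually_lt_nhds (by simp)).mono fun _ h => h.le
  filter_upwards [h1] with t ht
  exact norm_apply_sub_apply_le hM (by simp) ht x

theorem generatorGraph_sub {S : C0Semigroup 𝕜 E} {p q : E × E} (hp : p ∈ S.generatorGraph)
    (hq : q ∈ S.generatorGraph) : p - q ∈ S.generatorGraph := by
  simp only [generatorGraph, Set.mem_ofPred_eq] at *
  refine (hp.sub hq).congr fun t => ?_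
  rw [← smul_sub, Prod.fst_sub, _root_.map_sub]
  congr 1
  abel

theorem generatorGraph_apply {S : C0Semigroup 𝕜 E} {p : E × E} (hp : p ∈ S.generatorGraph)
    (t : ℝ≥0) : (S.toFun t p.1, S.toFun t p.2) ∈ S.generatorGraph := by
  simp only [generatorGraph, Set.mem_ofPred_eq] at *
  refine (((S.toFun t).continuous.tendsto _).comp hp).congr fun s => ?_
  simp only [Function.comp, map_smul, _root_.map_sub, ← S.apply_add, add_comm]

/-- Only right derivatives are obtained, straight from the definition of the generator; the
monotonicity arguments below need no more. -/
theorem hasDerivWithinAt_apply [NormedSpace ℝ E] [IsScalarTower ℝ 𝕜 E] {S : C0Semigroup 𝕜 E}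
    {p : E × E} (hp : p ∈ S.generatorGraph) {t : ℝ} (ht : 0 ≤ t) :
    HasDerivWithinAt (fun s : ℝ => S.toFun s.toNNReal p.1) (S.toFun t.toNNReal p.2)
      (Set.Ici t) t := by
  have h1 := generatorGraph_apply hp t.toNNReal
  simp only [generatorGraph, Set.mem_ofPred_eq] at h1
  rw [hasDerivWithinAt_iff_tendsto_slope, Set.Ici_sdiff_left]
  have h2 : Tendsto (fun s : ℝ => (s - t).toNNReal) (𝓝[>] t) (𝓝[>] 0) := by
    refine tendsto_nhdsWithin_iff.2 ⟨?_, ?_⟩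
    · have : Continuous fun s : ℝ => (s - t).toNNReal := by fun_prop
      simpa using (this.tendsto t).mono_left nhdsWithin_le_nhds
    · filter_upwards [self_mem_nhdsWithin] with s hs
      simpa using hs
  refine (h1.comp h2).congr' ?_
  filter_upwards [self_mem_nhdsWithin] with s hs
  have hs : t < s := hs
  have h3 : s.toNNReal = (s - t).toNNReal + t.toNNReal := by
    rw [← Real.toNNReal_add (by linarith) ht, sub_add_cancel]
  simp only [Function.comp, slope_def_module]
  rw [h3, S.apply_add, Real.coe_toNNReal _ (by linarith : 0 ≤ s - t)]
  rw [← RCLike.ofReal_inv, RCLike.real_smul_eq_coe_smul (K := 𝕜)]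

end Banach

/-! ### Energy estimates for semigroups in a Hilbert space -/

section Hilbert

variable {𝕜 E : Type*} [RCLike 𝕜] [NormedAddCommGroup E] [InnerProductSpace 𝕜 E]

/-- Grönwall in differential form: exp(2μt)‖u‖² has nonpositive right derivative. It is applied to
single orbits, to differences of orbits and to scalar coefficients. -/
theorem norm_le_exp_mul_of_hasDerivWithinAt [NormedSpace ℝ E] {u u' : ℝ → E} {μ : ℝ}
    (hu : ContinuousOn u (Set.Ici 0))
    (hu' : ∀ t, 0 ≤ t → HasDerivWithinAt u (u' t) (Set.Ici t) t)
    (h : ∀ t, 0 ≤ t → RCLike.re (inner 𝕜 (u t) (u' t)) ≤ -μ * ‖u t‖ ^ 2) {t : ℝ} (ht : 0 ≤ t) :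
    ‖u t‖ ≤ Real.exp (-μ * t) * ‖u 0‖ := by
  have hd : ∀ s, 0 ≤ s → HasDerivWithinAt (fun r => ‖u r‖ ^ 2)
      (2 * RCLike.re (inner 𝕜 (u s) (u' s))) (Set.Ici s) s := by
    intro s hs
    have h1 := RCLike.reCLM.hasFDerivAt.comp_hasDerivWithinAt s
      ((hu' s hs).inner 𝕜 (hu' s hs))
    refine (h1.congr_deriv ?_).congr_of_eventuallyEq (Eventually.of_forall fun r => ?_) ?_
    · simp only [RCLike.reCLM_apply, _root_.map_add]
      rw [inner_re_symm (u' s) (u s)]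
      ring
    · simp only [Function.comp, RCLike.reCLM_apply]
      rw [inner_self_eq_norm_sq]
    · simp only [Function.comp, RCLike.reCLM_apply]
      rw [inner_self_eq_norm_sq]
  have hd2 : ∀ s, 0 ≤ s → HasDerivWithinAt (fun r => Real.exp (2 * μ * r) * ‖u r‖ ^ 2)
      (Real.exp (2 * μ * s) * (2 * μ) * ‖u s‖ ^ 2 +
        Real.exp (2 * μ * s) * (2 * RCLike.re (inner 𝕜 (u s) (u' s)))) (Set.Ici s) s := by
    intro s hs
    have h2 : HasDerivAt (fun r => Real.exp (2 * μ * r)) (Real.exp (2 * μ * s) * (2 * μ)) s := by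
      simpa using ((hasDerivAt_id s).const_mul (2 * μ)).exp
    exact h2.hasDerivWithinAt.mul (hd s hs)
  have key := image_le_of_deriv_right_le_deriv_boundary (a := 0) (b := t)
    (f := fun r => Real.exp (2 * μ * r) * ‖u r‖ ^ 2) (B := fun _ => ‖u 0‖ ^ 2) (B' := fun _ => 0)
    (by
      refine ContinuousOn.mul (by fun_prop) ?_
      exact ((hu.mono Set.Icc_subset_Ici_self).norm.pow 2))
    (fun s hs => hd2 s hs.1) (by simp) continuousOn_const
    (fun s _ => hasDerivWithinAt_const _ _ _)
    (fun s hs => by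
      have := h s hs.1
      have he := Real.exp_pos (2 * μ * s)
      nlinarith) ⟨ht, le_rfl⟩
  have h3 : ‖u t‖ ^ 2 ≤ (Real.exp (-μ * t) * ‖u 0‖) ^ 2 := by
    have h4 : Real.exp (-μ * t) ^ 2 * Real.exp (2 * μ * t) = 1 := by
      rw [← Real.exp_nat_mul, ← Real.exp_add]
      simp only [Real.exp_eq_one_iff]
      push_cast
      ring
    calc ‖u t‖ ^ 2 = Real.exp (-μ * t) ^ 2 * (Real.exp (2 * μ * t) * ‖u t‖ ^ 2) := by
          rw [← mul_assoc, h4, one_mul]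
      _ ≤ Real.exp (-μ * t) ^ 2 * ‖u 0‖ ^ 2 := by gcongr
      _ = _ := by ring
  exact (sq_le_sq₀ (norm_nonneg _) (by positivity)).1 h3

variable [CompleteSpace E]

theorem continuousOn_apply_toNNReal (S : C0Semigroup 𝕜 E) (x : E) :
    ContinuousOn (fun t : ℝ => S.toFun t.toNNReal x) (Set.Ici 0) :=
  ((S.continuous_apply x).comp continuous_real_toNNReal).continuousOn

/-- Two orbits from the same point of the domain both remain in the common graph, hence so does
their difference. Dissipativity makes the norm of the difference nonincreasing, and it starts at 0;
density of the domain finishes. -/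
theorem eq_of_generatorGraph_eq [NormedSpace ℝ E] [IsScalarTower ℝ 𝕜 E] {S T : C0Semigroup 𝕜 E}
    (h : S.generatorGraph = T.generatorGraph)
    (hdiss : ∀ p ∈ S.generatorGraph, RCLike.re (inner 𝕜 p.1 p.2) ≤ 0)
    (hdense : Dense (Prod.fst '' S.generatorGraph)) : S = T := by
  refine ext_toFun (funext fun t => ContinuousLinearMap.ext fun x => ?_)
  refine congr_fun (Continuous.ext_on hdense (S.toFun t).continuous (T.toFun t).continuous ?_) x
  rintro _ ⟨p, hp, rfl⟩
  have hp' : p ∈ T.generatorGraph := h ▸ hp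
  have h1 := norm_le_exp_mul_of_hasDerivWithinAt (𝕜 := 𝕜) (μ := 0)
    (u := fun s : ℝ => S.toFun s.toNNReal p.1 - T.toFun s.toNNReal p.1)
    (u' := fun s : ℝ => S.toFun s.toNNReal p.2 - T.toFun s.toNNReal p.2)
    ((S.continuousOn_apply_toNNReal p.1).sub (T.continuousOn_apply_toNNReal p.1))
    (fun s hs => (hasDerivWithinAt_apply hp hs).sub (hasDerivWithinAt_apply hp' hs))
    (fun s hs => by
      have h3 : (T.toFun s.toNNReal p.1, T.toFun s.toNNReal p.2) ∈ S.generatorGraph := by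
        rw [h]
        exact generatorGraph_apply hp' _
      have h2 := hdiss _ (generatorGraph_sub (generatorGraph_apply hp s.toNNReal) h3)
      rw [neg_zero, zero_mul]
      exact h2) t.coe_nonneg
  simp only [Real.toNNReal_coe, Real.toNNReal_zero, apply_zero] at h1
  simpa [sub_eq_zero] using h1

/-- Invariance and the norm bound at a fixed time are closed conditions on the initial vector, so it
is enough to verify them for vectors of Z in the domain, where the energy estimate applies. -/
theorem decaysOn_of_generatorGraph [NormedSpace ℝ E] [IsScalarTower ℝ 𝕜 E] {S : C0Semigroup 𝕜 E}
    {Z : Submodule 𝕜 E} {μ : ℝ} (hZ : IsClosed (Z : Set E))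
    (hdense : ∀ x ∈ Z, x ∈ closure {y | y ∈ Z ∧ ∃ z, (y, z) ∈ S.generatorGraph})
    (hinv : ∀ p ∈ S.generatorGraph, p.1 ∈ Z → ∀ t, S.toFun t p.1 ∈ Z)
    (hdiss : ∀ p ∈ S.generatorGraph, p.1 ∈ Z → RCLike.re (inner 𝕜 p.1 p.2) ≤ -μ * ‖p.1‖ ^ 2) :
    S.DecaysOn Z μ := by
  intro τ
  have hcl : ∀ x ∈ Z, S.toFun τ x ∈ Z ∧ ‖S.toFun τ x‖ ≤ Real.exp (-μ * τ) * ‖x‖ := by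
    intro x hx
    have hc : IsClosed {x | S.toFun τ x ∈ Z ∧ ‖S.toFun τ x‖ ≤ Real.exp (-μ * τ) * ‖x‖} :=
      (hZ.preimage (S.toFun τ).continuous).inter
        (isClosed_le (S.toFun τ).continuous.norm (continuous_const.mul continuous_norm))
    refine closure_minimal ?_ hc (hdense x hx)
    rintro y ⟨hy, z, hz⟩
    refine ⟨hinv _ hz hy τ, ?_⟩
    have h1 := norm_le_exp_mul_of_hasDerivWithinAt (𝕜 := 𝕜) (μ := μ)
      (S.continuousOn_apply_toNNReal y)
      (fun s hs => (hasDerivWithinAt_apply hz hs))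
      (fun s hs => hdiss _ (generatorGraph_apply hz _) (hinv _ hz hy _)) τ.coe_nonneg
    simpa [apply_zero] using h1
  refine ⟨fun x hx => (hcl x hx).1, ?_⟩
  refine ContinuousLinearMap.opNorm_le_bound _ (Real.exp_pos _).le fun x => ?_
  exact (hcl x x.2).2

/-- Along the semigroup, a coordinate on which the generator acts as a scalar stays zero. -/
theorem inner_apply_eq_zero [NormedSpace ℝ E] [IsScalarTower ℝ 𝕜 E] {S : C0Semigroup 𝕜 E}
    {e : E} {c : ℝ} (he : ∀ p ∈ S.generatorGraph, inner 𝕜 e p.2 = (c : 𝕜) * inner 𝕜 e p.1)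
    {p : E × E} (hp : p ∈ S.generatorGraph) (h0 : inner 𝕜 e p.1 = 0) (t : ℝ≥0) :
    inner 𝕜 e (S.toFun t p.1) = 0 := by
  have h1 := norm_le_exp_mul_of_hasDerivWithinAt (𝕜 := 𝕜) (μ := -c)
    (u := fun s : ℝ => inner 𝕜 e (S.toFun s.toNNReal p.1))
    (u' := fun s : ℝ => inner 𝕜 e (S.toFun s.toNNReal p.2))
    ((innerSL 𝕜 e).continuous.comp_continuousOn (S.continuousOn_apply_toNNReal p.1))
    (fun s hs => by
      have := (hasDerivWithinAt_const s (Set.Ici s) e).inner 𝕜 (hasDerivWithinAt_apply hp hs)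
      simpa using this)
    (fun s hs => by
      rw [he _ (generatorGraph_apply hp _), RCLike.inner_apply, mul_assoc,
        RCLike.mul_conj, RCLike.re_ofReal_mul]
      norm_cast
      simp) t.coe_nonneg
  simp only [Real.toNNReal_coe, Real.toNNReal_zero, apply_zero, h0, norm_zero, mul_zero] at h1
  exact norm_le_zero_iff.1 h1

end Hilbert

end C0Semigroup

/-! ### Generation of semigroups by dissipative operators -/

section Exponential

variable {𝕜 E : Type*} [RCLike 𝕜] [NormedAddCommGroup E] [InnerProductSpace 𝕜 E]

/-- The group `exp (t B)` generated by a bounded operator `B`. -/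
def expGroup (B : E →L[𝕜] E) (t : ℝ) : E →L[𝕜] E := NormedSpace.exp ((t : 𝕜) • B)

theorem expGroup_zero (B : E →L[𝕜] E) : expGroup B 0 = 1 := by
  simp [expGroup, NormedSpace.exp_zero]

theorem expGroup_add [CompleteSpace E] (B : E →L[𝕜] E) (s t : ℝ) :
    expGroup B (s + t) = expGroup B s * expGroup B t := by
  let _ : NormedAlgebra ℚ (E →L[𝕜] E) := NormedAlgebra.restrictScalars ℚ 𝕜 _
  rw [expGroup, RCLike.ofReal_add, add_smul]
  exact NormedSpace.exp_add_of_commute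
    (((Commute.refl B).smul_left _).smul_right _)

theorem commute_expGroup {B C : E →L[𝕜] E} (h : Commute B C) (t : ℝ) :
    Commute C (expGroup B t) := by
  let _ : NormedAlgebra ℚ (E →L[𝕜] E) := NormedAlgebra.restrictScalars ℚ 𝕜 _
  exact (h.symm.smul_right _).exp_right

variable [CompleteSpace E] [NormedSpace ℝ E] [IsScalarTower ℝ 𝕜 E]

theorem hasDerivAt_expGroup (B : E →L[𝕜] E) (x : E) (t : ℝ) :
    HasDerivAt (fun s => expGroup B s x) (expGroup B t (B x)) t := by
  have h1 : HasDerivAt (fun s : 𝕜 => NormedSpace.exp (s • B) x)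
      (NormedSpace.exp ((t : 𝕜) • B) (B x)) (t : 𝕜) := by
    simpa using (hasDerivAt_exp_smul_const (𝕂 := 𝕜) B (t : 𝕜)).clm_apply
      (hasDerivAt_const (t : 𝕜) x)
  have h2 : HasDerivAt (fun s : ℝ => (s : 𝕜)) 1 t := by
    simpa using (RCLike.ofRealCLM (K := 𝕜)).hasDerivAt (x := t)
  simpa [Function.comp_def, expGroup] using h1.scomp t h2

theorem norm_expGroup_apply_le {B : E →L[𝕜] E} (hB : ∀ x, RCLike.re (inner 𝕜 x (B x)) ≤ 0)
    {t : ℝ} (ht : 0 ≤ t) (x : E) : ‖expGroup B t x‖ ≤ ‖x‖ := by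
  have h1 := C0Semigroup.norm_le_exp_mul_of_hasDerivWithinAt (𝕜 := 𝕜) (μ := 0)
    (u := fun s => expGroup B s x) (u' := fun s => B (expGroup B s x))
    (fun s _ => (hasDerivAt_expGroup B x s).continuousAt.continuousWithinAt)
    (fun s _ => by
      have h2 : expGroup B s (B x) = B (expGroup B s x) :=
        (DFunLike.congr_fun (commute_expGroup (Commute.refl B) s).eq x).symm
      rw [← h2]
      exact (hasDerivAt_expGroup B x s).hasDerivWithinAt)
    (fun s _ => by simpa using hB _) ht
  simpa [expGroup_zero] using h1

/-- The path s ↦ exp(sB) exp((t-s)C)x joins the two orbits. Because everything commutes, its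
derivative is exp(sB) exp((t-s)C)(B-C)x, which two contractions bound by ‖(B-C)x‖. -/
theorem norm_expGroup_sub_le {B C : E →L[𝕜] E} (hB : ∀ x, RCLike.re (inner 𝕜 x (B x)) ≤ 0)
    (hC : ∀ x, RCLike.re (inner 𝕜 x (C x)) ≤ 0) (hBC : Commute B C)
    {t : ℝ} (ht : 0 ≤ t) (x : E) :
    ‖expGroup B t x - expGroup C t x‖ ≤ t * ‖B x - C x‖ := by
  have h0 : ∀ s y, C (expGroup B s y) = expGroup B s (C y) := fun s y =>
    DFunLike.congr_fun (commute_expGroup hBC s).eq y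
  have hd : ∀ s, HasDerivAt (fun s => expGroup B s (expGroup C (t - s) x))
      (expGroup B s (expGroup C (t - s) (B x - C x))) s := by
    intro s
    have h1 : HasDerivAt (fun s : 𝕜 => NormedSpace.exp (s • B))
        (NormedSpace.exp ((s : 𝕜) • B) * B) (s : 𝕜) := hasDerivAt_exp_smul_const B _
    have h2 : HasDerivAt (fun s : 𝕜 => NormedSpace.exp (((t : 𝕜) - s) • C) x)
        (- NormedSpace.exp (((t : 𝕜) - (s : 𝕜)) • C) (C x)) (s : 𝕜) := by
      have h3 : HasDerivAt (fun s : 𝕜 => (t : 𝕜) - s) (-1) (s : 𝕜) := by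
        simpa using (hasDerivAt_id (s : 𝕜)).const_sub (t : 𝕜)
      have h4 := (hasDerivAt_exp_smul_const (𝕂 := 𝕜) C ((t : 𝕜) - (s : 𝕜))).scomp _ h3
      simpa using h4.clm_apply (hasDerivAt_const (s : 𝕜) x)
    have h5 := h1.clm_apply h2
    have h6 : HasDerivAt (fun s : ℝ => (s : 𝕜)) 1 s := by
      simpa using (RCLike.ofRealCLM (K := 𝕜)).hasDerivAt (x := s)
    have h7 := h5.scomp s h6
    have h8 : B (expGroup C (t - s) x) = expGroup C (t - s) (B x) :=
      DFunLike.congr_fun (commute_expGroup hBC.symm (t - s)).eq x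
    have h9 : (((t - s : ℝ)) : 𝕜) = (t : 𝕜) - (s : 𝕜) := by push_cast; rfl
    rw [_root_.map_sub, _root_.map_sub, ← h8]
    simpa [Function.comp_def, expGroup, h9, sub_eq_add_neg] using h7
  have key := norm_image_sub_le_of_norm_deriv_le_segment' (a := 0) (b := t)
    (fun s _ => (hd s).hasDerivWithinAt) (C := ‖B x - C x‖)
    (fun s hs => (norm_expGroup_apply_le hB hs.1 _).trans
      (norm_expGroup_apply_le hC (by linarith [hs.2]) _)) t ⟨ht, le_rfl⟩
  simpa [expGroup_zero, mul_comm] using key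

theorem norm_expGroup_sub_self_le {B : E →L[𝕜] E} (hB : ∀ x, RCLike.re (inner 𝕜 x (B x)) ≤ 0)
    {t : ℝ} (ht : 0 ≤ t) (x : E) : ‖expGroup B t x - x‖ ≤ t * ‖B x‖ := by
  have key := norm_image_sub_le_of_norm_deriv_le_segment' (a := 0) (b := t)
    (fun s _ => (hasDerivAt_expGroup B x s).hasDerivWithinAt) (C := ‖B x‖)
    (fun s hs => norm_expGroup_apply_le hB hs.1 _) t ⟨ht, le_rfl⟩
  simpa [expGroup_zero, mul_comm] using key

/-- The auxiliary z makes this usable with B = Bₙ uniformly in n. When y = Ax lies outside the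
domain, ‖Bₙy‖ may be unbounded, so y is replaced by a nearby z of the domain at the cost 2‖y-z‖. -/
theorem norm_expGroup_sub_self_sub_le {B : E →L[𝕜] E}
    (hB : ∀ x, RCLike.re (inner 𝕜 x (B x)) ≤ 0) {t : ℝ} (ht : 0 ≤ t) (x y z : E) :
    ‖expGroup B t x - x - t • y‖ ≤ t * (‖B x - y‖ + 2 * ‖y - z‖ + t * ‖B z‖) := by
  have hd : ∀ s, HasDerivAt (fun s => expGroup B s x - s • y) (expGroup B s (B x) - y) s := by
    intro s
    refine ((hasDerivAt_expGroup B x s).sub ((hasDerivAt_id s).smul_const y)).congr_deriv ?_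
    rw [one_smul]
  have key := norm_image_sub_le_of_norm_deriv_le_segment' (a := 0) (b := t)
    (fun s _ => (hd s).hasDerivWithinAt) (C := ‖B x - y‖ + 2 * ‖y - z‖ + t * ‖B z‖)
    (fun s hs => by
      have h1 : expGroup B s (B x) - y = expGroup B s (B x - y) + expGroup B s (y - z) - (y - z)
          + (expGroup B s z - z) := by
        simp only [_root_.map_sub]
        abel
      rw [h1]
      have h2 := norm_expGroup_apply_le hB hs.1 (B x - y)
      have h3 := norm_expGroup_apply_le hB hs.1 (y - z)
      have h4 := norm_expGroup_sub_self_le hB hs.1 z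
      have h5 : s * ‖B z‖ ≤ t * ‖B z‖ := by gcongr; exact hs.2.le
      refine (norm_add_le _ _).trans ?_
      have h6 := norm_sub_le (expGroup B s (B x - y) + expGroup B s (y - z)) (y - z)
      have h7 := norm_add_le (expGroup B s (B x - y)) (expGroup B s (y - z))
      linarith) t ⟨ht, le_rfl⟩
  have h9 : expGroup B t x - x - t • y = expGroup B t x - t • y - x := by abel
  rw [h9, mul_comm]
  simpa [expGroup_zero] using key

/-- If a sequence of commuting bounded dissipative operators converges on a dense subspace, then
the semigroups they generate converge strongly to a contraction semigroup whose generator extends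
the limit. -/
theorem exists_semigroup_of_tendsto {D : Submodule 𝕜 E} (hD : Dense (D : Set E))
    (A : D → E) (B : ℕ → E →L[𝕜] E) (hB : ∀ n x, RCLike.re (inner 𝕜 x (B n x)) ≤ 0)
    (hc : ∀ m n, Commute (B m) (B n)) (hA : ∀ x : D, Tendsto (fun n => B n x) atTop (𝓝 (A x))) :
    ∃ S : C0Semigroup 𝕜 E, (∀ t x, ‖S.toFun t x‖ ≤ ‖x‖) ∧
      ∀ x : D, ((x : E), A x) ∈ S.generatorGraph := by
  have hcauchy : ∀ (t : ℝ≥0) (x : E), CauchySeq fun n => expGroup (B n) t x := by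
    intro t x
    rw [Metric.cauchySeq_iff]
    intro ε hε
    obtain ⟨y, hy, hxy⟩ := Metric.mem_closure_iff.1 (hD x) (ε / 4) (by positivity)
    -- Dividing by t + 1 rather than t also covers t = 0.
    obtain ⟨N, hN⟩ := Metric.cauchySeq_iff.1 (hA ⟨y, hy⟩).cauchySeq (ε / 4 / (t + 1))
      (by positivity)
    refine ⟨N, fun m hm n hn => ?_⟩
    have h1 := hN m hm n hn
    rw [dist_eq_norm] at hxy h1 ⊢
    have h2 := norm_expGroup_sub_le (hB m) (hB n) (hc m n) t.2 y
    have h3 := norm_expGroup_apply_le (hB m) t.2 (x - y)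
    have h4 := norm_expGroup_apply_le (hB n) t.2 (x - y)
    have h5 : expGroup (B m) t x - expGroup (B n) t x = expGroup (B m) t (x - y)
        - expGroup (B n) t (x - y) + (expGroup (B m) t y - expGroup (B n) t y) := by
      simp only [_root_.map_sub]
      abel
    rw [h5]
    have h6 : (t : ℝ) * ‖B m y - B n y‖ ≤ ε / 4 := by
      have ht : (0 : ℝ) ≤ t := t.2
      rw [lt_div_iff₀ (by positivity)] at h1
      simp only at h1
      nlinarith [norm_nonneg (B m y - B n y)]
    have h2' := h2.trans h6
    have h7 := norm_add_le (expGroup (B m) t (x - y) - expGroup (B n) t (x - y))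
      (expGroup (B m) t y - expGroup (B n) t y)
    have h8 := norm_sub_le (expGroup (B m) t (x - y)) (expGroup (B n) t (x - y))
    linarith!
  choose F hF using fun t x => cauchySeq_tendsto_of_complete (hcauchy t x)
  have hFn : ∀ t x, ‖F t x‖ ≤ ‖x‖ := fun t x =>
    le_of_tendsto (hF t x).norm (Eventually.of_forall fun n => norm_expGroup_apply_le (hB n) t.2 x)
  let T : ℝ≥0 → E →L[𝕜] E := fun t => LinearMap.mkContinuous
    { toFun := F t
      map_add' := fun x y => tendsto_nhds_unique (hF t (x + y))
        (by simpa using (hF t x).add (hF t y))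
      map_smul' := fun c x => tendsto_nhds_unique (hF t (c • x))
        (by simpa using (hF t x).const_smul c) } 1 (fun x => by simpa using hFn t x)
  have hT : ∀ t x, T t x = F t x := fun t x => rfl
  have hTsub : ∀ t x, ‖T t x - x‖ ≤ 2 * ‖x‖ := fun t x => by
    have := norm_sub_le (T t x) x
    have h2 := hFn t x
    rw [← hT] at h2
    linarith
  let S : C0Semigroup 𝕜 E :=
    { toFun := T
      map_zero := by
        ext x
        exact tendsto_nhds_unique (hF 0 x) (by simp [expGroup_zero])
      map_add := by
        intro s t
        ext x
        refine tendsto_nhds_unique (hF (s + t) x) ?_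
        -- The outer operators vary with n, but they are contractions, so the inner limit may be
        -- taken first.
        have h1 : Tendsto (fun n => expGroup (B n) s (expGroup (B n) t x - T t x)) atTop (𝓝 0) := by
          refine squeeze_zero_norm (fun n => norm_expGroup_apply_le (hB n) s.2 _) ?_
          exact tendsto_iff_norm_sub_tendsto_zero.1 (hF t x)
        have h2 := h1.add (hF s (T t x))
        rw [zero_add] at h2
        refine h2.congr fun n => ?_
        rw [NNReal.coe_add, expGroup_add, _root_.map_sub, sub_add_cancel]
        rfl
      continuous_zero := by
        intro x
        rw [Metric.tendsto_nhds]
        intro ε hε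
        obtain ⟨y, hy, hxy⟩ := Metric.mem_closure_iff.1 (hD x) (ε / 4) (by positivity)
        rw [dist_eq_norm] at hxy
        have h1 : ∀ t : ℝ≥0, ‖T t y - y‖ ≤ t * ‖A ⟨y, hy⟩‖ := fun t =>
          le_of_tendsto_of_tendsto ((hF t y).sub_const y).norm ((hA ⟨y, hy⟩).norm.const_mul _)
            (Eventually.of_forall fun n => norm_expGroup_sub_self_le (hB n) t.2 y)
        have h2 : ∀ᶠ t : ℝ≥0 in 𝓝 0, (t : ℝ) * ‖A ⟨y, hy⟩‖ < ε / 4 := by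
          have h3 : Tendsto (fun t : ℝ≥0 => (t : ℝ) * ‖A ⟨y, hy⟩‖) (𝓝 0) (𝓝 0) := by
            have : Continuous fun t : ℝ≥0 => (t : ℝ) * ‖A ⟨y, hy⟩‖ := by fun_prop
            simpa using this.tendsto 0
          exact h3.eventually_lt_const (by positivity)
        filter_upwards [h2] with t ht
        rw [dist_eq_norm]
        have h5 : T t x - x = (T t (x - y) - (x - y)) + (T t y - y) := by
          simp only [_root_.map_sub]
          abel
        rw [h5]
        have h6 := norm_add_le (T t (x - y) - (x - y)) (T t y - y)
        have h7 := hTsub t (x - y)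
        have h8 := h1 t
        linarith }
  refine ⟨S, hFn, fun x => ?_⟩
  simp only [C0Semigroup.generatorGraph, Set.mem_ofPred_eq]
  rw [Metric.tendsto_nhds]
  intro ε hε
  -- Ax need not belong to D, so it is approximated by a vector z of D, along which Bₙz converges.
  obtain ⟨z, hz, hxz⟩ := Metric.mem_closure_iff.1 (hD (A x)) (ε / 4) (by positivity)
  rw [dist_eq_norm] at hxz
  have h1 : ∀ t : ℝ≥0, ‖T t x - x - (t : ℝ) • A x‖ ≤
      t * (2 * ‖A x - z‖ + t * ‖A ⟨z, hz⟩‖) := by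
    intro t
    have h2 : Tendsto (fun n => (t : ℝ) * (‖B n x - A x‖ + 2 * ‖A x - z‖ + t * ‖B n z‖)) atTop
        (𝓝 (t * (0 + 2 * ‖A x - z‖ + t * ‖A ⟨z, hz⟩‖))) :=
      (((tendsto_iff_norm_sub_tendsto_zero.1 (hA x)).add_const _).add
        ((hA ⟨z, hz⟩).norm.const_mul _)).const_mul _
    rw [zero_add] at h2
    exact le_of_tendsto_of_tendsto (((hF t x).sub_const _).sub_const _).norm h2
      (Eventually.of_forall fun n => norm_expGroup_sub_self_sub_le (hB n) t.2 x (A x) z)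
  have h2 : ∀ᶠ t : ℝ≥0 in 𝓝[>] 0, (t : ℝ) * ‖A ⟨z, hz⟩‖ < ε / 4 := by
    have h3 : Tendsto (fun t : ℝ≥0 => (t : ℝ) * ‖A ⟨z, hz⟩‖) (𝓝 0) (𝓝 0) := by
      have : Continuous fun t : ℝ≥0 => (t : ℝ) * ‖A ⟨z, hz⟩‖ := by fun_prop
      simpa using this.tendsto 0
    exact (h3.eventually_lt_const (by positivity)).filter_mono nhdsWithin_le_nhds
  filter_upwards [h2, self_mem_nhdsWithin] with t ht ht0
  have ht0 : (0 : ℝ) < t := ht0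
  have h4 : ((t : ℝ) : 𝕜)⁻¹ • (T t x - x) - A x = (t : ℝ)⁻¹ • (T t x - x - (t : ℝ) • A x) := by
    rw [smul_sub (t : ℝ)⁻¹ _ ((t : ℝ) • A x), inv_smul_smul₀ ht0.ne', ← RCLike.ofReal_inv,
      RCLike.real_smul_eq_coe_smul (K := 𝕜)]
  have h5 : ‖((t : ℝ) : 𝕜)⁻¹ • (T t x - x) - A x‖ < ε := by
    rw [h4, norm_smul, norm_inv, Real.norm_of_nonneg ht0.le, inv_mul_lt_iff₀ ht0]
    refine (h1 t).trans_lt ?_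
    gcongr
    linarith
  rw [dist_eq_norm]
  exact h5

end Exponential

/-! ### The Lumer-Phillips theorem by Yosida approximation -/

section Generation

variable {𝕜 E : Type*} [RCLike 𝕜] [NormedAddCommGroup E] [InnerProductSpace 𝕜 E] [CompleteSpace E]

/-- Lumer-Phillips: a densely defined dissipative operator `A` in a Hilbert space such that
`l - A` is onto for all large `l` generates a strongly continuous semigroup. -/
theorem exists_semigroup_of_dissipative [NormedSpace ℝ E] [IsScalarTower ℝ 𝕜 E]
    {D : Submodule 𝕜 E} (hD : Dense (D : Set E)) (A : D →ₗ[𝕜] E)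
    (hdiss : ∀ x : D, RCLike.re (inner 𝕜 (x : E) (A x)) ≤ 0) {l₀ : ℝ}
    (hrange : ∀ l : ℝ, l₀ < l → ∀ f, ∃ x : D, (l : 𝕜) • (x : E) - A x = f) :
    ∃ S : C0Semigroup 𝕜 E, S.generatorGraph = {p | ∃ x : D, p = ((x : E), A x)} := by
  -- Dissipativity gives injectivity of l - A and the resolvent bound 1/l at once.
  have hest : ∀ l : ℝ, 0 < l → ∀ x : D, l * ‖(x : E)‖ ≤ ‖(l : 𝕜) • (x : E) - A x‖ := by
    intro l hl x
    rcases eq_or_ne (‖(x : E)‖) 0 with h0 | h0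
    · rw [h0, mul_zero]; positivity
    have h1 : RCLike.re (inner 𝕜 (x : E) ((l : 𝕜) • (x : E) - A x)) ≤
        ‖(x : E)‖ * ‖(l : 𝕜) • (x : E) - A x‖ := re_inner_le_norm _ _
    rw [inner_sub_right, inner_smul_right, _root_.map_sub, RCLike.re_ofReal_mul,
      inner_self_eq_norm_sq] at h1
    have h2 := hdiss x
    have h3 : 0 < ‖(x : E)‖ := lt_of_le_of_ne (norm_nonneg _) h0.symm
    by_contra h4
    push Not at h4
    nlinarith
  let l : ℕ → ℝ := fun n => n + (max l₀ 0 + 1)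
  have hl0 : ∀ n, 0 < l n := fun n => by
    have := le_max_right l₀ 0
    simp only [l]
    positivity
  have hl1 : ∀ n, l₀ < l n := fun n => by
    have := le_max_left l₀ 0
    have : (0 : ℝ) ≤ n := n.cast_nonneg
    simp only [l]
    linarith
  have hlt : Tendsto l atTop atTop :=
    tendsto_atTop_add_const_right _ _ tendsto_natCast_atTop_atTop
  choose R hR using fun n f => hrange (l n) (hl1 n) f
  have hinj : ∀ n (x y : D), (l n : 𝕜) • (x : E) - A x = (l n : 𝕜) • (y : E) - A y → x = y := by
    intro n x y h
    have h1 := hest (l n) (hl0 n) (x - y)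
    have h2 : (l n : 𝕜) • ((x - y : D) : E) - A (x - y) = 0 := by
      rw [_root_.map_sub, Submodule.coe_sub, smul_sub, sub_sub_sub_comm, h, sub_self]
    rw [h2, norm_zero] at h1
    have h3 : ‖((x - y : D) : E)‖ = 0 :=
      le_antisymm (by nlinarith [hl0 n]) (norm_nonneg _)
    exact sub_eq_zero.1 (Subtype.ext (norm_eq_zero.1 h3))
  have hRn : ∀ n f, ‖(R n f : E)‖ ≤ (l n)⁻¹ * ‖f‖ := by
    intro n f
    have h1 := hest (l n) (hl0 n) (R n f)
    rw [hR] at h1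
    rw [inv_mul_eq_div, le_div_iff₀ (hl0 n), mul_comm]
    exact h1
  let RL : ℕ → E →L[𝕜] E := fun n => LinearMap.mkContinuous
    { toFun := fun f => R n f
      map_add' := fun f g => by
        rw [← Submodule.coe_add]
        congr 1
        refine hinj n _ _ ?_
        rw [hR, Submodule.coe_add, smul_add, _root_.map_add, add_sub_add_comm, hR, hR]
      map_smul' := fun c f => by
        rw [RingHom.id_apply, ← Submodule.coe_smul]
        congr 1
        refine hinj n _ _ ?_
        rw [hR, Submodule.coe_smul, smul_comm, _root_.map_smul, ← smul_sub, hR] } _ (hRn n)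
  have hRL : ∀ n f, RL n f = R n f := fun n f => rfl
  have hAR : ∀ n f, A (R n f) = (l n : 𝕜) • (R n f : E) - f := fun n f => by
    rw [eq_sub_iff_add_eq, ← eq_sub_iff_add_eq', hR]
  have hRA : ∀ n (x : D), RL n (A x) = (l n : 𝕜) • RL n x - x := fun n x => by
    have h1 : R n ((l n : 𝕜) • (x : E) - A x) = x := hinj n _ _ (hR n _)
    have h2 : RL n ((l n : 𝕜) • (x : E) - A x) = x := by rw [hRL, h1]
    rw [_root_.map_sub, _root_.map_smul] at h2
    rw [eq_sub_iff_add_eq, ← eq_sub_iff_add_eq', h2]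
  have hcommR : ∀ m n, Commute (RL m) (RL n) := by
    intro m n
    refine ContinuousLinearMap.ext fun f => ?_
    change RL m (RL n f) = RL n (RL m f)
    rw [hRL m]
    congr 1
    refine hinj m _ _ ?_
    -- The resolvent at l n commutes with A on the domain; applied to R m f this shows that both
    -- sides have the same image under l m - A.
    have e1 : ∃ z : D, (z : E) = RL n (RL m f) ∧ A z = RL n (A (R m f)) := by
      refine ⟨R n (RL m f), rfl, ?_⟩
      rw [hRA, hAR]
      rfl
    obtain ⟨z, hz, hAz⟩ := e1
    have hz' : z = R n (RL m f) := Subtype.ext hz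
    rw [hR, ← hz', hz, hAz, hRL m, ← _root_.map_smul, ← _root_.map_sub, hR]
  -- The Yosida approximations, equal to l A (l - A)⁻¹; on the domain they are l (l - A)⁻¹ A, and l
  -- (l - A)⁻¹ tends strongly to the identity.
  let B : ℕ → E →L[𝕜] E := fun n => (l n : 𝕜) • ((l n : 𝕜) • RL n - 1)
  have hBD : ∀ n (x : D), B n x = (l n : 𝕜) • RL n (A x) := fun n x => by
    rw [hRA]
    rfl
  have hJ : ∀ n f, ‖(l n : 𝕜) • RL n f‖ ≤ ‖f‖ := fun n f => by
    rw [norm_smul, RCLike.norm_ofReal, abs_of_pos (hl0 n)]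
    have h1 := hRn n f
    rw [inv_mul_eq_div, le_div_iff₀ (hl0 n), mul_comm] at h1
    exact h1
  have hJD : ∀ x : D, Tendsto (fun n => (l n : 𝕜) • RL n x - x) atTop (𝓝 0) := by
    intro x
    refine squeeze_zero_norm (a := fun n => (l n)⁻¹ * ‖A x‖) (fun n => ?_) ?_
    · rw [← hRA]
      exact hRn n _
    · simpa using (tendsto_inv_atTop_zero.comp hlt).mul_const ‖A x‖
  have hJt : ∀ x : E, Tendsto (fun n => (l n : 𝕜) • RL n x) atTop (𝓝 x) := by
    intro x
    rw [Metric.tendsto_nhds]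
    intro ε hε
    obtain ⟨y, hy, hxy⟩ := Metric.mem_closure_iff.1 (hD x) (ε / 4) (by positivity)
    have h1 := (hJD ⟨y, hy⟩).norm.eventually_lt_const (u := ε / 4) (by simpa using by positivity)
    filter_upwards [h1] with n hn
    rw [dist_eq_norm] at hxy ⊢
    have h2 : (l n : 𝕜) • RL n x - x = (l n : 𝕜) • RL n (x - y) - (x - y)
        + ((l n : 𝕜) • RL n y - y) := by
      simp only [_root_.map_sub, smul_sub]
      abel
    rw [h2]
    have h3 := norm_add_le ((l n : 𝕜) • RL n (x - y) - (x - y)) ((l n : 𝕜) • RL n y - y)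
    have h4 := norm_sub_le ((l n : 𝕜) • RL n (x - y)) (x - y)
    have h5 := hJ n (x - y)
    linarith
  have hBdiss : ∀ n x, RCLike.re (inner 𝕜 x (B n x)) ≤ 0 := by
    intro n x
    have h1 : B n x = (l n : 𝕜) • ((l n : 𝕜) • RL n x - x) := rfl
    rw [h1, inner_smul_right, RCLike.re_ofReal_mul, inner_sub_right, _root_.map_sub,
      inner_self_eq_norm_sq]
    have h2 : RCLike.re (inner 𝕜 x ((l n : 𝕜) • RL n x)) ≤ ‖x‖ * ‖(l n : 𝕜) • RL n x‖ :=
      re_inner_le_norm _ _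
    refine mul_nonpos_of_nonneg_of_nonpos (hl0 n).le ?_
    nlinarith [hJ n x, norm_nonneg x]
  have hBcomm : ∀ m n, Commute (B m) (B n) := fun m n =>
    ((((((hcommR m n).smul_left _).smul_right _).sub_left (Commute.one_left _)).sub_right
      (Commute.one_right _)).smul_left _).smul_right _
  obtain ⟨S, hSn, hS⟩ := exists_semigroup_of_tendsto hD A B hBdiss hBcomm
    (fun x => (hJt (A x)).congr fun n => (hBD n x).symm)
  refine ⟨S, Set.Subset.antisymm ?_ ?_⟩
  · intro p hp
    -- Maximality: w is chosen so that p - (w, Aw) has its second component equal to l times the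
    -- first. The generator of a contraction semigroup is dissipative, which forces this difference
    -- to vanish.
    obtain ⟨w, hw⟩ := hrange (l 0) (hl1 0) ((l 0 : 𝕜) • p.1 - p.2)
    have h1 := C0Semigroup.generatorGraph_sub hp (hS w)
    have h2 : p.2 - A w = (l 0 : 𝕜) • (p.1 - w) := by
      have h3 : p.2 = (l 0 : 𝕜) • p.1 - ((l 0 : 𝕜) • (w : E) - A w) := by
        rw [hw]
        abel
      rw [h3, smul_sub]
      abel
    have h3 : RCLike.re (inner 𝕜 (p.1 - w) (p.2 - A w)) ≤ 0 := by
      simp only [C0Semigroup.generatorGraph, Set.mem_ofPred_eq] at h1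
      have h4 : Tendsto (fun t : ℝ≥0 => RCLike.re (inner 𝕜 (p.1 - w)
          (((t : ℝ) : 𝕜)⁻¹ • (S.toFun t (p.1 - w) - (p.1 - w))))) (𝓝[>] 0)
          (𝓝 (RCLike.re (inner 𝕜 (p.1 - w) (p.2 - A w)))) :=
        (RCLike.continuous_re.tendsto _).comp (tendsto_const_nhds.inner h1)
      refine le_of_tendsto h4 (Eventually.of_forall fun t => ?_)
      rw [← RCLike.ofReal_inv, inner_smul_right, RCLike.re_ofReal_mul, inner_sub_right,
        _root_.map_sub, inner_self_eq_norm_sq]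
      have h5 : RCLike.re (inner 𝕜 (p.1 - w) (S.toFun t (p.1 - w))) ≤
          ‖p.1 - w‖ * ‖S.toFun t (p.1 - w)‖ := re_inner_le_norm _ _
      have h6 := hSn t (p.1 - w)
      refine mul_nonpos_of_nonneg_of_nonpos (inv_nonneg.2 t.2) ?_
      nlinarith [norm_nonneg (p.1 - (w : E))]
    rw [h2, inner_smul_right, RCLike.re_ofReal_mul, inner_self_eq_norm_sq] at h3
    have h4 : ‖p.1 - w‖ = 0 := by
      have := hl0 0
      have h5 : ‖p.1 - w‖ ^ 2 ≤ 0 := by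
        by_contra h6
        push Not at h6
        nlinarith
      exact pow_eq_zero_iff two_ne_zero |>.1 (le_antisymm h5 (by positivity))
    rw [norm_eq_zero] at h4
    rw [h4, smul_zero, sub_eq_zero] at h2
    exact ⟨w, Prod.ext (sub_eq_zero.1 h4) h2⟩
  · rintro _ ⟨x, rfl⟩
    exact hS x

end Generation

/-! ### Diagonal operators in a Hilbert basis and their perturbations -/

section Diagonal

variable {𝕜 H ι : Type*} [RCLike 𝕜] [NormedAddCommGroup H] [InnerProductSpace 𝕜 H]
  [CompleteSpace H]

theorem summable_smul_of_orthonormal {v : ι → H} (hv : Orthonormal 𝕜 v) {a : ι → 𝕜}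
    (ha : Summable fun k => ‖a k‖ ^ 2) : Summable fun k => a k • v k := by
  have h := (hv.orthogonalFamily.summable_iff_norm_sq_summable (f := a)).2 ha
  simpa using h

theorem norm_sq_tsum_smul_of_orthonormal {v : ι → H} (hv : Orthonormal 𝕜 v) {a : ι → 𝕜}
    (ha : Summable fun k => ‖a k‖ ^ 2) : ‖∑' k, a k • v k‖ ^ 2 = ∑' k, ‖a k‖ ^ 2 := by
  have h1 := (summable_smul_of_orthonormal hv ha).hasSum
  have h2 : Tendsto (fun s : Finset ι => ∑ k ∈ s, ‖a k‖ ^ 2) atTop (𝓝 (‖∑' k, a k • v k‖ ^ 2)) := by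
    refine ((h1.norm).pow 2).congr fun s => ?_
    have := hv.orthogonalFamily.norm_sum a s
    simpa using this
  exact tendsto_nhds_unique h2 ha.hasSum

variable (b : HilbertBasis ι 𝕜 H) (N : ι → ℝ)

theorem summable_norm_sq_repr (w : H) : Summable fun k => ‖b.repr w k‖ ^ 2 := by
  have := (lp.memℓp (b.repr w)).summable (by norm_num)
  simpa using this

theorem hasSum_norm_sq_repr (w : H) : HasSum (fun k => ‖b.repr w k‖ ^ 2) (‖w‖ ^ 2) := by
  have h1 := norm_sq_tsum_smul_of_orthonormal b.orthonormal (summable_norm_sq_repr b w)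
  rw [(b.hasSum_repr w).tsum_eq] at h1
  rw [h1]
  exact (summable_norm_sq_repr b w).hasSum

theorem repr_eq_of_hasSum {a : ι → 𝕜} {w : H} (h : HasSum (fun k => a k • b k) w) (k : ι) :
    b.repr w k = a k := by
  classical
  rw [b.repr_apply_apply]
  have h1 := h.mapL (innerSL 𝕜 (b k))
  refine h1.unique ?_
  have h2 := hasSum_single (f := fun j => innerSL 𝕜 (b k) (a j • b j)) k (fun j hj => by
    rw [innerSL_apply_apply, inner_smul_right, b.orthonormal.2 hj.symm, mul_zero])
  simpa [inner_smul_right, b.orthonormal.1 k, inner_self_eq_norm_sq_to_K] using h2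

/-- The maximal domain of the diagonal operator with entries `N`. -/
def diagDomain : Submodule 𝕜 H where
  carrier := {w | Summable fun k => (1 + N k) ^ 2 * ‖b.repr w k‖ ^ 2}
  zero_mem' := by simp
  add_mem' := fun {u v} hu hv => by
    refine Summable.of_nonneg_of_le (fun k => by positivity) (fun k => ?_)
      ((hu.add hv).mul_left 2)
    have h1 : ‖b.repr (u + v) k‖ ≤ ‖b.repr u k‖ + ‖b.repr v k‖ := by
      rw [_root_.map_add]
      exact norm_add_le _ _
    have h2 : ‖b.repr (u + v) k‖ ^ 2 ≤ 2 * (‖b.repr u k‖ ^ 2 + ‖b.repr v k‖ ^ 2) := by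
      nlinarith [norm_nonneg (b.repr (u + v) k), sq_nonneg (‖b.repr u k‖ - ‖b.repr v k‖)]
    calc _ ≤ (1 + N k) ^ 2 * (2 * (‖b.repr u k‖ ^ 2 + ‖b.repr v k‖ ^ 2)) := by gcongr
      _ = _ := by ring
  smul_mem' := fun c u hu => by
    refine (hu.mul_left (‖c‖ ^ 2)).congr fun k => ?_
    rw [_root_.map_smul, lp.coeFn_smul, Pi.smul_apply, norm_smul]
    ring

theorem mem_diagDomain {w : H} :
    w ∈ diagDomain b N ↔ Summable fun k => (1 + N k) ^ 2 * ‖b.repr w k‖ ^ 2 := Iff.rfl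

theorem finset_sum_mem_diagDomain (s : Finset ι) (a : ι → 𝕜) :
    ∑ k ∈ s, a k • b k ∈ diagDomain b N := by
  classical
  refine Submodule.sum_mem _ fun k _ => Submodule.smul_mem _ _ ?_
  rw [mem_diagDomain]
  refine summable_of_ne_finset_zero (s := {k}) fun j hj => ?_
  rw [b.repr_apply_apply, b.orthonormal.2 (by simpa using hj)]
  simp

theorem dense_diagDomain : Dense (diagDomain b N : Set H) := fun w =>
  mem_closure_of_tendsto (b.hasSum_repr w) (Eventually.of_forall fun s =>
    finset_sum_mem_diagDomain b N s _)

variable {b N}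

theorem summable_weight {c : ι → ℝ} {C : ℝ} (hc : ∀ k, c k ^ 2 ≤ C * (1 + N k) ^ 2)
    (w : diagDomain b N) : Summable fun k => ‖(c k : 𝕜) * b.repr w k‖ ^ 2 := by
  refine Summable.of_nonneg_of_le (fun k => by positivity) (fun k => ?_)
    (((mem_diagDomain b N).1 w.2).mul_left C)
  rw [norm_mul, mul_pow, RCLike.norm_ofReal, sq_abs, ← mul_assoc]
  gcongr
  exact hc k

/-- The weighted shift `∑ wₖ bₖ ↦ ∑ cₖ wₖ b_{σ k}`. -/
def weightedShift (b : HilbertBasis ι 𝕜 H) {σ : ι → ι} (hσ : σ.Injective) {c : ι → ℝ} {C : ℝ}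
    (hc : ∀ k, c k ^ 2 ≤ C * (1 + N k) ^ 2) : diagDomain b N →ₗ[𝕜] H where
  toFun w := ∑' k, ((c k : 𝕜) * b.repr (w : H) k) • b (σ k)
  map_add' u v := by
    refine Eq.trans (tsum_congr fun k => ?_)
      ((summable_smul_of_orthonormal (b.orthonormal.comp σ hσ) (summable_weight hc u)).tsum_add
        (summable_smul_of_orthonormal (b.orthonormal.comp σ hσ) (summable_weight hc v)))
    rw [Submodule.coe_add, _root_.map_add, lp.coeFn_add, Pi.add_apply, mul_add, add_smul]
    rfl
  map_smul' r u := by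
    refine Eq.trans (tsum_congr fun k => ?_)
      ((summable_smul_of_orthonormal (b.orthonormal.comp σ hσ)
        (summable_weight hc u)).tsum_const_smul r)
    rw [Submodule.coe_smul, _root_.map_smul, lp.coeFn_smul, Pi.smul_apply, smul_smul, smul_eq_mul,
      mul_left_comm]
    rfl

theorem hasSum_weightedShift {σ : ι → ι} (hσ : σ.Injective) {c : ι → ℝ} {C : ℝ}
    (hc : ∀ k, c k ^ 2 ≤ C * (1 + N k) ^ 2) (w : diagDomain b N) :
    HasSum (fun k => ((c k : 𝕜) * b.repr (w : H) k) • b (σ k)) (weightedShift b hσ hc w) :=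
  (summable_smul_of_orthonormal (b.orthonormal.comp σ hσ) (summable_weight hc w)).hasSum

theorem norm_sq_weightedShift {σ : ι → ι} (hσ : σ.Injective) {c : ι → ℝ} {C : ℝ}
    (hc : ∀ k, c k ^ 2 ≤ C * (1 + N k) ^ 2) (w : diagDomain b N) :
    ‖weightedShift b hσ hc w‖ ^ 2 = ∑' k, c k ^ 2 * ‖b.repr (w : H) k‖ ^ 2 := by
  have := norm_sq_tsum_smul_of_orthonormal (b.orthonormal.comp σ hσ) (summable_weight hc w)
  rw [weightedShift, LinearMap.coe_mk, AddHom.coe_mk]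
  refine this.trans (tsum_congr fun k => ?_)
  rw [norm_mul, mul_pow, RCLike.norm_ofReal, sq_abs]

/-- The operator domain lies in the form domain: 1 + N ≤ (1 + N)². -/
theorem summable_linear_weight (hN : ∀ k, 0 ≤ N k) (w : diagDomain b N) :
    Summable fun k => (1 + N k) * ‖b.repr (w : H) k‖ ^ 2 := by
  refine Summable.of_nonneg_of_le (fun k => ?_) (fun k => ?_) ((mem_diagDomain b N).1 w.2)
  · have := hN k
    positivity
  · have := hN k
    gcongr
    nlinarith

theorem sq_le_one_mul_sq (hN : ∀ k, 0 ≤ N k) (k : ι) : (-N k) ^ 2 ≤ 1 * (1 + N k) ^ 2 := by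
  nlinarith [hN k]

/-- The diagonal operator with entries `-N`. -/
def diagOp (b : HilbertBasis ι 𝕜 H) (hN : ∀ k, 0 ≤ N k) : diagDomain b N →ₗ[𝕜] H :=
  weightedShift b Function.injective_id (sq_le_one_mul_sq hN)

theorem repr_diagOp (hN : ∀ k, 0 ≤ N k) (w : diagDomain b N) (k : ι) :
    b.repr (diagOp b hN w) k = ((-N k : ℝ) : 𝕜) * b.repr (w : H) k :=
  repr_eq_of_hasSum b (hasSum_weightedShift Function.injective_id (sq_le_one_mul_sq hN) w) k

theorem hasSum_re_inner_diagOp (hN : ∀ k, 0 ≤ N k) (w : diagDomain b N) :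
    HasSum (fun k => -N k * ‖b.repr (w : H) k‖ ^ 2)
      (RCLike.re (inner 𝕜 (w : H) (diagOp b hN w))) := by
  have h1 := (hasSum_weightedShift Function.injective_id (sq_le_one_mul_sq hN) w).mapL
    (innerSL 𝕜 (w : H))
  have h2 := h1.mapL (RCLike.reCLM (K := 𝕜))
  refine h2.congr_fun ?_
  intro k
  rw [innerSL_apply_apply, inner_smul_right, id, ← inner_conj_symm, ← b.repr_apply_apply, mul_assoc,
    RCLike.mul_conj, RCLike.reCLM_apply, RCLike.re_ofReal_mul]
  norm_cast

variable (Λ : diagDomain b N →ₗ[𝕜] H)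

/-- Λ costs only half a power of 1 + N while (l + N)⁻¹ gains a full one, so αΛ(l + N)⁻¹ has norm at
most (α²C/l)^{1/2} < 1. The equation becomes g + αΛ(l + N)⁻¹g = f with w = (l + N)⁻¹g, solved by a
Neumann series. -/
theorem exists_sub_eq_of_bound (hN : ∀ k, 0 ≤ N k) {C : ℝ} (hC : 0 ≤ C)
    (hΛ : ∀ w : diagDomain b N, ‖Λ w‖ ^ 2 ≤ C * ∑' k, (1 + N k) * ‖b.repr (w : H) k‖ ^ 2)
    (α : ℝ) {l : ℝ} (hl1 : 1 ≤ l) (hl : α ^ 2 * C < l) (f : H) :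
    ∃ w : diagDomain b N, (l : 𝕜) • (w : H) - (diagOp b hN w - (α : 𝕜) • Λ w) = f := by
  have hlN : ∀ k, 0 < l + N k := fun k => by linarith [hN k]
  have hl0 : 0 < l := by linarith
  have hsum : ∀ g : H, Summable fun k => ‖(((l + N k)⁻¹ : ℝ) : 𝕜) * b.repr g k‖ ^ 2 := by
    intro g
    refine Summable.of_nonneg_of_le (fun k => by positivity) (fun k => ?_)
      (summable_norm_sq_repr b g)
    rw [norm_mul, mul_pow, RCLike.norm_ofReal, sq_abs]
    refine mul_le_of_le_one_left (by positivity) (pow_le_one₀ (inv_nonneg.2 (hlN k).le) ?_)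
    exact inv_le_one_of_one_le₀ (by linarith [hN k])
  let R : H → H := fun g => ∑' k, ((((l + N k)⁻¹ : ℝ) : 𝕜) * b.repr g k) • b k
  have hRs : ∀ g, HasSum (fun k => ((((l + N k)⁻¹ : ℝ) : 𝕜) * b.repr g k) • b k) (R g) := fun g =>
    (summable_smul_of_orthonormal b.orthonormal (hsum g)).hasSum
  have hRr : ∀ g k, b.repr (R g) k = (((l + N k)⁻¹ : ℝ) : 𝕜) * b.repr g k := fun g =>
    repr_eq_of_hasSum b (hRs g)
  have hRD : ∀ g, R g ∈ diagDomain b N := by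
    intro g
    rw [mem_diagDomain]
    refine Summable.of_nonneg_of_le (fun k => by positivity) (fun k => ?_)
      (summable_norm_sq_repr b g)
    rw [hRr, norm_mul, mul_pow, RCLike.norm_ofReal, sq_abs, ← mul_assoc, ← mul_pow]
    refine mul_le_of_le_one_left (by positivity) (pow_le_one₀ ?_ ?_)
    · have := hN k
      have := hlN k
      positivity
    · rw [← div_eq_mul_inv, div_le_one (hlN k)]
      linarith
  have hext : ∀ u v : H, (∀ k, b.repr u k = b.repr v k) → u = v := fun u v h =>
    b.repr.injective (lp.ext (funext h))
  let RL : H →ₗ[𝕜] diagDomain b N :=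
    { toFun := fun g => ⟨R g, hRD g⟩
      map_add' := fun g h => Subtype.ext <| hext _ _ fun k => by
        simp only [hRr, _root_.map_add, lp.coeFn_add, Pi.add_apply, Submodule.coe_add, mul_add]
      map_smul' := fun r g => Subtype.ext <| hext _ _ fun k => by
        simp only [hRr, _root_.map_smul, lp.coeFn_smul, Pi.smul_apply, Submodule.coe_smul,
          RingHom.id_apply, smul_eq_mul]
        ring }
  have hRL : ∀ g, ((RL g : diagDomain b N) : H) = R g := fun g => rfl
  have hT : ∀ g, ‖(Λ ∘ₗ RL) g‖ ≤ Real.sqrt (C / l) * ‖g‖ := by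
    intro g
    refine le_of_sq_le_sq ?_ (by positivity)
    rw [mul_pow, Real.sq_sqrt (by positivity)]
    refine (hΛ (RL g)).trans ?_
    -- For l ≥ 1, both 1 + N ≤ l + N and l ≤ l + N, hence (1 + N)/(l + N)² ≤ 1/l.
    have h1 : ∑' k, (1 + N k) * ‖b.repr ((RL g : diagDomain b N) : H) k‖ ^ 2 ≤
        ∑' k, l⁻¹ * ‖b.repr g k‖ ^ 2 := by
      refine Summable.tsum_le_tsum (fun k => ?_) (summable_linear_weight hN (RL g))
        ((summable_norm_sq_repr b g).mul_left _)
      rw [hRL, hRr, norm_mul, mul_pow, RCLike.norm_ofReal, sq_abs, ← mul_assoc]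
      gcongr
      have h2 := hN k
      have h3 := hlN k
      rw [inv_pow, ← div_eq_mul_inv, div_le_iff₀ (by positivity), inv_mul_eq_div,
        le_div_iff₀ hl0]
      nlinarith
    rw [tsum_mul_left, (hasSum_norm_sq_repr b g).tsum_eq] at h1
    calc _ ≤ C * (l⁻¹ * ‖g‖ ^ 2) := by gcongr
      _ = _ := by ring
  let T : H →L[𝕜] H := LinearMap.mkContinuous (Λ ∘ₗ RL) _ hT
  have hTn : ‖-((α : 𝕜) • T)‖ < 1 := by
    rw [norm_neg, norm_smul, RCLike.norm_ofReal]
    have h1 : ‖T‖ ≤ Real.sqrt (C / l) := LinearMap.mkContinuous_norm_le _ (by positivity) _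
    have h2 : |α| * ‖T‖ ≤ Real.sqrt (α ^ 2 * C / l) := by
      rw [mul_div_assoc, Real.sqrt_mul (sq_nonneg _), Real.sqrt_sq_eq_abs]
      gcongr
    refine h2.trans_lt ?_
    rw [Real.sqrt_lt' one_pos, one_pow, div_lt_one hl0]
    exact hl
  obtain ⟨u, hu⟩ := isUnit_one_sub_of_norm_lt_one hTn
  let g := (↑u⁻¹ : H →L[𝕜] H) f
  have hg : g + (α : 𝕜) • T g = f := by
    have h1 : ((u : H →L[𝕜] H) * (↑u⁻¹ : H →L[𝕜] H)) f = f := by simp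
    rw [hu] at h1
    simpa using h1
  refine ⟨RL g, ?_⟩
  have h1 : (l : 𝕜) • ((RL g : diagDomain b N) : H) - diagOp b hN (RL g) = g := by
    refine hext _ _ fun k => ?_
    rw [_root_.map_sub, _root_.map_smul, lp.coeFn_sub, Pi.sub_apply, lp.coeFn_smul, Pi.smul_apply,
      repr_diagOp, hRL, hRr, smul_eq_mul, ← sub_mul, ← mul_assoc, ← RCLike.ofReal_sub,
      ← RCLike.ofReal_mul, sub_neg_eq_add, mul_inv_cancel₀ (hlN k).ne']
    simp
  have h2 : T g = Λ (RL g) := rfl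
  rw [h2] at hg
  rw [← sub_add, h1, hg]

theorem re_inner_diagOp_le (hN : ∀ k, 0 ≤ N k) (w : diagDomain b N) {μ : ℝ}
    (h : ∀ k, μ ≤ N k ∨ b.repr (w : H) k = 0) :
    RCLike.re (inner 𝕜 (w : H) (diagOp b hN w)) ≤ -μ * ‖(w : H)‖ ^ 2 := by
  refine hasSum_le (fun k => ?_) (hasSum_re_inner_diagOp hN w)
    ((hasSum_norm_sq_repr b (w : H)).mul_left (-μ))
  rcases h k with h | h
  · gcongr
  · simp [h]

variable [NormedSpace ℝ H] [IsScalarTower ℝ 𝕜 H]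

/-- The operator `-N - α Λ`, where `Λ` is a skew perturbation dominated by `(1 + N)^{1/2}`,
generates a strongly continuous semigroup. -/
theorem exists_semigroup_diagOp_sub (hN : ∀ k, 0 ≤ N k) {C : ℝ} (hC : 0 ≤ C)
    (hΛ : ∀ w : diagDomain b N, ‖Λ w‖ ^ 2 ≤ C * ∑' k, (1 + N k) * ‖b.repr (w : H) k‖ ^ 2)
    (hskew : ∀ w : diagDomain b N, RCLike.re (inner 𝕜 (w : H) (Λ w)) = 0) (α : ℝ) :
    ∃ S : C0Semigroup 𝕜 H, S.generatorGraph =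
      {p | ∃ w : diagDomain b N, p = ((w : H), diagOp b hN w - (α : 𝕜) • Λ w)} := by
  refine exists_semigroup_of_dissipative (dense_diagDomain b N) (diagOp b hN - (α : 𝕜) • Λ)
    (fun w => ?_) (l₀ := max 1 (α ^ 2 * C)) (fun l hl f => ?_)
  · rw [LinearMap.sub_apply, LinearMap.smul_apply, inner_sub_right, _root_.map_sub,
      inner_smul_right, RCLike.re_ofReal_mul, hskew, mul_zero, sub_zero]
    simpa using re_inner_diagOp_le hN w (μ := 0) fun k => Or.inl (hN k)
  · exact exists_sub_eq_of_bound Λ hN hC hΛ α ((le_max_left _ _).trans hl.le)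
      ((le_max_right _ _).trans_lt hl) f

/-- The indices in s are those whose basis vectors are orthogonal to the range of Λ, so the
corresponding coefficients obey decoupled scalar equations. Z is cut out by their vanishing, and the
rest of the spectrum of N is at least μ. -/
theorem decaysOn_diagOp_sub (hN : ∀ k, 0 ≤ N k)
    (hskew : ∀ w : diagDomain b N, RCLike.re (inner 𝕜 (w : H) (Λ w)) = 0) (α : ℝ)
    {S : C0Semigroup 𝕜 H} (hS : S.generatorGraph =
      {p | ∃ w : diagDomain b N, p = ((w : H), diagOp b hN w - (α : 𝕜) • Λ w)})
    {s : Set ι} {μ : ℝ} (hs : ∀ k ∉ s, μ ≤ N k)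
    (hsΛ : ∀ k ∈ s, ∀ w : diagDomain b N, inner 𝕜 (b k) (Λ w) = 0)
    {Z : Submodule 𝕜 H} (hZ : ∀ w, w ∈ Z ↔ ∀ k ∈ s, inner 𝕜 (b k) w = 0) :
    S.DecaysOn Z μ := by
  have hrepr : ∀ w ∈ Z, ∀ k, μ ≤ N k ∨ b.repr w k = 0 := by
    intro w hw k
    by_cases hk : k ∈ s
    · right
      rw [b.repr_apply_apply]
      exact (hZ w).1 hw k hk
    · exact Or.inl (hs k hk)
  refine C0Semigroup.decaysOn_of_generatorGraph ?_ ?_ ?_ ?_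
  · have : (Z : Set H) = ⋂ k ∈ s, {w | inner 𝕜 (b k) w = 0} := by
      ext w
      simp [hZ]
    rw [this]
    exact isClosed_biInter fun k _ =>
      isClosed_eq (innerSL 𝕜 (b k)).continuous continuous_const
  · intro x hx
    -- Partial sums of the expansion of x lie in the domain, and they stay in Z because the
    -- coefficients with index in s are already zero.
    refine mem_closure_of_tendsto (b.hasSum_repr x) (Eventually.of_forall fun t => ?_)
    refine ⟨Submodule.sum_mem _ fun k _ => ?_,
      diagOp b hN ⟨_, finset_sum_mem_diagDomain b N t fun k => b.repr x k⟩ -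
        (α : 𝕜) • Λ ⟨_, finset_sum_mem_diagDomain b N t fun k => b.repr x k⟩, ?_⟩
    · by_cases hk : k ∈ s
      · rw [b.repr_apply_apply, (hZ x).1 hx k hk, zero_smul]
        exact Z.zero_mem
      · refine Z.smul_mem _ ((hZ _).2 fun j hj => b.orthonormal.2 ?_)
        rintro rfl
        exact hk hj
    · rw [hS]
      exact ⟨⟨_, finset_sum_mem_diagDomain b N t fun k => b.repr x k⟩, rfl⟩
  · intro p hp hpZ t
    rw [hZ] at hpZ ⊢
    intro k hk
    refine C0Semigroup.inner_apply_eq_zero (c := -N k) ?_ hp (hpZ k hk) t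
    rw [hS]
    rintro _ ⟨w, rfl⟩
    rw [inner_sub_right, inner_smul_right, hsΛ k hk, mul_zero, sub_zero, ← b.repr_apply_apply,
      repr_diagOp, b.repr_apply_apply]
  · rw [hS]
    rintro _ ⟨w, rfl⟩ hwZ
    rw [inner_sub_right, _root_.map_sub, inner_smul_right, RCLike.re_ofReal_mul, hskew, mul_zero,
      sub_zero]
    exact re_inner_diagOp_le hN w (hrepr _ hwZ)

end Diagonal

/-! ### Functions of exponential growth as weights for the Gaussian space -/

/-- Continuous functions of at most exponential growth. -/
def Adm (q : Plane → ℝ) : Prop :=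
  Continuous q ∧ ∃ C c : ℝ, ∀ ξ, |q ξ| ≤ C * Real.exp (c * ‖ξ‖)

namespace Adm

variable {p q : Plane → ℝ}

theorem mul (hp : Adm p) (hq : Adm q) : Adm (p * q) := by
  obtain ⟨hpc, C, c, h⟩ := hp
  obtain ⟨hqc, C', c', h'⟩ := hq
  refine ⟨hpc.mul hqc, C * C', c + c', fun ξ => ?_⟩
  rw [Pi.mul_apply, abs_mul, add_mul, Real.exp_add]
  calc _ ≤ (C * Real.exp (c * ‖ξ‖)) * (C' * Real.exp (c' * ‖ξ‖)) :=
        mul_le_mul (h ξ) (h' ξ) (abs_nonneg _) ((abs_nonneg _).trans (h ξ))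
    _ = _ := by ring

theorem exists_nonneg (hp : Adm p) : ∃ C c : ℝ, 0 ≤ C ∧ 0 ≤ c ∧
    ∀ ξ, |p ξ| ≤ C * Real.exp (c * ‖ξ‖) := by
  obtain ⟨-, C, c, h⟩ := hp
  have hC : 0 ≤ C := by
    have := (abs_nonneg _).trans (h 0)
    simpa using this
  refine ⟨C, max c 0, hC, le_max_right _ _, fun ξ => (h ξ).trans ?_⟩
  gcongr
  exact le_max_left _ _

theorem add (hp : Adm p) (hq : Adm q) : Adm (p + q) := by
  obtain ⟨C, c, hC, hc, h⟩ := hp.exists_nonneg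
  obtain ⟨C', c', hC', hc', h'⟩ := hq.exists_nonneg
  refine ⟨hp.1.add hq.1, C + C', max c c', fun ξ => (abs_add_le _ _).trans ?_⟩
  rw [add_mul]
  refine add_le_add ((h ξ).trans ?_) ((h' ξ).trans ?_) <;> gcongr
  · exact le_max_left _ _
  · exact le_max_right _ _

theorem const (c : ℝ) : Adm fun _ => c :=
  ⟨continuous_const, |c|, 0, fun ξ => by simp⟩

theorem coord (i : Fin 2) : Adm fun ξ => ξ i := by
  refine ⟨by fun_prop, 1, 1, fun ξ => ?_⟩
  have h1 := PiLp.norm_apply_le ξ i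
  have h2 := Real.add_one_le_exp (1 * ‖ξ‖)
  rw [Real.norm_eq_abs] at h1
  linarith

theorem const_mul (c : ℝ) (hp : Adm p) : Adm fun ξ => c * p ξ := (const c).mul hp

theorem neg (hp : Adm p) : Adm (-p) := by
  convert hp.const_mul (-1) using 1
  ext ξ
  simp

theorem sub (hp : Adm p) (hq : Adm q) : Adm (p - q) := by
  rw [sub_eq_add_neg]
  exact hp.add hq.neg

theorem polynomial (f : Polynomial ℝ) (i : Fin 2) : Adm fun ξ => f.eval (ξ i) := by
  induction f using Polynomial.induction_on' with
  | add f g hf hg => simpa [Pi.add_def] using hf.add hg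
  | monomial n a =>
    induction n generalizing a with
    | zero => simpa using const a
    | succ n ih =>
      convert (ih a).mul (coord i) using 1
      ext ξ
      simp [pow_succ]
      ring

theorem of_bounded (hc : Continuous p) {C : ℝ} (h : ∀ ξ, |p ξ| ≤ C) : Adm p :=
  ⟨hc, C, 0, fun ξ => by simpa using h ξ⟩

theorem of_hasCompactSupport (hc : Continuous p) (h : HasCompactSupport p) : Adm p := by
  obtain ⟨C, hC⟩ := h.exists_bound_of_continuous hc
  exact of_bounded hc hC

end Adm

theorem continuous_oseenG : Continuous oseenG := by unfold oseenG; fun_prop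

/-- From (r - 4c)² ≥ 0 one gets cr - r²/4 ≤ 2c² - r²/8, which gives the constant. -/
theorem oseenG_le (c : ℝ) : ∃ C, ∀ ξ : Plane,
    Real.exp (c * ‖ξ‖) * oseenG ξ ≤ C * Real.exp (-(1 / 8) * ‖ξ‖ ^ 2) := by
  refine ⟨1 / (4 * Real.pi) * Real.exp (2 * c ^ 2), fun ξ => ?_⟩
  rw [oseenG, mul_left_comm, mul_assoc, ← Real.exp_add, ← Real.exp_add]
  refine mul_le_mul_of_nonneg_left (Real.exp_le_exp.2 ?_) (by positivity)
  nlinarith [sq_nonneg (‖ξ‖ - 4 * c)]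

theorem integrable_exp_neg_sq : Integrable fun ξ : Plane => Real.exp (-(1 / 8) * ‖ξ‖ ^ 2) := by
  have h := GaussianFourier.integrable_cexp_neg_mul_sq_norm_add (V := Plane) (b := (1 / 8 : ℂ))
    (by norm_num) 0 0
  refine h.norm.congr (Eventually.of_forall fun ξ => ?_)
  simp [Complex.norm_exp, ← Complex.ofReal_pow]

theorem Adm.integrable_mul_oseenG {p : Plane → ℝ} (hp : Adm p) :
    Integrable fun ξ => p ξ * oseenG ξ := by
  obtain ⟨C, c, hC, -, h⟩ := hp.exists_nonneg
  obtain ⟨C', hC'⟩ := oseenG_le c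
  refine (integrable_exp_neg_sq.const_mul (C * C')).mono'
    (hp.1.mul continuous_oseenG).aestronglyMeasurable (Eventually.of_forall fun ξ => ?_)
  have hG := oseenG_pos ξ
  rw [Real.norm_eq_abs, abs_mul, abs_of_pos hG, mul_assoc]
  calc _ ≤ C * Real.exp (c * ‖ξ‖) * oseenG ξ := by gcongr; exact h ξ
    _ = C * (Real.exp (c * ‖ξ‖) * oseenG ξ) := by ring
    _ ≤ C * (C' * Real.exp (-(1 / 8) * ‖ξ‖ ^ 2)) := mul_le_mul_of_nonneg_left (hC' ξ) hC
    _ = _ := by ring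

/-! ### Pairings in the Gaussian space -/

section GaussianSpace

variable (𝕜 : Type*) [RCLike 𝕜]

theorem measurable_density : Measurable fun ξ : Plane => ENNReal.ofReal (oseenG ξ)⁻¹ :=
  measurable_oseenG.inv.ennreal_ofReal

theorem gaussMeasure_ac : gaussMeasure ≪ (volume : Measure Plane) :=
  withDensity_absolutelyContinuous _ _

theorem integral_gaussMeasure {F : Type*} [NormedAddCommGroup F] [NormedSpace ℝ F]
    (f : Plane → F) : ∫ ξ, f ξ ∂gaussMeasure = ∫ ξ, (oseenG ξ)⁻¹ • f ξ := by
  rw [gaussMeasure, integral_withDensity_eq_integral_toReal_smul measurable_density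
    (Eventually.of_forall fun ξ => ENNReal.ofReal_lt_top)]
  refine integral_congr_ae (Eventually.of_forall fun ξ => ?_)
  simp only
  rw [ENNReal.toReal_ofReal (inv_nonneg.2 (oseenG_pos ξ).le)]

theorem integrable_gaussMeasure {F : Type*} [NormedAddCommGroup F] [NormedSpace ℝ F]
    {f : Plane → F} : Integrable f gaussMeasure ↔ Integrable fun ξ => (oseenG ξ)⁻¹ • f ξ := by
  rw [gaussMeasure, integrable_withDensity_iff_integrable_smul' measurable_density
    (Eventually.of_forall fun ξ => ENNReal.ofReal_lt_top)]
  refine integrable_congr (Eventually.of_forall fun ξ => ?_)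
  simp only
  rw [ENNReal.toReal_ofReal (inv_nonneg.2 (oseenG_pos ξ).le)]

variable {p q : Plane → ℝ}

theorem Adm.memLp (hp : Adm p) :
    MemLp (fun ξ => ((p ξ * oseenG ξ : ℝ) : 𝕜)) 2 gaussMeasure := by
  have hm : AEStronglyMeasurable (fun ξ => p ξ * oseenG ξ) gaussMeasure :=
    (hp.1.mul continuous_oseenG).aestronglyMeasurable
  have h1 : MemLp (fun ξ => p ξ * oseenG ξ) 2 gaussMeasure := by
    rw [memLp_two_iff_integrable_sq hm, integrable_gaussMeasure]
    refine (hp.mul hp).integrable_mul_oseenG.congr (Eventually.of_forall fun ξ => ?_)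
    have := (oseenG_pos ξ).ne'
    simp only [smul_eq_mul, Pi.mul_apply]
    field_simp
  exact h1.ofReal

/-- The function `p G` as an element of `X`. -/
def gvec (hp : Adm p) : X 𝕜 := (hp.memLp 𝕜).toLp _

theorem gvec_ae (hp : Adm p) : gvec 𝕜 hp =ᵐ[volume] fun ξ => ((p ξ * oseenG ξ : ℝ) : 𝕜) :=
  volume_ac_gaussMeasure.ae_le (hp.memLp 𝕜).coeFn_toLp

theorem integrable_inner_X (u w : X 𝕜) :
    Integrable fun ξ => (oseenG ξ)⁻¹ • inner 𝕜 (u ξ) (w ξ) :=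
  integrable_gaussMeasure.1 (L2.integrable_inner (𝕜 := 𝕜) u w)

theorem inner_X (u w : X 𝕜) : inner 𝕜 u w = ∫ ξ, (oseenG ξ)⁻¹ • inner 𝕜 (u ξ) (w ξ) := by
  rw [L2.inner_def, integral_gaussMeasure]

theorem inv_smul_inner_gvec_ae (hp : Adm p) (w : X 𝕜) :
    (fun ξ => (oseenG ξ)⁻¹ • inner 𝕜 (gvec 𝕜 hp ξ) (w ξ)) =ᵐ[volume] fun ξ => p ξ • w ξ := by
  filter_upwards [gvec_ae 𝕜 hp] with ξ h
  have := (oseenG_pos ξ).ne'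
  rw [h, RCLike.inner_apply, RCLike.conj_ofReal, mul_comm, ← RCLike.real_smul_eq_coe_mul, smul_smul]
  congr 1
  field_simp

/-- The weight G⁻¹ cancels the factor G. Thus a flat pairing with a weight of exponential growth is
a bounded functional on `X`, and distributional identities can be read as identities of inner
products. -/
theorem inner_gvec (hp : Adm p) (w : X 𝕜) : inner 𝕜 (gvec 𝕜 hp) w = ∫ ξ, p ξ • w ξ := by
  rw [inner_X]
  exact integral_congr_ae (inv_smul_inner_gvec_ae 𝕜 hp w)

variable {𝕜}

theorem Adm.integrable_smul (hp : Adm p) (w : X 𝕜) : Integrable fun ξ => p ξ • w ξ :=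
  (integrable_inner_X 𝕜 (gvec 𝕜 hp) w).congr (inv_smul_inner_gvec_ae 𝕜 hp w)

variable (𝕜)

theorem inner_gvec_gvec (hp : Adm p) (hq : Adm q) :
    inner 𝕜 (gvec 𝕜 hp) (gvec 𝕜 hq) = ((∫ ξ, p ξ * q ξ * oseenG ξ : ℝ) : 𝕜) := by
  rw [inner_gvec, ← integral_ofReal]
  refine integral_congr_ae ?_
  filter_upwards [gvec_ae 𝕜 hq] with ξ h
  rw [h, RCLike.real_smul_eq_coe_mul, ← RCLike.ofReal_mul, mul_assoc]

end GaussianSpace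

/-! ### Partial derivatives and integration by parts -/

theorem partialD_mul {f g : Plane → ℝ} (hf : Differentiable ℝ f) (hg : Differentiable ℝ g)
    (i : Fin 2) : partialD i (f * g) = partialD i f * g + f * partialD i g := by
  ext ξ
  simp only [partialD, Pi.add_apply, Pi.mul_apply]
  rw [fderiv_mul (hf ξ) (hg ξ)]
  simp
  ring

theorem partialD_add {f g : Plane → ℝ} (hf : Differentiable ℝ f) (hg : Differentiable ℝ g)
    (i : Fin 2) : partialD i (f + g) = partialD i f + partialD i g := by
  ext ξ
  simp only [partialD, Pi.add_apply]
  rw [fderiv_add (hf ξ) (hg ξ)]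
  simp

theorem partialD_const_mul {f : Plane → ℝ} (hf : Differentiable ℝ f) (c : ℝ)
    (i : Fin 2) : partialD i (fun ξ => c * f ξ) = fun ξ => c * partialD i f ξ := by
  ext ξ
  simp only [partialD]
  rw [fderiv_const_mul (hf ξ)]
  simp

theorem hasFDerivAt_coord (i : Fin 2) (ξ : Plane) :
    HasFDerivAt (fun ξ : Plane => ξ i) (EuclideanSpace.proj i : Plane →L[ℝ] ℝ) ξ :=
  (EuclideanSpace.proj i : Plane →L[ℝ] ℝ).hasFDerivAt

theorem partialD_coord (i j : Fin 2) :
    partialD i (fun ξ => ξ j) = fun _ => if j = i then 1 else 0 := by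
  ext ξ
  rw [partialD, (hasFDerivAt_coord j ξ).fderiv]
  simp

theorem partialD_comp_coord (f : Polynomial ℝ) (i j : Fin 2) :
    partialD i (fun ξ => f.eval (ξ j)) =
      fun ξ => if j = i then f.derivative.eval (ξ j) else 0 := by
  ext ξ
  have h := (f.hasDerivAt (ξ j)).comp_hasFDerivAt ξ (hasFDerivAt_coord j ξ)
  simp only [Function.comp_def] at h
  rw [partialD, h.fderiv]
  simp

theorem hasFDerivAt_oseenG (ξ : Plane) :
    HasFDerivAt oseenG (-(oseenG ξ / 2) • innerSL ℝ ξ) ξ := by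
  have h1 : HasFDerivAt (fun η : Plane => ‖η‖ ^ 2) (2 • innerSL ℝ ξ) ξ :=
    (hasStrictFDerivAt_norm_sq ξ).hasFDerivAt
  have h2 : HasFDerivAt (fun η : Plane => -(1 / 4) * ‖η‖ ^ 2)
      (-(1 / 4 : ℝ) • (2 • innerSL ℝ ξ)) ξ := h1.const_mul (-(1 / 4 : ℝ))
  have h3 := h2.exp.const_mul (1 / (4 * Real.pi))
  have h4 : ∀ η : Plane, -‖η‖ ^ 2 / 4 = -(1 / 4) * ‖η‖ ^ 2 := fun η => by ring
  refine (h3.congr_of_eventuallyEq (Eventually.of_forall fun η => ?_)).congr_fderiv ?_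
  · rw [oseenG, h4]
  · ext η
    simp only [oseenG, h4, _root_.smul_apply, smul_eq_mul, nsmul_eq_mul,
      innerSL_apply_apply, Nat.cast_ofNat]
    ring

theorem differentiable_oseenG : Differentiable ℝ oseenG := fun ξ =>
  (hasFDerivAt_oseenG ξ).differentiableAt

theorem partialD_oseenG (i : Fin 2) : partialD i oseenG = fun ξ => -(ξ i / 2) * oseenG ξ := by
  ext ξ
  rw [partialD, (hasFDerivAt_oseenG ξ).fderiv]
  simp [EuclideanSpace.inner_single_right]
  ring

/-- Differentiable functions which are admissible together with their first derivatives. -/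
structure Adm1 (q : Plane → ℝ) : Prop where
  diff : Differentiable ℝ q
  adm : Adm q
  adm_partialD : ∀ i, Adm (partialD i q)

theorem Adm1.mul {p q : Plane → ℝ} (hp : Adm1 p) (hq : Adm1 q) : Adm1 (p * q) where
  diff := hp.diff.mul hq.diff
  adm := hp.adm.mul hq.adm
  adm_partialD i := by
    rw [partialD_mul hp.diff hq.diff]
    exact ((hp.adm_partialD i).mul hq.adm).add (hp.adm.mul (hq.adm_partialD i))

theorem Adm1.coord (j : Fin 2) : Adm1 (fun ξ => ξ j) where
  diff := by fun_prop
  adm := Adm.coord j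
  adm_partialD i := by
    rw [partialD_coord]
    exact Adm.const _

theorem Adm1.polynomial (f : Polynomial ℝ) (j : Fin 2) : Adm1 (fun ξ => f.eval (ξ j)) where
  diff := f.differentiable.comp (by fun_prop)
  adm := Adm.polynomial f j
  adm_partialD i := by
    rw [partialD_comp_coord]
    split_ifs
    · exact Adm.polynomial _ j
    · exact Adm.const 0

/-- Integration by parts against the Gaussian weight. -/
theorem integral_partialD_mul_oseenG {p q : Plane → ℝ} (hp : Adm1 p) (hq : Adm1 q) (i : Fin 2) :
    ∫ ξ, partialD i p ξ * q ξ * oseenG ξ =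
      ∫ ξ, p ξ * (ξ i / 2 * q ξ - partialD i q ξ) * oseenG ξ := by
  have hg : Differentiable ℝ (q * oseenG) := hq.diff.mul differentiable_oseenG
  have h1 : ∀ ξ, partialD i (q * oseenG) ξ = -((ξ i / 2 * q ξ - partialD i q ξ) * oseenG ξ) := by
    intro ξ
    rw [partialD_mul hq.diff differentiable_oseenG, partialD_oseenG]
    simp only [Pi.add_apply, Pi.mul_apply]
    ring
  have hadm : Adm (fun ξ => ξ i / 2 * q ξ - partialD i q ξ) := by
    have := (((Adm.coord i).const_mul (1 / 2)).mul hq.adm).sub (hq.adm_partialD i)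
    convert this using 1
    ext ξ
    simp only [Pi.sub_apply, Pi.mul_apply]
    ring
  have key := integral_mul_fderiv_eq_neg_fderiv_mul_of_integrable (μ := (volume : Measure Plane))
    (f := p) (g := q * oseenG) (v := EuclideanSpace.single i 1)
    (by
      refine ((hp.adm_partialD i).mul hq.adm).integrable_mul_oseenG.congr
        (Eventually.of_forall fun ξ => ?_)
      simp only [Pi.mul_apply, partialD]
      ring)
    (by
      refine (hp.adm.mul hadm).integrable_mul_oseenG.neg.congr
        (Eventually.of_forall fun ξ => ?_)
      have := h1 ξ
      simp only [partialD] at this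
      simp only [Pi.mul_apply, Pi.neg_apply, this, partialD]
      ring)
    (by
      refine (hp.adm.mul hq.adm).integrable_mul_oseenG.congr
        (Eventually.of_forall fun ξ => ?_)
      simp only [Pi.mul_apply]
      ring)
    (fun ξ _ => hp.diff ξ) (fun ξ _ => hg ξ)
  have h2 : ∫ ξ, p ξ * partialD i (q * oseenG) ξ =
      -∫ ξ, partialD i p ξ * (q * oseenG) ξ := key
  simp only [h1, Pi.mul_apply] at h2
  have h3 := congrArg Neg.neg h2
  rw [neg_neg, ← integral_neg] at h3
  calc _ = ∫ ξ, partialD i p ξ * (q ξ * oseenG ξ) := by simp only [mul_assoc]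
    _ = _ := by
      rw [← h3]
      refine integral_congr_ae (Eventually.of_forall fun ξ => ?_)
      simp only
      ring

/-! ### Hermite polynomials for the weight `G` -/

open Polynomial in
/-- Hermite polynomials, orthogonal for the weight `exp (-x² / 4)`. -/
def herm : ℕ → Polynomial ℝ
  | 0 => 1
  | n + 1 => C (1 / 2) * Polynomial.X * herm n - derivative (herm n)

open Polynomial in
-- The commutator of d/dx with the raising operator x/2 - d/dx is 1/2, so each raising adds 1/2 to
-- the factor.
theorem derivative_herm_succ (n : ℕ) : derivative (herm (n + 1)) = C ((n + 1) / 2 : ℝ) * herm n := by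
  induction n with
  | zero => simp [herm]
  | succ n ih =>
    have h1 : derivative (derivative (herm (n + 1))) = C ((n + 1) / 2 : ℝ) * derivative (herm n) := by
      rw [ih, derivative_C_mul]
    have h2 : herm (n + 1) = C (1 / 2) * Polynomial.X * herm n - derivative (herm n) := by rw [herm]
    rw [herm, derivative_sub, h1, derivative_mul, ih, derivative_C_mul, derivative_X, mul_one]
    have h3 : (C (((n + 1 : ℕ) + 1) / 2 : ℝ) : ℝ[X]) = C (1 / 2) + C ((n + 1) / 2 : ℝ) := by
      rw [← C_add]
      congr 1
      push_cast
      ring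
    rw [h3]
    linear_combination (- C ((n + 1) / 2 : ℝ)) * h2

open Polynomial in
theorem eval_derivative_herm (n : ℕ) (x : ℝ) :
    (derivative (herm n)).eval x = n / 2 * (herm (n - 1)).eval x := by
  cases n with
  | zero => simp [herm]
  | succ n => simp [derivative_herm_succ]

open Polynomial in
-- By the three-term relation X H_m = 2H_{m+1} + 2H_m', multiplication by X preserves the span.
theorem X_pow_mem_span_herm (n : ℕ) : (Polynomial.X ^ n : ℝ[X]) ∈ Submodule.span ℝ (Set.range herm) := by
  have hX : ∀ p ∈ Submodule.span ℝ (Set.range herm), Polynomial.X * p ∈ Submodule.span ℝ (Set.range herm) := by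
    intro p hp
    induction hp using Submodule.span_induction with
    | mem p hp =>
      obtain ⟨m, rfl⟩ := hp
      have h1 : Polynomial.X * herm m = (2 : ℝ) • herm (m + 1) + (2 : ℝ) • derivative (herm m) := by
        rw [herm, ← smul_add, sub_add_cancel, smul_eq_C_mul, ← mul_assoc, ← mul_assoc, ← C_mul]
        norm_num
      rw [h1]
      refine Submodule.add_mem _ (Submodule.smul_mem _ _ (Submodule.subset_span ⟨_, rfl⟩))
        (Submodule.smul_mem _ _ ?_)
      cases m with
      | zero => simp [herm]
      | succ m =>
        rw [derivative_herm_succ, ← smul_eq_C_mul]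
        exact Submodule.smul_mem _ _ (Submodule.subset_span ⟨_, rfl⟩)
    | zero => simp
    | add p q _ _ hp hq => rw [mul_add]; exact Submodule.add_mem _ hp hq
    | smul c p _ hp => rw [mul_smul_comm]; exact Submodule.smul_mem _ _ hp
  induction n with
  | zero => exact Submodule.subset_span ⟨0, by simp [herm]⟩
  | succ n ih => rw [pow_succ']; exact hX _ ih

/-- Multi-indices. -/
abbrev MIdx : Type := Fin 2 → ℕ

/-- The product Hermite polynomials on the plane. -/
def hermP (k : MIdx) : Plane → ℝ :=
  (fun ξ => (herm (k 0)).eval (ξ 0)) * fun ξ => (herm (k 1)).eval (ξ 1)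

theorem hermP_apply (k : MIdx) (ξ : Plane) :
    hermP k ξ = (herm (k 0)).eval (ξ 0) * (herm (k 1)).eval (ξ 1) := rfl

theorem adm1_hermP (k : MIdx) : Adm1 (hermP k) :=
  (Adm1.polynomial _ 0).mul (Adm1.polynomial _ 1)

theorem adm_hermP (k : MIdx) : Adm (hermP k) := (adm1_hermP k).adm

/-- When `k i = 0` the truncated subtraction is harmless, because the prefactor vanishes. -/
theorem partialD_hermP (i : Fin 2) (k : MIdx) (ξ : Plane) :
    partialD i (hermP k) ξ = k i / 2 * hermP (k - Pi.single i 1) ξ := by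
  rw [hermP, partialD_mul (Adm1.polynomial _ 0).diff (Adm1.polynomial _ 1).diff,
    partialD_comp_coord, partialD_comp_coord, hermP_apply]
  fin_cases i <;> simp [eval_derivative_herm] <;> ring

/-- Equivalently ∂ᵢ(H_k G) = -H_{k+eᵢ} G: differentiation in `X` is a weighted shift of the Hermite
basis. -/
theorem hermP_add_single (i : Fin 2) (k : MIdx) (ξ : Plane) :
    hermP (k + Pi.single i 1) ξ = ξ i / 2 * hermP k ξ - partialD i (hermP k) ξ := by
  rw [hermP_apply, hermP, partialD_mul (Adm1.polynomial _ 0).diff (Adm1.polynomial _ 1).diff,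
    partialD_comp_coord, partialD_comp_coord]
  fin_cases i <;> simp [herm] <;> ring

theorem hermP_zero (ξ : Plane) : hermP 0 ξ = 1 := by simp [hermP_apply, herm]

theorem hermP_single (i : Fin 2) (ξ : Plane) : hermP (Pi.single i 1) ξ = ξ i / 2 := by
  fin_cases i <;> simp [hermP_apply, herm] <;> ring

/-! ### Orthogonality -/

/-- Raising and lowering are adjoint to each other for the weight G. Both the norms and the
orthogonality of the basis come from this. -/
theorem integral_hermP_add_single_mul (i : Fin 2) (k l : MIdx) :
    ∫ ξ, hermP (k + Pi.single i 1) ξ * hermP l ξ * oseenG ξ =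
      l i / 2 * ∫ ξ, hermP k ξ * hermP (l - Pi.single i 1) ξ * oseenG ξ := by
  have h1 := integral_partialD_mul_oseenG (adm1_hermP l) (adm1_hermP k) i
  simp only [← hermP_add_single] at h1
  simp only [partialD_hermP] at h1
  rw [← integral_const_mul]
  calc _ = ∫ ξ, hermP l ξ * hermP (k + Pi.single i 1) ξ * oseenG ξ := by
        simp only [mul_comm (hermP l _)]
    _ = _ := by
        rw [← h1]
        refine integral_congr_ae (Eventually.of_forall fun ξ => ?_)
        simp only
        ring

/-- The squared norm of `hermP k`. -/
def hermSq (k : MIdx) : ℝ := ∫ ξ, hermP k ξ * hermP k ξ * oseenG ξ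

theorem hermSq_add_single (i : Fin 2) (k : MIdx) :
    hermSq (k + Pi.single i 1) = (k i + 1) / 2 * hermSq k := by
  rw [hermSq, integral_hermP_add_single_mul, add_tsub_cancel_right]
  simp [hermSq]

theorem MIdx.cases (k : MIdx) : k = 0 ∨ ∃ (i : Fin 2) (l : MIdx), k = l + Pi.single i 1 := by
  by_cases h : k = 0
  · exact Or.inl h
  · obtain ⟨i, hi⟩ := Function.ne_iff.1 h
    refine Or.inr ⟨i, k - Pi.single i 1, funext fun j => ?_⟩
    have hi' : k i ≠ 0 := hi
    by_cases hj : j = i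
    · subst hj
      simp
      omega
    · simp [hj]

theorem MIdx.induction {P : MIdx → Prop} (h0 : P 0)
    (hs : ∀ i k, P k → P (k + Pi.single i 1)) (k : MIdx) : P k := by
  obtain ⟨n, hn⟩ : ∃ n, n = k 0 + k 1 := ⟨_, rfl⟩
  induction n generalizing k with
  | zero =>
    have : k = 0 := by
      ext j
      fin_cases j <;> simp <;> omega
    exact this ▸ h0
  | succ n ih =>
    rcases k.cases with rfl | ⟨i, l, rfl⟩
    · exact h0
    · refine hs i l (ih l ?_)
      fin_cases i <;> simp at hn <;> omega

theorem hermSq_pos (k : MIdx) : 0 < hermSq k := by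
  induction k using MIdx.induction with
  | h0 =>
    simp only [hermSq, hermP_zero, one_mul]
    rw [integral_pos_iff_support_of_nonneg (fun ξ => (oseenG_pos ξ).le)]
    · have : Function.support oseenG = Set.univ :=
        Set.eq_univ_of_forall fun ξ => (oseenG_pos ξ).ne'
      rw [this]
      exact Measure.measure_univ_pos.2 (NeZero.ne _)
    · simpa using (Adm.const 1).integrable_mul_oseenG
  | hs i k ih =>
    rw [hermSq_add_single]
    positivity

/-- Adjointness lowers both indices together until one factor is H_0, which is orthogonal to every
raised polynomial. -/
theorem integral_hermP_mul_of_ne {k l : MIdx} (h : k ≠ l) :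
    ∫ ξ, hermP k ξ * hermP l ξ * oseenG ξ = 0 := by
  have hz : ∀ {l : MIdx} , l ≠ 0 → ∫ ξ, hermP l ξ * hermP 0 ξ * oseenG ξ = 0 := by
    intro l hl
    rcases l.cases with rfl | ⟨i, l, rfl⟩
    · exact absurd rfl hl
    · rw [integral_hermP_add_single_mul]
      simp
  induction k using MIdx.induction generalizing l with
  | h0 =>
    rw [← hz h.symm]
    simp only [mul_comm (hermP l _)]
  | hs i k ih =>
    rw [integral_hermP_add_single_mul]
    by_cases hl : l i = 0
    · simp [hl]
    · rw [ih, mul_zero]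
      rintro rfl
      refine h (funext fun j => ?_)
      by_cases hj : j = i
      · subst hj
        simp
        omega
      · simp [hj]

/-! ### Completeness -/

section Complete

variable (𝕜 : Type*) [RCLike 𝕜]

/-- The normalized Hermite functions. -/
def hermFun (k : MIdx) : X 𝕜 := (((Real.sqrt (hermSq k))⁻¹ : ℝ) : 𝕜) • gvec 𝕜 (adm_hermP k)

variable {𝕜}

theorem inner_hermFun (k : MIdx) (w : X 𝕜) :
    inner 𝕜 (hermFun 𝕜 k) w = (((Real.sqrt (hermSq k))⁻¹ : ℝ) : 𝕜) * ∫ ξ, hermP k ξ • w ξ := by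
  rw [hermFun, inner_smul_left, RCLike.conj_ofReal, inner_gvec]

theorem inner_hermFun_eq_zero_iff (k : MIdx) (w : X 𝕜) :
    inner 𝕜 (hermFun 𝕜 k) w = 0 ↔ ∫ ξ, hermP k ξ • w ξ = 0 := by
  rw [inner_hermFun, mul_eq_zero, or_iff_right]
  have := Real.sqrt_pos.2 (hermSq_pos k)
  simpa using this.ne'

theorem orthonormal_hermFun : Orthonormal 𝕜 (hermFun 𝕜) := by
  rw [orthonormal_iff_ite]
  intro k l
  rw [hermFun, hermFun, inner_smul_left, inner_smul_right, inner_gvec_gvec, RCLike.conj_ofReal]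
  split_ifs with h
  · subst h
    have h1 := Real.sqrt_pos.2 (hermSq_pos k)
    have h2 : (Real.sqrt (hermSq k))⁻¹ * ((Real.sqrt (hermSq k))⁻¹ * hermSq k) = 1 := by
      nth_rewrite 3 [← Real.mul_self_sqrt (hermSq_pos k).le]
      field_simp
    rw [← hermSq, ← RCLike.ofReal_mul, ← RCLike.ofReal_mul, h2, RCLike.ofReal_one]
  · rw [integral_hermP_mul_of_ne h]
    simp

theorem adm_polynomials (p q : Polynomial ℝ) :
    Adm ((fun ξ => p.eval (ξ 0)) * fun ξ => q.eval (ξ 1)) :=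
  (Adm.polynomial p 0).mul (Adm.polynomial q 1)

theorem integral_polynomial_smul_eq_zero {w : X 𝕜} (h : ∀ k, ∫ ξ, hermP k ξ • w ξ = 0)
    {p q : Polynomial ℝ} (hp : p ∈ Submodule.span ℝ (Set.range herm))
    (hq : q ∈ Submodule.span ℝ (Set.range herm)) :
    ∫ ξ : Plane, (p.eval (ξ 0) * q.eval (ξ 1)) • w ξ = 0 := by
  induction hp using Submodule.span_induction with
  | zero => simp
  | add p p' _ _ h1 h2 =>
    simp only [Polynomial.eval_add, add_mul, add_smul]
    exact (integral_add ((adm_polynomials p q).integrable_smul w)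
      ((adm_polynomials p' q).integrable_smul w)).trans ((congrArg₂ (· + ·) h1 h2).trans (add_zero 0))
  | smul c p _ h1 =>
    simp only [Polynomial.eval_smul, smul_eq_mul, mul_assoc, mul_smul c]
    rw [integral_smul, h1, smul_zero]
  | mem p hp =>
    obtain ⟨m, rfl⟩ := hp
    induction hq using Submodule.span_induction with
    | zero => simp
    | add q q' _ _ h1 h2 =>
      simp only [Polynomial.eval_add, mul_add, add_smul]
      exact (integral_add ((adm_polynomials _ q).integrable_smul w)
        ((adm_polynomials _ q').integrable_smul w)).trans
          ((congrArg₂ (· + ·) h1 h2).trans (add_zero 0))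
    | smul c q _ h1 =>
      simp only [Polynomial.eval_smul, smul_eq_mul, mul_left_comm _ c, mul_smul c]
      rw [integral_smul, h1, smul_zero]
    | mem q hq =>
      obtain ⟨n, rfl⟩ := hq
      exact h ![m, n]

theorem integral_inner_pow_smul_eq_zero {w : X 𝕜} (h : ∀ k, ∫ ξ, hermP k ξ • w ξ = 0)
    (t : Plane) (n : ℕ) : ∫ ξ, (inner ℝ ξ t) ^ n • w ξ = 0 := by
  have h1 : ∀ ξ : Plane, (inner ℝ ξ t) ^ n • w ξ = ∑ m ∈ Finset.range (n + 1),
      (t 0 ^ m * t 1 ^ (n - m) * n.choose m) • ((ξ 0 ^ m * ξ 1 ^ (n - m)) • w ξ) := by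
    intro ξ
    have h2 : inner ℝ ξ t = t 0 * ξ 0 + t 1 * ξ 1 := by
      simp [PiLp.inner_apply, Fin.sum_univ_two]
    rw [h2, add_pow, Finset.sum_smul]
    refine Finset.sum_congr rfl fun m _ => ?_
    rw [smul_smul]
    congr 1
    ring
  have h3 : ∀ a b : ℕ, Integrable fun ξ : Plane => (ξ 0 ^ a * ξ 1 ^ b) • w ξ := fun a b => by
    simpa using (adm_polynomials (Polynomial.X ^ a) (Polynomial.X ^ b)).integrable_smul w
  simp only [h1]
  refine (integral_finsetSum _ fun m _ => (h3 m (n - m)).smul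
    (t 0 ^ m * t 1 ^ (n - m) * (n.choose m : ℝ))).trans (Finset.sum_eq_zero fun m _ => ?_)
  simp only [Pi.smul_apply]
  rw [integral_smul]
  have := integral_polynomial_smul_eq_zero h (X_pow_mem_span_herm m) (X_pow_mem_span_herm (n - m))
  simp only [Polynomial.eval_pow, Polynomial.eval_X] at this
  rw [this, smul_zero]

/-- A function with exponential moments all of whose polynomial moments vanish is zero. -/
theorem ae_eq_zero_of_moments {f : Plane → ℝ}
    (hf : ∀ c : ℝ, Integrable fun ξ => Real.exp (c * ‖ξ‖) * f ξ)
    (h : ∀ (t : Plane) (n : ℕ), ∫ ξ, (inner ℝ ξ t) ^ n * f ξ = 0) : f =ᵐ[volume] 0 := by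
  have hf0 : Integrable f := by simpa using hf 0
  have hchar : ∀ t : Plane, ∫ ξ, Complex.exp (inner ℝ ξ t * Complex.I) * (f ξ : ℂ) = 0 := by
    intro t
    -- The exponential series is integrated term by term; its terms sum in absolute value to
    -- exp(‖t‖‖ξ‖)|f(ξ)|, integrable by assumption.
    have h1 := hasSum_integral_of_dominated_convergence (μ := (volume : Measure Plane))
      (F := fun (n : ℕ) ξ => ((inner ℝ ξ t * Complex.I) ^ n / n.factorial) * (f ξ : ℂ))
      (f := fun ξ => Complex.exp (inner ℝ ξ t * Complex.I) * (f ξ : ℂ))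
      (fun n ξ => (‖t‖ * ‖ξ‖) ^ n / n.factorial * |f ξ|)
      (fun n => by
        refine AEStronglyMeasurable.mul ?_
          (Complex.continuous_ofReal.comp_aestronglyMeasurable hf0.aestronglyMeasurable)
        exact Continuous.aestronglyMeasurable (by fun_prop))
      (fun n => Eventually.of_forall fun ξ => by
        rw [norm_mul, norm_div, norm_pow, norm_mul, Complex.norm_I, mul_one, Complex.norm_natCast,
          Complex.norm_real, Complex.norm_real, Real.norm_eq_abs (f ξ)]
        gcongr
        rw [mul_comm]
        exact norm_inner_le_norm ξ t)
      (Eventually.of_forall fun ξ => (Real.summable_pow_div_factorial _).mul_right _)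
      (by
        refine (hf ‖t‖).norm.congr (Eventually.of_forall fun ξ => ?_)
        simp only
        rw [tsum_mul_right, norm_mul, Real.norm_of_nonneg (Real.exp_pos _).le, Real.norm_eq_abs,
          Real.exp_eq_exp_ℝ, NormedSpace.exp_eq_tsum_div])
      (Eventually.of_forall fun ξ => by
        have h2 := NormedSpace.expSeries_div_hasSum_exp (𝔸 := ℂ) (inner ℝ ξ t * Complex.I)
        rw [← Complex.exp_eq_exp_ℂ] at h2
        exact h2.mul_right _)
    refine h1.unique ?_
    convert hasSum_zero with n
    have h2 : ∀ ξ : Plane, ((inner ℝ ξ t * Complex.I) ^ n / n.factorial) * (f ξ : ℂ) =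
        (Complex.I ^ n / n.factorial) * (((inner ℝ ξ t) ^ n * f ξ : ℝ) : ℂ) := by
      intro ξ
      push_cast
      ring
    simp only [h2]
    rw [integral_const_mul, integral_complex_ofReal, h, Complex.ofReal_zero, mul_zero]
  have hpos : AEMeasurable (fun ξ => ENNReal.ofReal (f ξ)) volume :=
    hf0.aestronglyMeasurable.aemeasurable.ennreal_ofReal
  have hneg : AEMeasurable (fun ξ => ENNReal.ofReal (-f ξ)) volume :=
    hf0.aestronglyMeasurable.aemeasurable.neg.ennreal_ofReal
  have hfin1 : IsFiniteMeasure (volume.withDensity fun ξ : Plane => ENNReal.ofReal (f ξ)) :=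
    isFiniteMeasure_withDensity_ofReal hf0.2
  have hfin2 : IsFiniteMeasure (volume.withDensity fun ξ : Plane => ENNReal.ofReal (-f ξ)) :=
    isFiniteMeasure_withDensity_ofReal hf0.neg.2
  -- The vanishing Fourier transform of f says that its positive and negative parts, as finite
  -- measures, have the same characteristic function.
  have heq : (volume.withDensity fun ξ : Plane => ENNReal.ofReal (f ξ)) =
      volume.withDensity fun ξ => ENNReal.ofReal (-f ξ) := by
    refine Measure.ext_of_charFun (funext fun t => ?_)
    rw [charFun_apply, charFun_apply,
      integral_withDensity_eq_integral_toReal_smul₀ hpos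
        (Eventually.of_forall fun ξ => ENNReal.ofReal_lt_top),
      integral_withDensity_eq_integral_toReal_smul₀ hneg
        (Eventually.of_forall fun ξ => ENNReal.ofReal_lt_top), ← sub_eq_zero, ← integral_sub]
    · rw [← hchar t]
      refine integral_congr_ae (Eventually.of_forall fun ξ => ?_)
      simp only
      rw [← sub_smul, ENNReal.toReal_ofReal', ENNReal.toReal_ofReal']
      have : max (f ξ) 0 - max (-f ξ) 0 = f ξ := max_zero_sub_max_neg_zero_eq_self _
      rw [this, Complex.real_smul, mul_comm]
    · refine (hf0.norm).mono (hpos.ennreal_toReal.aestronglyMeasurable.smul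
        (Continuous.aestronglyMeasurable (by fun_prop))) (Eventually.of_forall fun ξ => ?_)
      rw [norm_smul, Complex.norm_exp_ofReal_mul_I, mul_one, ENNReal.toReal_ofReal', norm_norm,
        Real.norm_eq_abs, Real.norm_eq_abs, abs_of_nonneg (le_max_right _ _)]
      exact max_le (le_abs_self _) (abs_nonneg _)
    · refine (hf0.norm).mono (hneg.ennreal_toReal.aestronglyMeasurable.smul
        (Continuous.aestronglyMeasurable (by fun_prop))) (Eventually.of_forall fun ξ => ?_)
      rw [norm_smul, Complex.norm_exp_ofReal_mul_I, mul_one, ENNReal.toReal_ofReal', norm_norm,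
        Real.norm_eq_abs, Real.norm_eq_abs, abs_of_nonneg (le_max_right _ _)]
      exact max_le (neg_le_abs _) (abs_nonneg _)
  have hae := (withDensity_eq_iff hpos hneg (hf0.lintegral_lt_top.ne)).1 heq
  filter_upwards [hae] with ξ hξ
  rcases le_total 0 (f ξ) with h0 | h0
  · rw [ENNReal.ofReal_of_nonpos (neg_nonpos.2 h0), ENNReal.ofReal_eq_zero] at hξ
    exact le_antisymm hξ h0
  · rw [ENNReal.ofReal_of_nonpos h0, eq_comm, ENNReal.ofReal_eq_zero] at hξ
    exact le_antisymm h0 (neg_nonpos.1 hξ)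

theorem adm_exp_norm (c : ℝ) : Adm fun ξ => Real.exp (c * ‖ξ‖) :=
  ⟨by fun_prop, 1, c, fun ξ => by rw [abs_of_pos (Real.exp_pos _), one_mul]⟩

theorem adm_inner_pow (t : Plane) (n : ℕ) : Adm fun ξ => (inner ℝ ξ t) ^ n := by
  induction n with
  | zero => simpa using Adm.const 1
  | succ n ih =>
    have h : Adm fun ξ => inner ℝ ξ t := by
      convert ((Adm.coord 0).const_mul (t 0)).add ((Adm.coord 1).const_mul (t 1)) using 1
      ext ξ
      simp [PiLp.inner_apply, Fin.sum_univ_two]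
    simp only [pow_succ]
    exact ih.mul h

/-- Hermite polynomials span all polynomials, so all polynomial moments of w vanish; exp(c‖ξ‖)w is
integrable for every c because exp(c‖ξ‖)G lies in `X`. Real and imaginary parts are treated
separately. -/
theorem eq_zero_of_integral_hermP {w : X 𝕜} (h : ∀ k, ∫ ξ, hermP k ξ • w ξ = 0) : w = 0 := by
  have key : ∀ L : 𝕜 →L[ℝ] ℝ, (fun ξ => L (w ξ)) =ᵐ[volume] 0 := by
    intro L
    refine ae_eq_zero_of_moments (fun c => ?_) fun t n => ?_
    · simpa using L.integrable_comp ((adm_exp_norm c).integrable_smul w)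
    · have h1 := L.integral_comp_comm ((adm_inner_pow t n).integrable_smul w)
      rw [integral_inner_pow_smul_eq_zero h, _root_.map_zero] at h1
      simpa using h1
  refine (Lp.eq_zero_iff_ae_eq_zero).2 (gaussMeasure_ac.ae_le ?_)
  filter_upwards [key RCLike.reCLM, key RCLike.imCLM] with ξ h1 h2
  exact RCLike.ext (by simpa using h1) (by simpa using h2)

variable (𝕜)

/-- The Hermite functions form a Hilbert basis of `X`. -/
def hermBasis : HilbertBasis MIdx 𝕜 (X 𝕜) :=
  HilbertBasis.mkOfOrthogonalEqBot orthonormal_hermFun (by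
    rw [Submodule.eq_bot_iff]
    intro w hw
    refine eq_zero_of_integral_hermP fun k => ?_
    rw [← inner_hermFun_eq_zero_iff]
    exact Submodule.mem_orthogonal _ _ |>.1 hw _ (Submodule.subset_span ⟨k, rfl⟩))

@[simp]
theorem coe_hermBasis : ⇑(hermBasis 𝕜) = hermFun 𝕜 := HilbertBasis.coe_mkOfOrthogonalEqBot _ _

variable {𝕜}

theorem hermBasis_repr (w : X 𝕜) (k : MIdx) : (hermBasis 𝕜).repr w k =
    (((Real.sqrt (hermSq k))⁻¹ : ℝ) : 𝕜) * ∫ ξ, hermP k ξ • w ξ := by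
  rw [HilbertBasis.repr_apply_apply, coe_hermBasis, inner_hermFun]

end Complete

/-! ### Test functions and distributions defined by elements of `X` -/

theorem contDiff_partialD {f : Plane → ℝ} (hf : ContDiff ℝ ∞ f) (i : Fin 2) :
    ContDiff ℝ ∞ (partialD i f) :=
  (hf.fderiv_right (m := ∞) (by simp)).clm_apply contDiff_const

theorem ContDiff.differentiable_plane {f : Plane → ℝ} (hf : ContDiff ℝ ∞ f) :
    Differentiable ℝ f := hf.differentiable (by simp)

namespace IsTest

variable {φ : Plane → ℝ}

theorem partialD (hφ : IsTest φ) (i : Fin 2) : IsTest (partialD i φ) :=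
  ⟨contDiff_partialD hφ.1 i, hφ.2.fderiv_apply ℝ _⟩

theorem mul_left (hφ : IsTest φ) {a : Plane → ℝ} (ha : ContDiff ℝ ∞ a) : IsTest (a * φ) :=
  ⟨ha.mul hφ.1, hφ.2.mul_left⟩

theorem adm (hφ : IsTest φ) : Adm φ := Adm.of_hasCompactSupport hφ.1.continuous hφ.2

theorem adm1 (hφ : IsTest φ) : Adm1 φ where
  diff := ContDiff.differentiable_plane hφ.1
  adm := hφ.adm
  adm_partialD i := (hφ.partialD i).adm

end IsTest

section Distributions

variable {𝕜 : Type*} [RCLike 𝕜]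

/-- Elements of `X` are locally integrable, so test functions separate them. This is what makes the
distributional graph the graph of a function. -/
theorem EqFun.unique {T : Distr 𝕜} {f g : X 𝕜} (hf : EqFun T f) (hg : EqFun T g) : f = g := by
  have hL : ∀ w : X 𝕜, LocallyIntegrable (fun ξ => w ξ) volume := fun w => by
    simpa using ((Adm.const 1).integrable_smul w).locallyIntegrable
  refine Lp.ext (gaussMeasure_ac.ae_le ?_)
  refine ae_eq_of_integral_contDiff_smul_eq (hL f) (hL g) fun φ h1 h2 => ?_
  exact (hf φ ⟨h1, h2⟩).symm.trans (hg φ ⟨h1, h2⟩)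

theorem ofFun_eq_inner {p : Plane → ℝ} (hp : Adm p) (w : X 𝕜) :
    ofFun w p = inner 𝕜 (gvec 𝕜 hp) w := (inner_gvec 𝕜 hp w).symm

theorem ofFun_add_left {p q : Plane → ℝ} (hp : Adm p) (hq : Adm q) (w : X 𝕜) :
    ofFun w (p + q) = ofFun w p + ofFun w q := by
  simp only [ofFun, Pi.add_apply, add_smul]
  exact integral_add (hp.integrable_smul w) (hq.integrable_smul w)

theorem ofFun_const_mul (c : ℝ) (p : Plane → ℝ) (w : X 𝕜) :
    ofFun w (fun ξ => c * p ξ) = c • ofFun w p := by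
  simp only [ofFun, mul_smul]
  exact integral_smul _ _

/-! ### Cutting off weights of exponential growth -/

/-- A fixed cutoff function. -/
def bump : ContDiffBump (0 : Plane) := ⟨1, 2, one_pos, one_lt_two⟩

theorem isTest_bump : IsTest bump := ⟨bump.contDiff, bump.hasCompactSupport⟩

/-- Dilated cutoff functions. -/
def cutoff (n : ℕ) (ξ : Plane) : ℝ := bump ((n + 1 : ℝ)⁻¹ • ξ)

theorem contDiff_cutoff (n : ℕ) : ContDiff ℝ ∞ (cutoff n) :=
  bump.contDiff.comp (contDiff_const_smul _)

theorem isTest_mul_cutoff {q : Plane → ℝ} (hq : ContDiff ℝ ∞ q) (n : ℕ) :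
    IsTest (q * cutoff n) := by
  refine IsTest.mul_left ⟨contDiff_cutoff n, ?_⟩ hq
  exact bump.hasCompactSupport.comp_homeomorph (Homeomorph.smulOfNeZero ((n + 1 : ℝ)⁻¹)
    (inv_ne_zero (by positivity)))

theorem partialD_comp_smul {f : Plane → ℝ} (hf : Differentiable ℝ f) (c r : ℝ) (i : Fin 2) :
    partialD i (fun ξ => c * f (r • ξ)) = fun ξ => c * r * partialD i f (r • ξ) := by
  ext ξ
  have h1 : HasFDerivAt (fun ξ : Plane => f (r • ξ)) (r • fderiv ℝ f (r • ξ)) ξ := by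
    have h2 : HasFDerivAt (fun ξ : Plane => r • ξ) (r • ContinuousLinearMap.id ℝ Plane) ξ :=
      (hasFDerivAt_id ξ).const_smul r
    refine ((hf _).hasFDerivAt.comp ξ h2).congr_fderiv ?_
    ext η
    simp
  rw [partialD, (h1.const_mul c).fderiv]
  simp [partialD, mul_assoc]

theorem partialD_cutoff (n : ℕ) (i : Fin 2) : partialD i (cutoff n) =
    fun ξ => (n + 1 : ℝ)⁻¹ * partialD i bump ((n + 1 : ℝ)⁻¹ • ξ) := by
  have := partialD_comp_smul (isTest_bump.adm1.diff) 1 ((n + 1 : ℝ)⁻¹) i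
  simp only [one_mul] at this
  exact this

theorem partialD_partialD_cutoff (n : ℕ) (i j : Fin 2) : partialD j (partialD i (cutoff n)) =
    fun ξ => (n + 1 : ℝ)⁻¹ * (n + 1 : ℝ)⁻¹ *
      partialD j (partialD i bump) ((n + 1 : ℝ)⁻¹ • ξ) := by
  rw [partialD_cutoff]
  exact partialD_comp_smul (isTest_bump.partialD i).adm1.diff _ _ j

theorem eventually_cutoff_eventuallyEq (ξ : Plane) : ∀ᶠ n in atTop, cutoff n =ᶠ[𝓝 ξ] 1 := by
  filter_upwards [eventually_gt_atTop ⌈‖ξ‖⌉₊] with n hn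
  have hn' : ‖ξ‖ < n + 1 := by
    have := Nat.lt_of_ceil_lt hn
    linarith
  have h1 : ∀ᶠ η in 𝓝 ξ, ‖η‖ < n + 1 := continuous_norm.continuousAt.eventually_lt_const hn'
  filter_upwards [h1] with η hη
  refine bump.one_of_mem_closedBall ?_
  rw [mem_closedBall_zero_iff, norm_smul, norm_inv, Real.norm_of_nonneg (by positivity)]
  change _ ≤ 1
  rw [inv_mul_le_one₀ (by positivity)]
  exact hη.le

theorem eventuallyEq_partialD {f g : Plane → ℝ} {ξ : Plane} (h : f =ᶠ[𝓝 ξ] g) (i : Fin 2) :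
    partialD i f =ᶠ[𝓝 ξ] partialD i g := by
  filter_upwards [h.fderiv (𝕜 := ℝ)] with η hη
  rw [partialD, partialD, hη]

/-- Dominated convergence in the form suited to cutoffs, which at each point eventually have no
effect. -/
theorem tendsto_ofFun_of_bound {f : ℕ → Plane → ℝ} {g B : Plane → ℝ} (hf : ∀ n, Continuous (f n))
    (hB : Adm B) (hb : ∀ n ξ, |f n ξ| ≤ B ξ) (h : ∀ ξ, ∀ᶠ n in atTop, f n ξ = g ξ) (w : X 𝕜) :
    Tendsto (fun n => ofFun w (f n)) atTop (𝓝 (ofFun w g)) := by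
  have hw : AEStronglyMeasurable (fun ξ => w ξ) (volume : Measure Plane) := by
    simpa using ((Adm.const 1).integrable_smul w).aestronglyMeasurable
  refine tendsto_integral_of_dominated_convergence (fun ξ => ‖B ξ • w ξ‖)
    (fun n => (hf n).aestronglyMeasurable.smul hw) (hB.integrable_smul w).norm
    (fun n => Eventually.of_forall fun ξ => ?_) (Eventually.of_forall fun ξ => ?_)
  · rw [norm_smul, norm_smul]
    gcongr
    rw [Real.norm_eq_abs]
    exact (hb n ξ).trans (le_abs_self _)
  · exact tendsto_const_nhds.congr' ((h ξ).mono fun n hn => by simp only [hn])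

theorem Adm.abs {p : Plane → ℝ} (hp : Adm p) : Adm fun ξ => |p ξ| := by
  obtain ⟨hc, C, c, h⟩ := hp
  exact ⟨hc.abs, C, c, fun ξ => by simpa using h ξ⟩

theorem abs_inv_mul_le {C x : ℝ} (h : |x| ≤ C) (n : ℕ) : |(n + 1 : ℝ)⁻¹ * x| ≤ C := by
  have h1 : (n + 1 : ℝ)⁻¹ ≤ 1 := inv_le_one_of_one_le₀ (by linarith [n.cast_nonneg (α := ℝ)])
  rw [abs_mul, abs_of_pos (by positivity)]
  exact (mul_le_of_le_one_left (abs_nonneg _) h1).trans h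

/-- Each derivative of the dilated cutoff brings a factor (n + 1)⁻¹ ≤ 1, hence bounds uniform in n.
-/
theorem exists_bound_cutoff (i : Fin 2) : ∃ C : ℝ, 0 ≤ C ∧ ∀ (n : ℕ) (ξ : Plane),
    |partialD i (cutoff n) ξ| ≤ C ∧ |partialD i (partialD i (cutoff n)) ξ| ≤ C := by
  obtain ⟨C₁, h₁⟩ := (isTest_bump.partialD i).2.exists_bound_of_continuous
    (isTest_bump.partialD i).1.continuous
  obtain ⟨C₂, h₂⟩ := ((isTest_bump.partialD i).partialD i).2.exists_bound_of_continuous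
    ((isTest_bump.partialD i).partialD i).1.continuous
  simp only [Real.norm_eq_abs] at h₁ h₂
  refine ⟨max C₁ C₂, le_max_of_le_left ((abs_nonneg _).trans (h₁ 0)), fun n ξ => ⟨?_, ?_⟩⟩
  · rw [partialD_cutoff]
    exact (abs_inv_mul_le (h₁ _) n).trans (le_max_left _ _)
  · rw [partialD_partialD_cutoff]
    simp only [mul_assoc]
    exact (abs_inv_mul_le (abs_inv_mul_le (h₂ _) n) n).trans (le_max_right _ _)

theorem abs_cutoff_le (n : ℕ) (ξ : Plane) : |cutoff n ξ| ≤ 1 := by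
  rw [cutoff, abs_of_nonneg bump.nonneg]
  exact bump.le_one

theorem tendsto_ofFun_mul_cutoff {q : Plane → ℝ} (hq : Adm q) (w : X 𝕜) :
    Tendsto (fun n => ofFun w (q * cutoff n)) atTop (𝓝 (ofFun w q)) := by
  refine tendsto_ofFun_of_bound (fun n => hq.1.mul (contDiff_cutoff n).continuous) hq.abs
    (fun n ξ => ?_) (fun ξ => ?_) w
  · rw [Pi.mul_apply, abs_mul]
    exact mul_le_of_le_one_right (abs_nonneg _) (abs_cutoff_le n ξ)
  · filter_upwards [eventually_cutoff_eventuallyEq ξ] with n hn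
    simp [hn.eq_of_nhds]

theorem eventually_mul_cutoff (q : Plane → ℝ) (ξ : Plane) :
    ∀ᶠ n in atTop, q * cutoff n =ᶠ[𝓝 ξ] q := by
  filter_upwards [eventually_cutoff_eventuallyEq ξ] with n hn
  filter_upwards [hn] with η hη
  simp [hη]

theorem tendsto_ofFun_partialD_mul_cutoff {q : Plane → ℝ} (hq : Adm1 q) (hs : ContDiff ℝ ∞ q)
    (i : Fin 2) (w : X 𝕜) :
    Tendsto (fun n => ofFun w (partialD i (q * cutoff n))) atTop (𝓝 (ofFun w (partialD i q))) := by
  obtain ⟨C, hC0, hC⟩ := exists_bound_cutoff i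
  refine tendsto_ofFun_of_bound
    (fun n => (contDiff_partialD (isTest_mul_cutoff hs n).1 i).continuous)
    ((hq.adm_partialD i).abs.add (hq.adm.abs.const_mul C)) (fun n ξ => ?_) (fun ξ => ?_) w
  · rw [partialD_mul hq.diff (ContDiff.differentiable_plane (contDiff_cutoff n))]
    simp only [Pi.add_apply, Pi.mul_apply]
    refine (abs_add_le _ _).trans (add_le_add ?_ ?_)
    · rw [abs_mul]
      exact mul_le_of_le_one_right (abs_nonneg _) (abs_cutoff_le n ξ)
    · rw [abs_mul, mul_comm]
      gcongr
      exact (hC n ξ).1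
  · filter_upwards [eventually_mul_cutoff q ξ] with n hn
    exact (eventuallyEq_partialD hn i).eq_of_nhds

theorem tendsto_ofFun_partialD_partialD_mul_cutoff {q : Plane → ℝ} (hq : Adm1 q) (i : Fin 2)
    (hq' : Adm1 (partialD i q)) (hs : ContDiff ℝ ∞ q) (w : X 𝕜) :
    Tendsto (fun n => ofFun w (partialD i (partialD i (q * cutoff n)))) atTop
      (𝓝 (ofFun w (partialD i (partialD i q)))) := by
  obtain ⟨C, hC0, hC⟩ := exists_bound_cutoff i
  have hs' := contDiff_partialD hs i
  refine tendsto_ofFun_of_bound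
    (fun n => (contDiff_partialD (contDiff_partialD (isTest_mul_cutoff hs n).1 i) i).continuous)
    ((hq'.adm_partialD i).abs.add (((hq.adm_partialD i).abs.const_mul (2 * C)).add
      (hq.adm.abs.const_mul C))) (fun n ξ => ?_) (fun ξ => ?_) w
  · have hd := ContDiff.differentiable_plane (contDiff_cutoff n)
    have hd' := ContDiff.differentiable_plane (contDiff_partialD (contDiff_cutoff n) i)
    rw [partialD_mul hq.diff hd, partialD_add (hq'.diff.mul hd) (hq.diff.mul hd'),
      partialD_mul hq'.diff hd, partialD_mul hq.diff hd']
    simp only [Pi.add_apply, Pi.mul_apply]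
    have h1 : |partialD i (partialD i q) ξ * cutoff n ξ| ≤ |partialD i (partialD i q) ξ| := by
      rw [abs_mul]
      exact mul_le_of_le_one_right (abs_nonneg _) (abs_cutoff_le n ξ)
    have h2 : |partialD i q ξ * partialD i (cutoff n) ξ| ≤ C * |partialD i q ξ| := by
      rw [abs_mul, mul_comm]
      gcongr
      exact (hC n ξ).1
    have h3 : |q ξ * partialD i (partialD i (cutoff n)) ξ| ≤ C * |q ξ| := by
      rw [abs_mul, mul_comm]
      gcongr
      exact (hC n ξ).2
    refine (abs_add_le _ _).trans ?_
    have h4 := abs_add_le (partialD i (partialD i q) ξ * cutoff n ξ)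
      (partialD i q ξ * partialD i (cutoff n) ξ)
    have h5 := abs_add_le (partialD i q ξ * partialD i (cutoff n) ξ)
      (q ξ * partialD i (partialD i (cutoff n)) ξ)
    linarith
  · filter_upwards [eventually_mul_cutoff q ξ] with n hn
    exact (eventuallyEq_partialD (eventuallyEq_partialD hn i) i).eq_of_nhds

/-! ### The Hermite coefficients of `𝓛 w` -/

theorem contDiff_hermP (k : MIdx) : ContDiff ℝ ∞ (hermP k) := by
  have h : ∀ (p : Polynomial ℝ) (i : Fin 2), ContDiff ℝ ∞ fun ξ : Plane => p.eval (ξ i) := by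
    intro p i
    have h1 : ContDiff ℝ ∞ fun x : ℝ => p.eval x := by
      simpa using p.contDiff_aeval (𝕜 := ℝ) ∞
    exact h1.comp (by fun_prop)
  exact (h _ 0).mul (h _ 1)

theorem partialD_hermP_eq (i : Fin 2) (k : MIdx) :
    partialD i (hermP k) = fun ξ => k i / 2 * hermP (k - Pi.single i 1) ξ :=
  funext fun ξ => partialD_hermP i k ξ

theorem Adm1.const_mul {q : Plane → ℝ} (hq : Adm1 q) (c : ℝ) : Adm1 fun ξ => c * q ξ where
  diff := hq.diff.const_mul c
  adm := hq.adm.const_mul c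
  adm_partialD i := by
    rw [partialD_const_mul hq.diff]
    exact (hq.adm_partialD i).const_mul c

theorem adm1_partialD_hermP (i : Fin 2) (k : MIdx) : Adm1 (partialD i (hermP k)) := by
  rw [partialD_hermP_eq]
  exact (adm1_hermP _).const_mul _

theorem contDiff_coord (i : Fin 2) : ContDiff ℝ ∞ fun ξ : Plane => ξ i := by fun_prop

theorem partialD_partialD_hermP (i : Fin 2) (k : MIdx) (ξ : Plane) :
    partialD i (partialD i (hermP k)) ξ - ξ i / 2 * partialD i (hermP k) ξ =
      -(k i / 2) * hermP k ξ := by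
  rw [partialD_hermP_eq, partialD_const_mul (adm1_hermP _).diff]
  simp only
  rcases Nat.eq_zero_or_pos (k i) with h | h
  · simp [h]
  · have h1 := hermP_add_single i (k - Pi.single i 1) ξ
    have h2 : k - Pi.single i 1 + Pi.single i 1 = k := by
      ext j
      by_cases hj : j = i
      · subst hj
        simp
        omega
      · simp [hj]
    rw [h2] at h1
    rw [h1]
    ring

/-- The eigenvalues of `-𝓛`. -/
def deg (k : MIdx) : ℝ := (k 0 + k 1) / 2

theorem deg_nonneg (k : MIdx) : 0 ≤ deg k := by unfold deg; positivity

theorem deg_add_single (i : Fin 2) (k : MIdx) : deg (k + Pi.single i 1) = deg k + 1 / 2 := by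
  fin_cases i <;> simp [deg] <;> ring

/-- The formal adjoint of `𝓛`, acting on functions. -/
def adjL (φ : Plane → ℝ) (ξ : Plane) : ℝ :=
  ∑ i, (partialD i (partialD i φ) ξ - ξ i / 2 * partialD i φ ξ)

theorem adjL_hermP (k : MIdx) : adjL (hermP k) = fun ξ => -deg k * hermP k ξ := by
  ext ξ
  simp only [adjL, partialD_partialD_hermP, Fin.sum_univ_two, deg]
  ring

theorem Adm.sum_two {p : Fin 2 → Plane → ℝ} (h : ∀ i, Adm (p i)) : Adm fun ξ => ∑ i, p i ξ := by
  simp only [Fin.sum_univ_two]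
  exact (h 0).add (h 1)

theorem ofFun_sum_two {p : Fin 2 → Plane → ℝ} (h : ∀ i, Adm (p i)) (w : X 𝕜) :
    ofFun w (fun ξ => ∑ i, p i ξ) = ∑ i, ofFun w (p i) := by
  simp only [Fin.sum_univ_two]
  exact ofFun_add_left (h 0) (h 1) w

theorem partialD_coord_mul {φ : Plane → ℝ} (hφ : Differentiable ℝ φ) (i : Fin 2) :
    partialD i ((fun ξ => ξ i) * φ) = φ + (fun ξ => ξ i) * partialD i φ := by
  rw [partialD_mul (by fun_prop) hφ, partialD_coord]
  ext ξ
  simp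

/-- The flat transpose of 𝓛 is Δφ - ½ div(ξφ) + φ. In dimension two div ξ = 2, so the zeroth-order
terms cancel and `adjL` has none. -/
theorem ofFun_adjL {φ : Plane → ℝ} (hφ : Adm1 φ) (hφ' : ∀ i, Adm1 (partialD i φ)) (w : X 𝕜) :
    ofFun w (adjL φ) = ∑ i, ofFun w (partialD i (partialD i φ)) -
      (1 / 2 : ℝ) • ∑ i, ofFun w (partialD i ((fun ξ => ξ i) * φ)) + ofFun w φ := by
  have h1 : ∀ i, Adm fun ξ : Plane => -(1 / 2) * partialD i ((fun ξ => ξ i) * φ) ξ := fun i =>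
    (((Adm1.coord i).mul hφ).adm_partialD i).const_mul _
  have h2 : adjL φ = (fun ξ => ∑ i, partialD i (partialD i φ) ξ) +
      ((fun ξ => ∑ i, -(1 / 2) * partialD i ((fun ξ => ξ i) * φ) ξ) + φ) := by
    ext ξ
    simp only [adjL, partialD_coord_mul hφ.diff, Pi.add_apply, Pi.mul_apply, Fin.sum_univ_two]
    ring
  have h3 : ∀ i, Adm (partialD i (partialD i φ)) := fun i => (hφ' i).adm_partialD i
  rw [h2, ofFun_add_left (Adm.sum_two h3) ((Adm.sum_two h1).add hφ.adm),
    ofFun_add_left (Adm.sum_two h1) hφ.adm, ofFun_sum_two h3, ofFun_sum_two h1]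
  simp only [ofFun_const_mul, Fin.sum_univ_two, neg_smul, smul_add]
  abel

theorem laplacianD_ofFun (w : X 𝕜) (φ : Plane → ℝ) :
    laplacianD (ofFun w) φ = ∑ i, ofFun w (partialD i (partialD i φ)) := by
  simp [laplacianD, derivD, Finset.sum_apply]

theorem transportD_id_ofFun (w : X 𝕜) (φ : Plane → ℝ) :
    transportD id (ofFun w) φ = -∑ i, ofFun w (partialD i ((fun ξ => ξ i) * φ)) := by
  simp [transportD, derivD, mulD, Finset.sum_apply]

theorem opL_ofFun (w : X 𝕜) {φ : Plane → ℝ} (hφ : IsTest φ) :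
    opL w φ = ofFun w (adjL φ) := by
  rw [ofFun_adjL hφ.adm1 (fun i => (hφ.partialD i).adm1)]
  simp only [opL, Pi.add_apply, Pi.smul_apply, laplacianD_ofFun, transportD_id_ofFun, smul_neg]
  ring

theorem ofFun_add_X {p : Plane → ℝ} (hp : Adm p) (u w : X 𝕜) :
    ofFun (u + w : X 𝕜) p = ofFun u p + ofFun w p := by
  rw [ofFun_eq_inner hp, ofFun_eq_inner hp, ofFun_eq_inner hp, inner_add_right]

theorem ofFun_smul_X {p : Plane → ℝ} (hp : Adm p) (c : 𝕜) (w : X 𝕜) :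
    ofFun (c • w : X 𝕜) p = c * ofFun w p := by
  rw [ofFun_eq_inner hp, ofFun_eq_inner hp, inner_smul_right]

/-- For `w ∈ D(𝓛)` there is `g ∈ X` whose Hermite coefficients are those of `𝓛 w`. -/
theorem exists_hermite_coeff_of_mem_domL {w : X 𝕜} (hw : w ∈ domL 𝕜) :
    ∃ g : X 𝕜, ∀ k, ofFun g (hermP k) = ((-deg k : ℝ) : 𝕜) * ofFun w (hermP k) := by
  obtain ⟨⟨g₁, h₁⟩, g₂, h₂⟩ := hw
  refine ⟨g₁ + ((1 / 2 : ℝ) : 𝕜) • g₂ + w, fun k => ?_⟩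
  have hP := adm_hermP k
  have hs := contDiff_hermP k
  -- Hermite polynomials are not test functions: the distributional identity is applied to their
  -- cutoffs and passes to the limit on both sides.
  have e1 : ofFun g₁ (hermP k) = ∑ i, ofFun w (partialD i (partialD i (hermP k))) := by
    refine tendsto_nhds_unique (tendsto_ofFun_mul_cutoff hP g₁) ?_
    refine (tendsto_finsetSum Finset.univ fun i _ => tendsto_ofFun_partialD_partialD_mul_cutoff
      (adm1_hermP k) i (adm1_partialD_hermP i k) hs w).congr fun n => ?_
    rw [← laplacianD_ofFun, h₁ _ (isTest_mul_cutoff hs n)]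
  have e2 : ofFun g₂ (hermP k) = -∑ i, ofFun w (partialD i ((fun ξ => ξ i) * hermP k)) := by
    refine tendsto_nhds_unique (tendsto_ofFun_mul_cutoff hP g₂) ?_
    refine (tendsto_finsetSum Finset.univ fun i _ => tendsto_ofFun_partialD_mul_cutoff
      ((Adm1.coord i).mul (adm1_hermP k)) ((contDiff_coord i).mul hs) i w).neg.congr fun n => ?_
    rw [← h₂ _ (isTest_mul_cutoff hs n), transportD_id_ofFun]
    simp only [mul_assoc]
  have e3 := ofFun_adjL (adm1_hermP k) (fun i => adm1_partialD_hermP i k) w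
  rw [adjL_hermP, ofFun_const_mul, RCLike.real_smul_eq_coe_mul] at e3
  rw [ofFun_add_X hP, ofFun_add_X hP, ofFun_smul_X hP, e1, e2, e3, RCLike.real_smul_eq_coe_mul]
  ring

theorem hermBasis_repr_ofFun (w : X 𝕜) (k : MIdx) : (hermBasis 𝕜).repr w k =
    (((Real.sqrt (hermSq k))⁻¹ : ℝ) : 𝕜) * ofFun w (hermP k) := hermBasis_repr w k

variable (𝕜) in
/-- The domain of `𝓛` in terms of Hermite coefficients. -/
abbrev hermDomain : Submodule 𝕜 (X 𝕜) := diagDomain (hermBasis 𝕜) deg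

theorem mem_hermDomain_of_mem_domL {w : X 𝕜} (hw : w ∈ domL 𝕜) : w ∈ hermDomain 𝕜 := by
  obtain ⟨g, hg⟩ := exists_hermite_coeff_of_mem_domL hw
  rw [mem_diagDomain]
  -- Here g plays the role of 𝓛w, so w - g has coefficients (1 + deg k) times those of w, and they
  -- are square-summable because w - g is in `X`.
  refine (summable_norm_sq_repr (hermBasis 𝕜) (w - g)).congr fun k => ?_
  have h1 : (hermBasis 𝕜).repr (w - g) k = ((1 + deg k : ℝ) : 𝕜) * (hermBasis 𝕜).repr w k := by
    rw [_root_.map_sub, lp.coeFn_sub, Pi.sub_apply, hermBasis_repr_ofFun g, hg,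
      hermBasis_repr_ofFun w]
    push_cast
    ring
  rw [h1, norm_mul, mul_pow, RCLike.norm_ofReal, sq_abs]

end Distributions

/-! ### Transposes of weighted shifts -/

section ShiftPairing

variable {𝕜 H ι : Type*} [RCLike 𝕜] [NormedAddCommGroup H] [InnerProductSpace 𝕜 H]
  [CompleteSpace H] {b : HilbertBasis ι 𝕜 H} {N : ι → ℝ}

/-- Both sides are sums over the basis expansion of w, so an identity on basis vectors passes to the
whole domain. It identifies weighted shifts with weak derivatives without approximating w. -/
theorem inner_eq_inner_weightedShift {σ : ι → ι} (hσ : σ.Injective) {c : ι → ℝ} {C : ℝ}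
    (hc : ∀ k, c k ^ 2 ≤ C * (1 + N k) ^ 2) {u v : H} {s : 𝕜}
    (h : ∀ k, inner 𝕜 u (b k) = s * (c k * inner 𝕜 v (b (σ k)))) (w : diagDomain b N) :
    inner 𝕜 u (w : H) = s * inner 𝕜 v (weightedShift b hσ hc w) := by
  have h1 := (b.hasSum_repr (w : H)).mapL (innerSL 𝕜 u)
  have h2 := ((hasSum_weightedShift hσ hc w).mapL (innerSL 𝕜 v)).mul_left s
  refine h1.unique (h2.congr_fun ?_)
  intro k
  simp only [innerSL_apply_apply, inner_smul_right]
  rw [h]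
  ring

end ShiftPairing

/-! ### Weak derivatives in Hermite coordinates and the domain of 𝓛 -/

section WeakDerivatives

variable {𝕜 : Type*} [RCLike 𝕜]

theorem inner_gvec_hermFun {p : Plane → ℝ} (hp : Adm p) (k : MIdx) :
    inner 𝕜 (gvec 𝕜 hp) (hermFun 𝕜 k) =
      (((Real.sqrt (hermSq k))⁻¹ * ∫ ξ, p ξ * hermP k ξ * oseenG ξ : ℝ) : 𝕜) := by
  rw [hermFun, inner_smul_right, inner_gvec_gvec, RCLike.ofReal_mul]

theorem integral_partialD_mul_hermP {φ : Plane → ℝ} (hφ : Adm1 φ) (i : Fin 2) (k : MIdx) :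
    ∫ ξ, partialD i φ ξ * hermP k ξ * oseenG ξ =
      ∫ ξ, φ ξ * hermP (k + Pi.single i 1) ξ * oseenG ξ := by
  rw [integral_partialD_mul_oseenG hφ (adm1_hermP k)]
  simp only [hermP_add_single]

theorem sqrt_hermSq_add_single (i : Fin 2) (k : MIdx) :
    Real.sqrt (hermSq (k + Pi.single i 1)) =
      Real.sqrt ((k i + 1) / 2) * Real.sqrt (hermSq k) := by
  rw [hermSq_add_single, Real.sqrt_mul (by positivity)]

theorem injective_add_single (i : Fin 2) :
    Function.Injective fun k : MIdx => k + Pi.single i 1 := add_left_injective _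

theorem le_two_mul_deg (i : Fin 2) (k : MIdx) : (k i : ℝ) ≤ 2 * deg k := by
  have h0 := (k 0).cast_nonneg (α := ℝ)
  have h1 := (k 1).cast_nonneg (α := ℝ)
  fin_cases i <;> simp [deg] <;> linarith

theorem sq_shift_weight_le (i : Fin 2) (k : MIdx) :
    (-Real.sqrt ((k i + 1) / 2)) ^ 2 ≤ 1 * (1 + deg k) ^ 2 := by
  rw [neg_sq, Real.sq_sqrt (by positivity)]
  nlinarith [le_two_mul_deg i k, deg_nonneg k]

theorem sq_shift_shift_weight_le (i : Fin 2) (k : MIdx) :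
    (Real.sqrt ((k i + 1) / 2) * Real.sqrt ((k i + 1 + 1) / 2)) ^ 2 ≤ 1 * (1 + deg k) ^ 2 := by
  rw [mul_pow, Real.sq_sqrt (by positivity), Real.sq_sqrt (by positivity), one_mul, sq]
  have h1 := le_two_mul_deg i k
  have h2 := deg_nonneg k
  have h3 := (k i).cast_nonneg (α := ℝ)
  apply mul_le_mul <;> linarith

variable (𝕜)

/-- The weak partial derivatives on the domain of `𝓛`. -/
def weakD (i : Fin 2) : hermDomain 𝕜 →ₗ[𝕜] X 𝕜 :=
  weightedShift (hermBasis 𝕜) (injective_add_single i) (sq_shift_weight_le i)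

/-- The weak second partial derivatives on the domain of `𝓛`. -/
def weakDD (i : Fin 2) : hermDomain 𝕜 →ₗ[𝕜] X 𝕜 :=
  weightedShift (hermBasis 𝕜) ((injective_add_single i).comp (injective_add_single i))
    (sq_shift_shift_weight_le i)

/-- The operator `𝓛` in Hermite coordinates. -/
def hermL : hermDomain 𝕜 →ₗ[𝕜] X 𝕜 := diagOp (hermBasis 𝕜) deg_nonneg

variable {𝕜}

/-- On a basis vector this is one integration by parts against G, which raises the Hermite index.
The weight in `weakD` is minus the ratio of the norms of H_{k+eᵢ} and H_k. -/
theorem inner_gvec_partialD {φ : Plane → ℝ} (hφ : Adm1 φ) (i : Fin 2) (w : hermDomain 𝕜) :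
    inner 𝕜 (gvec 𝕜 (hφ.adm_partialD i)) (w : X 𝕜) = -inner 𝕜 (gvec 𝕜 hφ.adm) (weakD 𝕜 i w) := by
  rw [weakD, ← neg_one_mul]
  refine inner_eq_inner_weightedShift _ _ (fun k => ?_) w
  have h1 : Real.sqrt (((k i : ℝ) + 1) / 2) ≠ 0 := (Real.sqrt_pos.2 (by positivity)).ne'
  have h2 := (Real.sqrt_pos.2 (hermSq_pos k)).ne'
  rw [coe_hermBasis, inner_gvec_hermFun, inner_gvec_hermFun, integral_partialD_mul_hermP hφ,
    sqrt_hermSq_add_single, ← RCLike.ofReal_one, ← RCLike.ofReal_neg, ← RCLike.ofReal_mul,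
    ← RCLike.ofReal_mul]
  congr 1
  field_simp

theorem inner_gvec_partialD_partialD {φ : Plane → ℝ} (hφ : Adm1 φ) (i : Fin 2)
    (hφ' : Adm1 (partialD i φ)) (w : hermDomain 𝕜) :
    inner 𝕜 (gvec 𝕜 (hφ'.adm_partialD i)) (w : X 𝕜) =
      inner 𝕜 (gvec 𝕜 hφ.adm) (weakDD 𝕜 i w) := by
  rw [weakDD, ← one_mul (inner 𝕜 (gvec 𝕜 hφ.adm) _)]
  refine inner_eq_inner_weightedShift _ _ (fun k => ?_) w
  have h1 : Real.sqrt (((k i : ℝ) + 1) / 2) ≠ 0 := (Real.sqrt_pos.2 (by positivity)).ne'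
  have h3 : Real.sqrt (((k i : ℝ) + 1 + 1) / 2) ≠ 0 := (Real.sqrt_pos.2 (by positivity)).ne'
  have h2 := (Real.sqrt_pos.2 (hermSq_pos k)).ne'
  rw [coe_hermBasis, inner_gvec_hermFun, inner_gvec_hermFun, integral_partialD_mul_hermP hφ',
    integral_partialD_mul_hermP hφ, Function.comp_apply,
    sqrt_hermSq_add_single, sqrt_hermSq_add_single, one_mul, ← RCLike.ofReal_mul]
  congr 1
  have h4 : (((k + Pi.single i 1 : MIdx) i : ℕ) : ℝ) = k i + 1 := by simp
  rw [h4]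
  field_simp

theorem adm_adjL {φ : Plane → ℝ} (hφ : Adm1 φ) (hφ' : ∀ i, Adm1 (partialD i φ)) :
    Adm (adjL φ) := by
  refine Adm.sum_two fun i => ((hφ' i).adm_partialD i).sub ?_
  convert ((Adm.coord i).const_mul (1 / 2)).mul (hφ.adm_partialD i) using 1
  ext ξ
  simp only [Pi.mul_apply]
  ring

/-- `adjL` is symmetric for the weight G: two integrations by parts move it onto H_k, an
eigenfunction. -/
theorem integral_adjL_mul_hermP {φ : Plane → ℝ} (hφ : Adm1 φ) (hφ' : ∀ i, Adm1 (partialD i φ))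
    (k : MIdx) : ∫ ξ, adjL φ ξ * hermP k ξ * oseenG ξ =
      -deg k * ∫ ξ, φ ξ * hermP k ξ * oseenG ξ := by
  have h1 : ∀ i, ∫ ξ, (partialD i (partialD i φ) ξ - ξ i / 2 * partialD i φ ξ) * hermP k ξ *
      oseenG ξ = -(k i / 2) * ∫ ξ, φ ξ * hermP k ξ * oseenG ξ := by
    intro i
    have hk := (adm1_partialD_hermP i k)
    have e1 := integral_partialD_mul_oseenG (hφ' i) (adm1_hermP k) i
    have e2 := integral_partialD_mul_oseenG hφ hk i
    have e3 : ∫ ξ, (partialD i (partialD i φ) ξ - ξ i / 2 * partialD i φ ξ) * hermP k ξ * oseenG ξ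
        = (∫ ξ, partialD i (partialD i φ) ξ * hermP k ξ * oseenG ξ) -
          ∫ ξ, ξ i / 2 * partialD i φ ξ * hermP k ξ * oseenG ξ := by
      rw [← integral_sub]
      · refine integral_congr_ae (Eventually.of_forall fun ξ => ?_)
        simp only
        ring
      · exact (((hφ' i).adm_partialD i).mul (adm_hermP k)).integrable_mul_oseenG
      · refine ((((Adm.coord i).const_mul (1 / 2)).mul (hφ.adm_partialD i)).mul
          (adm_hermP k)).integrable_mul_oseenG.congr (Eventually.of_forall fun ξ => ?_)
        simp only [Pi.mul_apply]
        ring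
    have e4 : ∫ ξ, partialD i φ ξ * (ξ i / 2 * hermP k ξ - partialD i (hermP k) ξ) * oseenG ξ =
        (∫ ξ, ξ i / 2 * partialD i φ ξ * hermP k ξ * oseenG ξ) -
          ∫ ξ, partialD i φ ξ * partialD i (hermP k) ξ * oseenG ξ := by
      rw [← integral_sub]
      · refine integral_congr_ae (Eventually.of_forall fun ξ => ?_)
        simp only
        ring
      · refine ((((Adm.coord i).const_mul (1 / 2)).mul (hφ.adm_partialD i)).mul
          (adm_hermP k)).integrable_mul_oseenG.congr (Eventually.of_forall fun ξ => ?_)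
        simp only [Pi.mul_apply]
        ring
      · exact ((hφ.adm_partialD i).mul hk.adm).integrable_mul_oseenG
    rw [e3, e1, e4, e2, sub_sub_cancel_left, ← integral_neg, ← integral_const_mul]
    refine integral_congr_ae (Eventually.of_forall fun ξ => ?_)
    have := partialD_partialD_hermP i k ξ
    simp only
    linear_combination φ ξ * oseenG ξ * this
  have h2 : ∀ i, Integrable fun ξ => (partialD i (partialD i φ) ξ - ξ i / 2 * partialD i φ ξ) *
      hermP k ξ * oseenG ξ := by
    intro i
    refine ((((hφ' i).adm_partialD i).sub (((Adm.coord i).const_mul (1 / 2)).mul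
      (hφ.adm_partialD i))).mul (adm_hermP k)).integrable_mul_oseenG.congr
        (Eventually.of_forall fun ξ => ?_)
    simp only [Pi.mul_apply, Pi.sub_apply]
    ring
  simp only [adjL, Finset.sum_mul]
  rw [integral_finsetSum _ fun i _ => h2 i]
  simp only [h1, Fin.sum_univ_two, deg]
  ring

theorem inner_gvec_adjL {φ : Plane → ℝ} (hφ : Adm1 φ) (hφ' : ∀ i, Adm1 (partialD i φ))
    (w : hermDomain 𝕜) : inner 𝕜 (gvec 𝕜 (adm_adjL hφ hφ')) (w : X 𝕜) =
      inner 𝕜 (gvec 𝕜 hφ.adm) (hermL 𝕜 w) := by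
  rw [hermL, diagOp, ← one_mul (inner 𝕜 (gvec 𝕜 hφ.adm) _)]
  refine inner_eq_inner_weightedShift _ _ (fun k => ?_) w
  rw [coe_hermBasis, inner_gvec_hermFun, inner_gvec_hermFun, integral_adjL_mul_hermP hφ hφ',
    one_mul, ← RCLike.ofReal_mul]
  congr 1
  simp only [id]
  ring

theorem ofFun_partialD {φ : Plane → ℝ} (hφ : Adm1 φ) (i : Fin 2) (w : hermDomain 𝕜) :
    ofFun (w : X 𝕜) (partialD i φ) = -ofFun (weakD 𝕜 i w) φ := by
  rw [ofFun_eq_inner (hφ.adm_partialD i), ofFun_eq_inner hφ.adm, inner_gvec_partialD hφ]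

theorem eqFun_opL (w : hermDomain 𝕜) : EqFun (opL (w : X 𝕜)) (hermL 𝕜 w) := by
  intro φ hφ
  rw [opL_ofFun _ hφ, ofFun_eq_inner (adm_adjL hφ.adm1 fun i => (hφ.partialD i).adm1),
    ofFun_eq_inner hφ.adm, inner_gvec_adjL hφ.adm1 fun i => (hφ.partialD i).adm1]

theorem eqFun_laplacianD (w : hermDomain 𝕜) :
    EqFun (laplacianD (ofFun (w : X 𝕜))) (∑ i, weakDD 𝕜 i w : X 𝕜) := by
  intro φ hφ
  rw [laplacianD_ofFun, ofFun_eq_inner hφ.adm, inner_sum]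
  refine Finset.sum_congr rfl fun i _ => ?_
  rw [ofFun_eq_inner ((hφ.partialD i).partialD i).adm,
    inner_gvec_partialD_partialD hφ.adm1 i (hφ.partialD i).adm1]

/-- Δw is given by second weak derivatives, and ξ·∇w is then recovered from the formula for 𝓛 as
2(𝓛w - Δw - w). -/
theorem mem_domL_of_mem_hermDomain {w : X 𝕜} (hw : w ∈ hermDomain 𝕜) : w ∈ domL 𝕜 := by
  refine ⟨⟨_, eqFun_laplacianD ⟨w, hw⟩⟩, (2 : 𝕜) • (hermL 𝕜 ⟨w, hw⟩ +
    (-1 : 𝕜) • (∑ i, weakDD 𝕜 i ⟨w, hw⟩) + (-1 : 𝕜) • w), fun φ hφ => ?_⟩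
  have h1 := eqFun_opL ⟨w, hw⟩ φ hφ
  have h2 := eqFun_laplacianD ⟨w, hw⟩ φ hφ
  rw [ofFun_smul_X hφ.adm, ofFun_add_X hφ.adm, ofFun_add_X hφ.adm, ofFun_smul_X hφ.adm,
    ofFun_smul_X hφ.adm, ← h1, ← h2]
  simp only [opL, Pi.add_apply, Pi.smul_apply, RCLike.real_smul_eq_coe_mul]
  push_cast
  ring

theorem mem_domL_iff {w : X 𝕜} : w ∈ domL 𝕜 ↔ w ∈ hermDomain 𝕜 :=
  ⟨mem_hermDomain_of_mem_domL, mem_domL_of_mem_hermDomain⟩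

/-! ### Multiplication by bounded functions -/

theorem norm_smul_le_of_bound {f : Plane → ℝ} {C : ℝ} (hb : ∀ ξ, |f ξ| ≤ C) (z : 𝕜) (ξ : Plane) :
    ‖f ξ • z‖ ≤ C * ‖z‖ := by
  rw [norm_smul, Real.norm_eq_abs]
  exact mul_le_mul_of_nonneg_right (hb ξ) (norm_nonneg _)

theorem memLp_bounded_smul {f : Plane → ℝ} (hf : Continuous f) {C : ℝ} (hb : ∀ ξ, |f ξ| ≤ C)
    (w : X 𝕜) : MemLp (fun ξ => f ξ • w ξ) 2 gaussMeasure :=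
  (Lp.memLp w).of_le_mul (hf.aestronglyMeasurable.smul (Lp.aestronglyMeasurable w))
    (Eventually.of_forall fun ξ => norm_smul_le_of_bound hb _ ξ)

variable (𝕜) in
/-- Multiplication by a bounded continuous function. -/
def mulOp {f : Plane → ℝ} (hf : Continuous f) {C : ℝ} (hb : ∀ ξ, |f ξ| ≤ C) : X 𝕜 →L[𝕜] X 𝕜 :=
  LinearMap.mkContinuous
    { toFun := fun w => (memLp_bounded_smul hf hb w).toLp _
      map_add' := fun u w => by
        refine Lp.ext ?_
        filter_upwards [(memLp_bounded_smul hf hb (u + w)).coeFn_toLp,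
          (memLp_bounded_smul hf hb u).coeFn_toLp, (memLp_bounded_smul hf hb w).coeFn_toLp,
          Lp.coeFn_add u w, Lp.coeFn_add ((memLp_bounded_smul hf hb u).toLp _)
            ((memLp_bounded_smul hf hb w).toLp _)] with ξ h1 h2 h3 h4 h5
        rw [h1, h5, Pi.add_apply, h2, h3, h4, Pi.add_apply, smul_add]
      map_smul' := fun c w => by
        refine Lp.ext ?_
        filter_upwards [(memLp_bounded_smul hf hb (c • w)).coeFn_toLp,
          (memLp_bounded_smul hf hb w).coeFn_toLp, Lp.coeFn_smul c w,
          Lp.coeFn_smul c ((memLp_bounded_smul hf hb w).toLp _)] with ξ h1 h2 h3 h4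
        rw [h1, RingHom.id_apply, h4, Pi.smul_apply, h2, h3, Pi.smul_apply, smul_comm] } C
    fun w => Lp.norm_le_mul_norm_of_ae_le_mul <| by
      filter_upwards [(memLp_bounded_smul hf hb w).coeFn_toLp] with ξ h1
      simp only [LinearMap.coe_mk, AddHom.coe_mk]
      rw [h1]
      exact norm_smul_le_of_bound hb _ ξ

theorem mulOp_ae {f : Plane → ℝ} (hf : Continuous f) {C : ℝ} (hb : ∀ ξ, |f ξ| ≤ C) (w : X 𝕜) :
    mulOp 𝕜 hf hb w =ᵐ[volume] fun ξ => f ξ • w ξ :=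
  volume_ac_gaussMeasure.ae_le (memLp_bounded_smul hf hb w).coeFn_toLp

theorem norm_mulOp_le {f : Plane → ℝ} (hf : Continuous f) {C : ℝ} (hb : ∀ ξ, |f ξ| ≤ C)
    (w : X 𝕜) : ‖mulOp 𝕜 hf hb w‖ ≤ C * ‖w‖ := by
  have hC : 0 ≤ C := (abs_nonneg _).trans (hb 0)
  exact (mulOp 𝕜 hf hb).le_of_opNorm_le (LinearMap.mkContinuous_norm_le _ hC _) w

theorem inner_gvec_mulOp {f : Plane → ℝ} (hf : Continuous f) {C : ℝ} (hb : ∀ ξ, |f ξ| ≤ C)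
    {p : Plane → ℝ} (hp : Adm p) (w : X 𝕜) :
    inner 𝕜 (gvec 𝕜 hp) (mulOp 𝕜 hf hb w) =
      inner 𝕜 (gvec 𝕜 ((Adm.of_bounded hf hb).mul hp)) w := by
  rw [inner_gvec, inner_gvec]
  refine integral_congr_ae ?_
  filter_upwards [mulOp_ae hf hb w] with ξ h
  rw [h, smul_smul, Pi.mul_apply, mul_comm]

end WeakDerivatives

/-! ### The velocity profile of the Oseen vortex -/

/-- The function `s ↦ (1 - exp (-s/4)) / s`, extended smoothly to `s = 0`. -/
def profile : ℝ → ℝ := dslope (fun s => 1 - Real.exp (-s / 4)) 0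

theorem profile_of_ne {s : ℝ} (hs : s ≠ 0) : profile s = (1 - Real.exp (-s / 4)) / s := by
  rw [profile, dslope_of_ne _ hs, slope_def_field]
  simp

/-- At 0 the slope of an analytic function has the shifted power series; elsewhere it is a quotient
of analytic functions. -/
theorem contDiff_profile : ContDiff ℝ ∞ profile := by
  refine contDiff_iff_contDiffAt.2 fun s => AnalyticAt.contDiffAt ?_
  have h1 : ∀ s : ℝ, AnalyticAt ℝ (fun s : ℝ => 1 - Real.exp (-s / 4)) s := fun s => by
    have h2 : AnalyticAt ℝ (fun s : ℝ => -s / 4) s := analyticAt_id.neg.div_const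
    exact analyticAt_const.sub h2.rexp
  rcases eq_or_ne s 0 with rfl | hs
  · obtain ⟨p, hp⟩ := h1 0
    exact ⟨_, hp.has_fpower_series_dslope_fslope⟩
  · refine ((h1 s).div analyticAt_id hs).congr ?_
    filter_upwards [isOpen_ne.mem_nhds hs] with t ht
    exact (profile_of_ne ht).symm

theorem mul_profile (s : ℝ) : s * profile s = 1 - Real.exp (-s / 4) := by
  rcases eq_or_ne s 0 with rfl | hs
  · simp
  · rw [profile_of_ne hs]
    field_simp

theorem profile_zero : profile 0 = 1 / 4 := by
  rw [profile, dslope_same]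
  have h1 : HasDerivAt (fun s : ℝ => -s / 4) (-1 / 4) 0 := (hasDerivAt_id (0 : ℝ)).neg.div_const 4
  have := (h1.exp.const_sub 1).deriv
  rw [this]
  norm_num

theorem profile_nonneg {s : ℝ} (hs : 0 ≤ s) : 0 ≤ profile s := by
  rcases hs.eq_or_lt with rfl | hs
  · rw [profile_zero]; norm_num
  · rw [profile_of_ne hs.ne']
    refine div_nonneg ?_ hs.le
    rw [sub_nonneg, Real.exp_le_one_iff]
    linarith

theorem profile_le {s : ℝ} (hs : 0 ≤ s) : profile s ≤ 1 / 4 := by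
  rcases hs.eq_or_lt with rfl | hs
  · rw [profile_zero]
  · rw [profile_of_ne hs.ne', div_le_iff₀ hs]
    linarith [Real.add_one_le_exp (-s / 4)]

theorem mul_profile_le {s : ℝ} : s * profile s ≤ 1 := by
  rw [mul_profile]
  linarith [Real.exp_pos (-s / 4)]

theorem exists_bound_deriv_profile : ∃ C, ∀ s, 0 ≤ s → |deriv profile s| ≤ C := by
  have hd : Differentiable ℝ profile := contDiff_profile.differentiable (by simp)
  have hc : Continuous (deriv profile) := contDiff_profile.continuous_deriv (by simp)
  obtain ⟨C, hC⟩ := isCompact_Icc.exists_bound_of_continuousOn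
    (s := Set.Icc (0 : ℝ) 1) hc.continuousOn
  refine ⟨max C 1, fun s hs => ?_⟩
  rcases le_total s 1 with h1 | h1
  · exact (hC s ⟨hs, h1⟩).trans (le_max_left _ _)
  · refine le_trans ?_ (le_max_right _ _)
    -- For s ≥ 1, differentiating s·profile(s) = 1 - exp(-s/4) gives s·profile'(s) = exp(-s/4)/4 -
    -- profile(s), of absolute value at most 1.
    have e1 : HasDerivAt (fun s => s * profile s) (1 * profile s + s * deriv profile s) s :=
      (hasDerivAt_id s).mul (hd s).hasDerivAt
    have e2 : HasDerivAt (fun s => s * profile s) (Real.exp (-s / 4) / 4) s := by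
      have h2 : HasDerivAt (fun s : ℝ => -s / 4) (-1 / 4) s := (hasDerivAt_id s).neg.div_const 4
      have h3 := h2.exp.const_sub 1
      refine (h3.congr_of_eventuallyEq (Eventually.of_forall mul_profile)).congr_deriv ?_
      ring
    have e3 := e1.unique e2
    have e4 := profile_nonneg hs
    have e5 := profile_le hs
    have e6 := Real.exp_pos (-s / 4)
    have e7 : Real.exp (-s / 4) ≤ 1 := Real.exp_le_one_iff.2 (by linarith)
    have e8 : |s * deriv profile s| ≤ 1 := by
      rw [abs_le]
      constructor <;> linarith
    rw [abs_mul, abs_of_nonneg hs] at e8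
    nlinarith [abs_nonneg (deriv profile s)]

/-- The radial factor `|ξ|⁻² (1 - exp (-|ξ|² / 4))`. -/
def radial (ξ : Plane) : ℝ := profile (‖ξ‖ ^ 2)

theorem contDiff_radial : ContDiff ℝ ∞ radial :=
  contDiff_profile.comp (contDiff_norm_sq ℝ)

theorem partialD_radial (i : Fin 2) (ξ : Plane) :
    partialD i radial ξ = 2 * deriv profile (‖ξ‖ ^ 2) * ξ i := by
  have h1 : HasFDerivAt (fun η : Plane => ‖η‖ ^ 2) (2 • innerSL ℝ ξ) ξ :=
    (hasStrictFDerivAt_norm_sq ξ).hasFDerivAt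
  have h2 : HasDerivAt profile (deriv profile (‖ξ‖ ^ 2)) (‖ξ‖ ^ 2) :=
    (contDiff_profile.differentiable (by simp) _).hasDerivAt
  have h3 : HasFDerivAt radial (deriv profile (‖ξ‖ ^ 2) • (2 • innerSL ℝ ξ)) ξ :=
    h2.comp_hasFDerivAt ξ h1
  rw [partialD, h3.fderiv]
  simp [EuclideanSpace.inner_single_right]
  ring

theorem adm1_radial : Adm1 radial where
  diff := contDiff_radial.differentiable (by simp)
  adm := Adm.of_bounded (C := 1 / 4) contDiff_radial.continuous fun ξ => by
    rw [radial, abs_of_nonneg (profile_nonneg (by positivity))]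
    exact profile_le (by positivity)
  adm_partialD i := by
    obtain ⟨C, hC⟩ := exists_bound_deriv_profile
    have h1 : Adm fun ξ : Plane => deriv profile (‖ξ‖ ^ 2) :=
      Adm.of_bounded ((contDiff_profile.continuous_deriv (by simp)).comp (by fun_prop))
        fun ξ => hC _ (by positivity)
    convert (h1.const_mul 2).mul (Adm.coord i) using 1
    ext ξ
    rw [partialD_radial]
    rfl

/-- The components of the velocity profile. -/
def velo (i : Fin 2) (ξ : Plane) : ℝ := oseenV ξ i

theorem velo_zero : velo 0 = (fun ξ => -(1 / (2 * Real.pi)) * ξ 1) * radial := by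
  ext ξ
  simp only [velo, oseenV, perp, PiLp.smul_apply, smul_eq_mul, Pi.mul_apply, radial]
  rcases eq_or_ne ξ 0 with rfl | h
  · simp
  · rw [profile_of_ne (by simpa using h)]
    simp
    ring

theorem velo_one : velo 1 = (fun ξ => 1 / (2 * Real.pi) * ξ 0) * radial := by
  ext ξ
  simp only [velo, oseenV, perp, PiLp.smul_apply, smul_eq_mul, Pi.mul_apply, radial]
  rcases eq_or_ne ξ 0 with rfl | h
  · simp
  · rw [profile_of_ne (by simpa using h)]
    simp
    ring

theorem contDiff_velo (i : Fin 2) : ContDiff ℝ ∞ (velo i) := by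
  fin_cases i
  · rw [Fin.zero_eta, velo_zero]
    exact (contDiff_const.mul (contDiff_coord 1)).mul contDiff_radial
  · rw [Fin.mk_one, velo_one]
    exact (contDiff_const.mul (contDiff_coord 0)).mul contDiff_radial

theorem adm1_velo (i : Fin 2) : Adm1 (velo i) := by
  fin_cases i
  · rw [Fin.zero_eta, velo_zero]
    exact ((Adm1.coord 1).const_mul _).mul adm1_radial
  · rw [Fin.mk_one, velo_one]
    exact ((Adm1.coord 0).const_mul _).mul adm1_radial

theorem norm_mul_radial_le (ξ : Plane) : ‖ξ‖ * radial ξ ≤ 1 := by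
  have h0 := norm_nonneg ξ
  have h1 := profile_nonneg (sq_nonneg ‖ξ‖)
  have h2 := profile_le (sq_nonneg ‖ξ‖)
  have h3 := mul_profile_le (s := ‖ξ‖ ^ 2)
  rw [radial]
  rcases le_total ‖ξ‖ 1 with h | h
  · nlinarith
  · nlinarith [mul_le_mul_of_nonneg_right (by nlinarith : ‖ξ‖ ≤ ‖ξ‖ ^ 2) h1]

theorem abs_velo_le (i : Fin 2) (ξ : Plane) : |velo i ξ| ≤ 1 := by
  have h0 : 0 ≤ radial ξ := profile_nonneg (sq_nonneg ‖ξ‖)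
  have h1 : 1 / (2 * Real.pi) ≤ 1 := by
    rw [div_le_one (by positivity)]
    linarith [Real.pi_gt_three]
  have h2 : ∀ j : Fin 2, |ξ j| * radial ξ ≤ 1 := fun j =>
    (mul_le_mul_of_nonneg_right (PiLp.norm_apply_le ξ j) h0).trans (norm_mul_radial_le ξ)
  have h3 : ∀ j : Fin 2, 1 / (2 * Real.pi) * |ξ j| * radial ξ ≤ 1 := fun j => by
    rw [mul_assoc]
    exact mul_le_one₀ h1 (by positivity) (h2 j)
  fin_cases i
  · rw [Fin.zero_eta, velo_zero, Pi.mul_apply, abs_mul, abs_mul, abs_neg, abs_of_nonneg h0,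
      abs_of_pos (by positivity : 0 < 1 / (2 * Real.pi))]
    exact h3 1
  · rw [Fin.mk_one, velo_one, Pi.mul_apply, abs_mul, abs_mul, abs_of_nonneg h0,
      abs_of_pos (by positivity : 0 < 1 / (2 * Real.pi))]
    exact h3 0

theorem sum_coord_mul_velo (ξ : Plane) : ∑ i, ξ i * velo i ξ = 0 := by
  rw [Fin.sum_univ_two, velo_zero, velo_one]
  simp only [Pi.mul_apply]
  ring

theorem sum_partialD_velo (ξ : Plane) : ∑ i, partialD i (velo i) ξ = 0 := by
  rw [Fin.sum_univ_two, velo_zero, velo_one,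
    partialD_mul ((Adm1.coord 1).const_mul _).diff adm1_radial.diff,
    partialD_mul ((Adm1.coord 0).const_mul _).diff adm1_radial.diff,
    partialD_const_mul (Adm1.coord 1).diff, partialD_const_mul (Adm1.coord 0).diff,
    partialD_coord, partialD_coord]
  simp only [Pi.add_apply, Pi.mul_apply, partialD_radial]
  simp
  ring

/-! ### Transport by the velocity profile -/

/-- The directional derivative `v^G · ∇ φ`. -/
def transp (φ : Plane → ℝ) (ξ : Plane) : ℝ := ∑ i, velo i ξ * partialD i φ ξ

theorem adm_transp {φ : Plane → ℝ} (hφ : Adm1 φ) : Adm (transp φ) :=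
  Adm.sum_two fun i => (adm1_velo i).adm.mul (hφ.adm_partialD i)

theorem transp_eq_div {φ : Plane → ℝ} (hφ : Adm1 φ) :
    transp φ = fun ξ => ∑ i, partialD i (velo i * φ) ξ := by
  ext ξ
  have h := sum_partialD_velo ξ
  simp only [Fin.sum_univ_two] at h
  simp only [transp, partialD_mul (adm1_velo _).diff hφ.diff, Pi.add_apply, Pi.mul_apply,
    Fin.sum_univ_two]
  linear_combination -φ ξ * h

/-- Integration by parts against G leaves the factor ξ·v^G/2 - div v^G, and both terms vanish. -/
theorem integral_transp_mul_oseenG {φ : Plane → ℝ} (hφ : Adm1 φ) :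
    ∫ ξ, transp φ ξ * oseenG ξ = 0 := by
  have h1 : ∀ i, Integrable fun ξ => partialD i φ ξ * velo i ξ * oseenG ξ := fun i =>
    ((hφ.adm_partialD i).mul (adm1_velo i).adm).integrable_mul_oseenG
  have h2 : ∀ i, Integrable fun ξ =>
      φ ξ * (ξ i / 2 * velo i ξ - partialD i (velo i) ξ) * oseenG ξ := by
    intro i
    refine (hφ.adm.mul ((((Adm.coord i).const_mul (1 / 2)).mul (adm1_velo i).adm).sub
      ((adm1_velo i).adm_partialD i))).integrable_mul_oseenG.congr
        (Eventually.of_forall fun ξ => ?_)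
    simp only [Pi.mul_apply, Pi.sub_apply]
    ring
  calc _ = ∫ ξ, ∑ i, partialD i φ ξ * velo i ξ * oseenG ξ := by
        refine integral_congr_ae (Eventually.of_forall fun ξ => ?_)
        simp only [transp, Finset.sum_mul, mul_comm (velo _ ξ)]
    _ = ∫ ξ, ∑ i, φ ξ * (ξ i / 2 * velo i ξ - partialD i (velo i) ξ) * oseenG ξ := by
        rw [integral_finsetSum _ fun i _ => h1 i, integral_finsetSum _ fun i _ => h2 i]
        exact Finset.sum_congr rfl fun i _ => integral_partialD_mul_oseenG hφ (adm1_velo i) i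
    _ = ∫ ξ : Plane, (0 : ℝ) := by
        refine integral_congr_ae (Eventually.of_forall fun ξ => ?_)
        have e1 := sum_coord_mul_velo ξ
        have e2 := sum_partialD_velo ξ
        simp only [Fin.sum_univ_two] at e1 e2 ⊢
        linear_combination φ ξ * oseenG ξ * (e1 / 2 - e2)
    _ = 0 := by simp

/-- `transp` is a derivation, and the derivative of the product φψ has zero integral against G. -/
theorem integral_transp_mul {φ ψ : Plane → ℝ} (hφ : Adm1 φ) (hψ : Adm1 ψ) :
    ∫ ξ, transp φ ξ * ψ ξ * oseenG ξ = -∫ ξ, φ ξ * transp ψ ξ * oseenG ξ := by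
  rw [eq_neg_iff_add_eq_zero]
  refine (integral_add ((adm_transp hφ).mul hψ.adm).integrable_mul_oseenG
    (hφ.adm.mul (adm_transp hψ)).integrable_mul_oseenG).symm.trans ?_
  rw [← integral_transp_mul_oseenG (hφ.mul hψ)]
  refine integral_congr_ae (Eventually.of_forall fun ξ => ?_)
  simp only [transp, partialD_mul hφ.diff hψ.diff, Pi.add_apply, Pi.mul_apply, Fin.sum_univ_two]
  ring

/-! ### The transport part of Λ as an operator on the Hermite domain -/

section TransportOp

variable (𝕜 : Type*) [RCLike 𝕜]

/-- The operator `v^G · ∇` on the domain of `𝓛`. -/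
def transportOp : hermDomain 𝕜 →ₗ[𝕜] X 𝕜 :=
  ∑ i, (mulOp 𝕜 (contDiff_velo i).continuous (abs_velo_le i)).toLinearMap ∘ₗ weakD 𝕜 i

variable {𝕜}

theorem transportOp_apply (w : hermDomain 𝕜) : transportOp 𝕜 w =
    ∑ i, mulOp 𝕜 (contDiff_velo i).continuous (abs_velo_le i) (weakD 𝕜 i w) := by
  simp [transportOp]

theorem inner_gvec_transportOp' {φ : Plane → ℝ} (hφ : Adm φ) (w : hermDomain 𝕜) :
    inner 𝕜 (gvec 𝕜 hφ) (transportOp 𝕜 w) =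
      ∑ i, ofFun (weakD 𝕜 i w) (velo i * φ) := by
  rw [transportOp_apply, inner_sum]
  refine Finset.sum_congr rfl fun i _ => ?_
  rw [inner_gvec_mulOp, ofFun_eq_inner ((adm1_velo i).adm.mul hφ)]

theorem inner_gvec_transportOp {φ : Plane → ℝ} (hφ : Adm1 φ) (w : hermDomain 𝕜) :
    inner 𝕜 (gvec 𝕜 hφ.adm) (transportOp 𝕜 w) =
      -inner 𝕜 (gvec 𝕜 (adm_transp hφ)) (w : X 𝕜) := by
  rw [inner_gvec_transportOp', ← ofFun_eq_inner, transp_eq_div hφ,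
    ofFun_sum_two fun i => ((adm1_velo i).mul hφ).adm_partialD i, ← Finset.sum_neg_distrib]
  refine Finset.sum_congr rfl fun i _ => ?_
  rw [ofFun_partialD ((adm1_velo i).mul hφ), neg_neg]

theorem eqFun_transportD (w : hermDomain 𝕜) :
    EqFun (transportD oseenV (ofFun (w : X 𝕜))) (transportOp 𝕜 w) := by
  intro φ hφ
  rw [ofFun_eq_inner hφ.adm, inner_gvec_transportOp' hφ.adm]
  simp only [transportD, Finset.sum_apply, mulD, derivD]
  refine Finset.sum_congr rfl fun i _ => ?_
  have := ofFun_partialD ((adm1_velo i).mul hφ.adm1) i w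
  rw [eq_comm, ← neg_inj, ← this, neg_neg]
  rfl

theorem hermFun_mem (k : MIdx) : hermFun 𝕜 k ∈ hermDomain 𝕜 := by
  simpa using finset_sum_mem_diagDomain (hermBasis 𝕜) deg {k} fun _ => (1 : 𝕜)

theorem inner_gvec_transportOp_hermFun {φ : Plane → ℝ} (hφ : Adm1 φ) (k : MIdx) :
    inner 𝕜 (gvec 𝕜 hφ.adm) (transportOp 𝕜 ⟨hermFun 𝕜 k, hermFun_mem k⟩) =
      (((Real.sqrt (hermSq k))⁻¹ * ∫ ξ, φ ξ * transp (hermP k) ξ * oseenG ξ : ℝ) : 𝕜) := by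
  rw [inner_gvec_transportOp hφ, inner_gvec_hermFun, integral_transp_mul hφ (adm1_hermP k),
    ← RCLike.ofReal_neg]
  congr 1
  ring

theorem inner_hermFun_transportOp_hermFun (k l : MIdx) :
    inner 𝕜 (hermFun 𝕜 l) (transportOp 𝕜 ⟨hermFun 𝕜 k, hermFun_mem k⟩) =
      (((Real.sqrt (hermSq l))⁻¹ * ((Real.sqrt (hermSq k))⁻¹ *
        ∫ ξ, hermP l ξ * transp (hermP k) ξ * oseenG ξ) : ℝ) : 𝕜) := by
  rw [hermFun, inner_smul_left, RCLike.conj_ofReal,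
    inner_gvec_transportOp_hermFun (adm1_hermP l), ← RCLike.ofReal_mul]

end TransportOp

/-! ### Skew operators in a Hilbert basis -/

section Skew

variable {𝕜 H ι : Type*} [RCLike 𝕜] [NormedAddCommGroup H] [InnerProductSpace 𝕜 H]
  [CompleteSpace H] {b : HilbertBasis ι 𝕜 H} {N : ι → ℝ}

/-- The vectors m k are the images of the basis. Assuming that T acts termwise on expansions avoids
any closure argument: skewness of the matrix is passed first to one argument and then to the other.
-/
theorem inner_skew_of_basis {T : diagDomain b N →ₗ[𝕜] H} {m : ι → H}
    (hT : ∀ w : diagDomain b N, HasSum (fun k => b.repr (w : H) k • m k) (T w))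
    (hm : ∀ k l, inner 𝕜 (b l) (m k) = -inner 𝕜 (m l) (b k)) (u w : diagDomain b N) :
    inner 𝕜 (u : H) (T w) = -inner 𝕜 (T u) (w : H) := by
  have h1 : ∀ l, inner 𝕜 (b l) (T w) = -inner 𝕜 (m l) (w : H) := by
    intro l
    have e1 := (hT w).mapL (innerSL 𝕜 (b l))
    have e2 := ((b.hasSum_repr (w : H)).mapL (innerSL 𝕜 (m l))).neg
    refine e1.unique (e2.congr_fun ?_)
    intro k
    simp only [innerSL_apply_apply, inner_smul_right]
    rw [hm]
    ring
  have e1 := (b.hasSum_repr (u : H)).mapL (innerSL 𝕜 (T w))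
  have e2 := ((hT u).mapL (innerSL 𝕜 (w : H))).neg
  have h2 : inner 𝕜 (T w) (u : H) = -inner 𝕜 (w : H) (T u) := by
    refine e1.unique (e2.congr_fun ?_)
    intro k
    simp only [innerSL_apply_apply, inner_smul_right]
    rw [← inner_conj_symm (T w), h1, ← inner_conj_symm (w : H), _root_.map_neg]
    ring
  rw [← inner_conj_symm (u : H), h2, _root_.map_neg, inner_conj_symm]

theorem weightedShift_basis {σ : ι → ι} (hσ : σ.Injective) {c : ι → ℝ} {C : ℝ}
    (hc : ∀ k, c k ^ 2 ≤ C * (1 + N k) ^ 2) {k : ι} (hk : b k ∈ diagDomain b N) :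
    weightedShift b hσ hc ⟨b k, hk⟩ = (c k : 𝕜) • b (σ k) := by
  classical
  refine (hasSum_weightedShift hσ hc ⟨b k, hk⟩).unique ?_
  have h := hasSum_single (f := fun j => ((c j : 𝕜) * b.repr (b k) j) • b (σ j)) k (fun j hj => by
    rw [b.repr_apply_apply, b.orthonormal.2 hj, mul_zero, zero_smul])
  have h1 : b.repr (b k) k = 1 := by
    rw [b.repr_apply_apply, inner_self_eq_norm_sq_to_K, b.orthonormal.1 k]
    simp
  rwa [h1, mul_one] at h

end Skew

/-! ### Skewness and relative bound of the transport part -/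

section TransportOp

variable {𝕜 : Type*} [RCLike 𝕜]

/-- Each weak derivative is by construction a convergent sum over the basis, and multiplication by a
bounded velocity component is continuous. -/
theorem hasSum_transportOp (w : hermDomain 𝕜) :
    HasSum (fun k => (hermBasis 𝕜).repr (w : X 𝕜) k •
      transportOp 𝕜 ⟨hermFun 𝕜 k, hermFun_mem k⟩) (transportOp 𝕜 w) := by
  rw [transportOp_apply]
  have h1 : ∀ i, HasSum (fun k => (hermBasis 𝕜).repr (w : X 𝕜) k •
      mulOp 𝕜 (contDiff_velo i).continuous (abs_velo_le i)
        (weakD 𝕜 i ⟨hermFun 𝕜 k, hermFun_mem k⟩))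
      (mulOp 𝕜 (contDiff_velo i).continuous (abs_velo_le i) (weakD 𝕜 i w)) := by
    intro i
    have e1 := (hasSum_weightedShift (injective_add_single i) (sq_shift_weight_le i) w).mapL
      (mulOp 𝕜 (contDiff_velo i).continuous (abs_velo_le i))
    refine e1.congr_fun fun k => ?_
    have e2 : weakD 𝕜 i ⟨hermFun 𝕜 k, hermFun_mem k⟩ =
        ((-Real.sqrt ((k i + 1) / 2) : ℝ) : 𝕜) • (hermBasis 𝕜) (k + Pi.single i 1) := by
      have hk : hermBasis 𝕜 k ∈ hermDomain 𝕜 := by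
        rw [coe_hermBasis]
        exact hermFun_mem k
      have := weightedShift_basis (b := hermBasis 𝕜) (N := deg) (injective_add_single i)
        (sq_shift_weight_le i) hk
      simp only [coe_hermBasis] at this ⊢
      exact this
    rw [e2, ← ContinuousLinearMap.map_smul, smul_smul, mul_comm]
  refine (hasSum_sum fun i (_ : i ∈ Finset.univ) => h1 i).congr_fun fun k => ?_
  rw [transportOp_apply, Finset.smul_sum]

theorem inner_transportOp_skew (u w : hermDomain 𝕜) :
    inner 𝕜 (u : X 𝕜) (transportOp 𝕜 w) = -inner 𝕜 (transportOp 𝕜 u) (w : X 𝕜) := by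
  refine inner_skew_of_basis hasSum_transportOp (fun k l => ?_) u w
  rw [coe_hermBasis, ← inner_conj_symm (transportOp 𝕜 _), inner_hermFun_transportOp_hermFun,
    inner_hermFun_transportOp_hermFun, RCLike.conj_ofReal, ← RCLike.ofReal_neg]
  congr 1
  have h := integral_transp_mul (adm1_hermP k) (adm1_hermP l)
  simp only [mul_comm (transp (hermP k) _)] at h
  rw [h]
  ring

theorem norm_sq_transportOp_le (w : hermDomain 𝕜) : ‖transportOp 𝕜 w‖ ^ 2 ≤
    2 * ∑' k, (1 + deg k) * ‖(hermBasis 𝕜).repr (w : X 𝕜) k‖ ^ 2 := by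
  have h1 : ‖transportOp 𝕜 w‖ ≤ ‖weakD 𝕜 0 w‖ + ‖weakD 𝕜 1 w‖ := by
    rw [transportOp_apply, Fin.sum_univ_two]
    refine (norm_add_le _ _).trans (add_le_add ?_ ?_)
    · exact (norm_mulOp_le _ _ _).trans (one_mul _).le
    · exact (norm_mulOp_le _ _ _).trans (one_mul _).le
  have h2 : ∀ i, ‖weakD 𝕜 i w‖ ^ 2 =
      ∑' k, (k i + 1) / 2 * ‖(hermBasis 𝕜).repr (w : X 𝕜) k‖ ^ 2 := by
    intro i
    refine (norm_sq_weightedShift (injective_add_single i) (sq_shift_weight_le i) w).trans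
      (tsum_congr fun k => ?_)
    rw [neg_sq, Real.sq_sqrt (by positivity)]
  have h3 : ∀ i, Summable fun k : MIdx =>
      ((k i : ℝ) + 1) / 2 * ‖(hermBasis 𝕜).repr (w : X 𝕜) k‖ ^ 2 := by
    intro i
    refine Summable.of_nonneg_of_le (fun k => by positivity) (fun k => ?_)
      (summable_linear_weight deg_nonneg w)
    gcongr
    linarith [le_two_mul_deg i k]
  -- The squared weights (k₀+1)/2 and (k₁+1)/2 add up to exactly 1 + deg k: the energy identity for
  -- 1 - 𝓛.
  have h4 : ‖weakD 𝕜 0 w‖ ^ 2 + ‖weakD 𝕜 1 w‖ ^ 2 =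
      ∑' k, (1 + deg k) * ‖(hermBasis 𝕜).repr (w : X 𝕜) k‖ ^ 2 := by
    rw [h2, h2, ← (h3 0).tsum_add (h3 1)]
    refine tsum_congr fun k => ?_
    rw [deg]
    ring
  rw [← h4]
  nlinarith [norm_nonneg (transportOp 𝕜 w), sq_nonneg (‖weakD 𝕜 0 w‖ - ‖weakD 𝕜 1 w‖)]

end TransportOp

/-! ### The Riesz potential of order one in the plane -/

/-- The part of the kernel `‖ζ‖⁻¹` near the origin. -/
def rieszNear (ζ : Plane) : ℝ := Set.indicator (Set.Iio 1) (fun r : ℝ => r⁻¹) ‖ζ‖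

/-- In polar coordinates the Jacobian r cancels r⁻¹ on (0,1). -/
theorem integrable_rieszNear : Integrable rieszNear := by
  have h := integrable_fun_norm_addHaar (volume : Measure Plane)
    (f := Set.indicator (Set.Iio 1) (fun r : ℝ => r⁻¹))
  refine h.2 ?_
  have h1 : IntegrableOn (fun _ : ℝ => (1 : ℝ)) (Set.Ioo 0 1) := by simp
  have h2 : Integrable (Set.indicator (Set.Ioo 0 1) fun _ : ℝ => (1 : ℝ)) :=
    h1.integrable_indicator measurableSet_Ioo
  refine h2.integrableOn.congr_fun (fun r hr => ?_) measurableSet_Ioi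
  have hr0 : (0 : ℝ) < r := hr
  by_cases h : r < 1
  · rw [Set.indicator_of_mem (show r ∈ Set.Ioo (0 : ℝ) 1 from ⟨hr0, h⟩),
      Set.indicator_of_mem (show r ∈ Set.Iio (1 : ℝ) from h)]
    simp [hr0.ne']
  · rw [Set.indicator_of_notMem (fun h' : r ∈ Set.Ioo (0 : ℝ) 1 => h h'.2),
      Set.indicator_of_notMem (show r ∉ Set.Iio (1 : ℝ) from h), smul_zero]

theorem inv_norm_le (ζ : Plane) : ‖ζ‖⁻¹ ≤ rieszNear ζ + 1 := by
  by_cases h : ‖ζ‖ < 1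
  · rw [rieszNear, Set.indicator_of_mem (show ‖ζ‖ ∈ Set.Iio (1 : ℝ) from h)]
    linarith
  · rw [rieszNear, Set.indicator_of_notMem (show ‖ζ‖ ∉ Set.Iio (1 : ℝ) from h), zero_add]
    exact inv_le_one_of_one_le₀ (not_lt.1 h)

theorem rieszNear_nonneg (ζ : Plane) : 0 ≤ rieszNear ζ := by
  by_cases h : ‖ζ‖ < 1
  · rw [rieszNear, Set.indicator_of_mem (show ‖ζ‖ ∈ Set.Iio (1 : ℝ) from h)]
    positivity
  · rw [rieszNear, Set.indicator_of_notMem (show ‖ζ‖ ∉ Set.Iio (1 : ℝ) from h)]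

/-- The potentials `∫ h(η) ‖ξ - η‖⁻¹ dη` are bounded for `h` bounded and integrable. -/
theorem exists_bound_riesz {h : Plane → ℝ} (hc : Continuous h) (hi : Integrable h) {M : ℝ}
    (h0 : ∀ ξ, 0 ≤ h ξ) (hM : ∀ ξ, h ξ ≤ M) :
    ∃ A, ∀ ξ, Integrable (fun η => h η * ‖ξ - η‖⁻¹) ∧ ∫ η, h η * ‖ξ - η‖⁻¹ ≤ A := by
  have hM0 : 0 ≤ M := (h0 0).trans (hM 0)
  refine ⟨M * (∫ ζ, rieszNear ζ) + ∫ η, h η, fun ξ => ?_⟩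
  have h1 : Integrable fun η => M * rieszNear (ξ - η) + h η :=
    ((integrable_rieszNear.comp_sub_left ξ).const_mul M).add hi
  have h2 : ∀ η, h η * ‖ξ - η‖⁻¹ ≤ M * rieszNear (ξ - η) + h η := fun η => by
    have e1 := mul_le_mul_of_nonneg_left (inv_norm_le (ξ - η)) (h0 η)
    have e2 := mul_le_mul_of_nonneg_right (hM η) (rieszNear_nonneg (ξ - η))
    linarith
  have h3 : Integrable (fun η => h η * ‖ξ - η‖⁻¹) := by
    refine h1.mono' ?_ (Eventually.of_forall fun η => ?_)
    · exact (hc.measurable.mul (by fun_prop)).aestronglyMeasurable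
    · rw [Real.norm_eq_abs, abs_of_nonneg (mul_nonneg (h0 η) (by positivity))]
      exact h2 η
  refine ⟨h3, (integral_mono h3 h1 h2).trans_eq ?_⟩
  rw [integral_add ((integrable_rieszNear.comp_sub_left ξ).const_mul M) hi, integral_const_mul,
    integral_sub_left_eq_self]

/-- Integrability of `U(ξ) h(η) ‖ξ - η‖⁻¹`, with a bound. -/
theorem integrable_riesz_prod {h : Plane → ℝ} (hc : Continuous h) (h0 : ∀ ξ, 0 ≤ h ξ) {A : ℝ}
    (hA : ∀ ξ, Integrable (fun η => h η * ‖ξ - η‖⁻¹) ∧ ∫ η, h η * ‖ξ - η‖⁻¹ ≤ A)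
    {U : Plane → ℝ} (hU : Integrable U) (hU0 : ∀ ξ, 0 ≤ U ξ) :
    Integrable (fun z : Plane × Plane => U z.1 * (h z.2 * ‖z.1 - z.2‖⁻¹)) ∧
      ∫ z : Plane × Plane, U z.1 * (h z.2 * ‖z.1 - z.2‖⁻¹) ≤ A * ∫ ξ, U ξ := by
  have hn : ∀ ξ η, 0 ≤ h η * ‖ξ - η‖⁻¹ := fun ξ η => mul_nonneg (h0 η) (by positivity)
  have hm : AEStronglyMeasurable (fun z : Plane × Plane => U z.1 * (h z.2 * ‖z.1 - z.2‖⁻¹))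
      (volume.prod volume) := by
    refine hU.aestronglyMeasurable.comp_fst.mul ?_
    have h1 : Measurable fun z : Plane × Plane => h z.2 := hc.measurable.comp measurable_snd
    have h2 : Measurable fun z : Plane × Plane => ‖z.1 - z.2‖⁻¹ := by fun_prop
    exact (h1.mul h2).aestronglyMeasurable
  have hle : ∀ ξ, ∫ η, U ξ * (h η * ‖ξ - η‖⁻¹) ≤ A * U ξ := fun ξ => by
    rw [integral_const_mul, mul_comm A]
    exact mul_le_mul_of_nonneg_left (hA ξ).2 (hU0 ξ)
  have hi : Integrable (fun z : Plane × Plane => U z.1 * (h z.2 * ‖z.1 - z.2‖⁻¹))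
      (volume.prod volume) := by
    rw [integrable_prod_iff hm]
    refine ⟨Eventually.of_forall fun ξ => (hA ξ).1.const_mul (U ξ), ?_⟩
    refine (hU.const_mul A).mono' hm.norm.integral_prod_right' (Eventually.of_forall fun ξ => ?_)
    simp only
    rw [Real.norm_eq_abs, abs_of_nonneg (integral_nonneg fun η => norm_nonneg _)]
    refine le_of_eq_of_le (integral_congr_ae (Eventually.of_forall fun η => ?_)) (hle ξ)
    simp only
    rw [Real.norm_eq_abs, abs_of_nonneg (mul_nonneg (hU0 ξ) (hn ξ η))]
  refine ⟨hi, ?_⟩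
  rw [Measure.volume_eq_prod, integral_prod _ hi, ← integral_const_mul]
  exact integral_mono hi.integral_prod_left (hU.const_mul A) hle

/-! ### The kernel of the quadratic form -/

/-- The kernel `ξ · (ξ - η)^⊥ / |ξ - η|²`. -/
def swirl (ξ η : Plane) : ℝ := (ξ 0 * η 1 - ξ 1 * η 0) / ‖ξ - η‖ ^ 2

theorem swirl_antisymm (ξ η : Plane) : swirl ξ η = -swirl η ξ := by
  rw [swirl, swirl, norm_sub_rev, ← neg_div]
  congr 1
  ring

theorem norm_sq_plane (ξ : Plane) : ‖ξ‖ ^ 2 = ξ 0 ^ 2 + ξ 1 ^ 2 := by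
  rw [EuclideanSpace.real_norm_sq_eq, Fin.sum_univ_two]

/-- The cross product of ξ with η equals that of ξ with η - ξ; Lagrange's identity then gives the
bound. This gain makes κ only as singular as ‖ξ - η‖⁻¹. -/
theorem abs_cross_le (ξ η : Plane) : |ξ 0 * η 1 - ξ 1 * η 0| ≤ ‖ξ‖ * ‖ξ - η‖ := by
  refine abs_le_of_sq_le_sq ?_ (by positivity)
  rw [mul_pow, norm_sq_plane, norm_sq_plane]
  simp only [PiLp.sub_apply]
  nlinarith [sq_nonneg (ξ 0 * (ξ 0 - η 0) + ξ 1 * (ξ 1 - η 1))]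

theorem abs_swirl_le (ξ η : Plane) : |swirl ξ η| ≤ ‖ξ‖ * ‖ξ - η‖⁻¹ := by
  rcases eq_or_ne (ξ - η) 0 with h | h
  · rw [swirl, h]
    simp
  · have h1 : 0 < ‖ξ - η‖ := norm_pos_iff.2 h
    rw [swirl, abs_div, abs_of_nonneg (sq_nonneg ‖ξ - η‖), div_le_iff₀ (by positivity)]
    refine (abs_cross_le ξ η).trans_eq ?_
    field_simp

theorem measurable_swirl : Measurable fun z : Plane × Plane => swirl z.1 z.2 := by
  unfold swirl
  fun_prop

theorem sum_coord_mul_perp (ξ η : Plane) :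
    ∑ i, ξ i * (perp (ξ - η) i / ‖ξ - η‖ ^ 2) = swirl ξ η := by
  simp [Fin.sum_univ_two, perp, swirl]
  ring

theorem abs_perp_div_le (ζ : Plane) (i : Fin 2) : |perp ζ i / ‖ζ‖ ^ 2| ≤ ‖ζ‖⁻¹ := by
  rcases eq_or_ne ζ 0 with rfl | h
  · simp
  have h1 : 0 < ‖ζ‖ := norm_pos_iff.2 h
  rw [abs_div, abs_of_nonneg (sq_nonneg ‖ζ‖), div_le_iff₀ (by positivity)]
  have h2 : ‖ζ‖⁻¹ * ‖ζ‖ ^ 2 = ‖ζ‖ := by field_simp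
  rw [h2]
  have h3 : ∀ j, |ζ j| ≤ ‖ζ‖ := fun j => PiLp.norm_apply_le ζ j
  fin_cases i <;> simp [perp, h3]

theorem exists_bound_riesz_oseenG {q : Plane → ℝ} (hq : Adm q) (h0 : ∀ ξ, 0 ≤ q ξ) :
    ∃ A, ∀ ξ, Integrable (fun η => q η * oseenG η * ‖ξ - η‖⁻¹) ∧
      ∫ η, q η * oseenG η * ‖ξ - η‖⁻¹ ≤ A := by
  obtain ⟨C, c, hC, -, h⟩ := hq.exists_nonneg
  obtain ⟨C', hC'⟩ := oseenG_le c
  refine exists_bound_riesz (h := fun η => q η * oseenG η) (M := C * |C'|)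
    (hq.1.mul continuous_oseenG) hq.integrable_mul_oseenG
    (fun ξ => mul_nonneg (h0 ξ) (oseenG_pos ξ).le) fun ξ => ?_
  have h1 : Real.exp (-(1 / 8) * ‖ξ‖ ^ 2) ≤ 1 :=
    Real.exp_le_one_iff.2 (by nlinarith [sq_nonneg ‖ξ‖])
  calc q ξ * oseenG ξ ≤ C * Real.exp (c * ‖ξ‖) * oseenG ξ :=
        mul_le_mul_of_nonneg_right ((le_abs_self _).trans (h ξ)) (oseenG_pos ξ).le
    _ = C * (Real.exp (c * ‖ξ‖) * oseenG ξ) := by ring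
    _ ≤ C * (C' * Real.exp (-(1 / 8) * ‖ξ‖ ^ 2)) := mul_le_mul_of_nonneg_left (hC' ξ) hC
    _ ≤ C * (|C'| * 1) := by
        refine mul_le_mul_of_nonneg_left ?_ hC
        exact mul_le_mul (le_abs_self _) h1 (Real.exp_pos _).le (abs_nonneg _)
    _ = _ := by ring

theorem adm_norm_sq : Adm fun ξ : Plane => ‖ξ‖ ^ 2 := by
  convert ((Adm.coord 0).mul (Adm.coord 0)).add ((Adm.coord 1).mul (Adm.coord 1)) using 1
  ext ξ
  rw [norm_sq_plane]
  simp only [Pi.add_apply, Pi.mul_apply]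
  ring

/-! ### Boundedness of the form with kernel κ -/

section Form

variable {𝕜 : Type*} [RCLike 𝕜]

/-- The integrand of the form `(u, w) ↦ ∬ \bar u(ξ) κ(ξ, η) w(η) dξ dη`. -/
def formIntegrand (u w : Plane → 𝕜) (z : Plane × Plane) : 𝕜 :=
  swirl z.1 z.2 • inner 𝕜 (u z.1) (w z.2)

/-- The product ‖ξ‖‖u(ξ)‖‖w(η)‖ is split by ab ≤ a² + b² (for a, b ≥ 0). The Gaussian factors are
distributed so that each term is the `X`-density of one function times a Gaussian in the other
variable, which tames the Riesz kernel. -/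
theorem norm_formIntegrand_le (u w : Plane → 𝕜) (z : Plane × Plane) :
    ‖formIntegrand u w z‖ ≤
      (oseenG z.1)⁻¹ * ‖u z.1‖ ^ 2 * (1 * oseenG z.2 * ‖z.1 - z.2‖⁻¹) +
      (oseenG z.2)⁻¹ * ‖w z.2‖ ^ 2 * (‖z.1‖ ^ 2 * oseenG z.1 * ‖z.2 - z.1‖⁻¹) := by
  have hP := oseenG_pos z.1
  have hQ := oseenG_pos z.2
  have h1 : ‖formIntegrand u w z‖ ≤ ‖z.1‖ * ‖z.1 - z.2‖⁻¹ * (‖u z.1‖ * ‖w z.2‖) := by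
    rw [formIntegrand, norm_smul, Real.norm_eq_abs]
    exact mul_le_mul (abs_swirl_le _ _) (norm_inner_le_norm _ _) (norm_nonneg _) (by positivity)
  refine h1.trans ?_
  rw [norm_sub_rev z.2 z.1]
  have h2 : ‖z.1‖ * (‖u z.1‖ * ‖w z.2‖) ≤ (oseenG z.1)⁻¹ * ‖u z.1‖ ^ 2 * oseenG z.2 +
      (oseenG z.2)⁻¹ * ‖w z.2‖ ^ 2 * (‖z.1‖ ^ 2 * oseenG z.1) := by
    rw [← sub_nonneg]
    have h3 : (oseenG z.1)⁻¹ * ‖u z.1‖ ^ 2 * oseenG z.2 +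
      (oseenG z.2)⁻¹ * ‖w z.2‖ ^ 2 * (‖z.1‖ ^ 2 * oseenG z.1) - ‖z.1‖ * (‖u z.1‖ * ‖w z.2‖) =
      (oseenG z.1)⁻¹ * (oseenG z.2)⁻¹ * ((‖u z.1‖ * oseenG z.2 - ‖w z.2‖ * ‖z.1‖ * oseenG z.1) ^ 2
        + ‖u z.1‖ * oseenG z.2 * (‖w z.2‖ * ‖z.1‖ * oseenG z.1)) := by
      field_simp
      ring
    rw [h3]
    positivity
  calc _ = ‖z.1‖ * (‖u z.1‖ * ‖w z.2‖) * ‖z.1 - z.2‖⁻¹ := by ring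
    _ ≤ _ := mul_le_mul_of_nonneg_right h2 (by positivity)
    _ = _ := by ring

theorem norm_sq_X (u : X 𝕜) : ‖u‖ ^ 2 = ∫ ξ, (oseenG ξ)⁻¹ * ‖u ξ‖ ^ 2 := by
  have h := inner_X 𝕜 u u
  simp only [inner_self_eq_norm_sq_to_K] at h
  have h2 : (((∫ ξ, (oseenG ξ)⁻¹ * ‖u ξ‖ ^ 2 : ℝ)) : 𝕜) = ((‖u‖ ^ 2 : ℝ) : 𝕜) := by
    rw [← integral_ofReal, RCLike.ofReal_pow, h]
    refine integral_congr_ae (Eventually.of_forall fun ξ => ?_)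
    simp only [RCLike.real_smul_eq_coe_mul, RCLike.ofReal_mul, RCLike.ofReal_pow]
  exact (RCLike.ofReal_injective h2).symm

theorem integrable_norm_sq_X (u : X 𝕜) : Integrable fun ξ => (oseenG ξ)⁻¹ * ‖u ξ‖ ^ 2 := by
  refine (integrable_inner_X 𝕜 u u).norm.congr (Eventually.of_forall fun ξ => ?_)
  simp only [inner_self_eq_norm_sq_to_K, norm_smul, norm_pow, RCLike.norm_ofReal, Real.norm_eq_abs,
    abs_norm, abs_of_pos (inv_pos.2 (oseenG_pos ξ))]

theorem aestronglyMeasurable_X (u : X 𝕜) :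
    AEStronglyMeasurable (fun ξ => u ξ) (volume : Measure Plane) :=
  (Lp.aestronglyMeasurable u).mono_ac volume_ac_gaussMeasure

theorem aestronglyMeasurable_formIntegrand (u w : X 𝕜) :
    AEStronglyMeasurable (formIntegrand u w) ((volume : Measure Plane).prod volume) :=
  measurable_swirl.aestronglyMeasurable.smul
    ((aestronglyMeasurable_X u).comp_fst.inner (aestronglyMeasurable_X w).comp_snd)

/-- The integrand of the form is integrable, with a bound. -/
theorem exists_bound_formIntegrand : ∃ K : ℝ, ∀ u w : X 𝕜,
    Integrable (formIntegrand u w) ((volume : Measure Plane).prod volume) ∧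
    ‖∫ z, formIntegrand u w z ∂((volume : Measure Plane).prod volume)‖ ≤
      K * (‖u‖ ^ 2 + ‖w‖ ^ 2) := by
  obtain ⟨A, hA⟩ := exists_bound_riesz_oseenG (Adm.const 1) fun _ => zero_le_one
  obtain ⟨A', hA'⟩ := exists_bound_riesz_oseenG adm_norm_sq fun _ => by positivity
  refine ⟨max A A', fun u w => ?_⟩
  have h1 := integrable_riesz_prod (continuous_const.mul continuous_oseenG)
    (fun ξ => mul_nonneg zero_le_one (oseenG_pos ξ).le) hA (integrable_norm_sq_X u)
    (fun ξ => mul_nonneg (inv_nonneg.2 (oseenG_pos ξ).le) (by positivity))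
  have h2 := integrable_riesz_prod (adm_norm_sq.1.mul continuous_oseenG)
    (fun ξ => mul_nonneg (by positivity) (oseenG_pos ξ).le) hA' (integrable_norm_sq_X w)
    (fun ξ => mul_nonneg (inv_nonneg.2 (oseenG_pos ξ).le) (by positivity))
  rw [← norm_sq_X, Measure.volume_eq_prod] at h1 h2
  have h3 : Integrable (fun z : Plane × Plane =>
      (oseenG z.1)⁻¹ * ‖u z.1‖ ^ 2 * (1 * oseenG z.2 * ‖z.1 - z.2‖⁻¹) +
      (oseenG z.2)⁻¹ * ‖w z.2‖ ^ 2 * (‖z.1‖ ^ 2 * oseenG z.1 * ‖z.2 - z.1‖⁻¹))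
      (volume.prod volume) := h1.1.add h2.1.swap
  have h4 : Integrable (formIntegrand u w) ((volume : Measure Plane).prod volume) :=
    h3.mono' (aestronglyMeasurable_formIntegrand u w)
      (Eventually.of_forall fun z => norm_formIntegrand_le _ _ z)
  refine ⟨h4, (norm_integral_le_integral_norm _).trans ((integral_mono h4.norm h3
    fun z => norm_formIntegrand_le _ _ z).trans ?_)⟩
  have h5 := integral_add h1.1 h2.1.swap
  have h6 := integral_prod_swap (μ := (volume : Measure Plane)) (ν := (volume : Measure Plane))
    (fun z : Plane × Plane => (oseenG z.1)⁻¹ * ‖w z.1‖ ^ 2 *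
      (‖z.2‖ ^ 2 * oseenG z.2 * ‖z.1 - z.2‖⁻¹))
  calc _ = _ := h5
    _ = _ := congrArg₂ (· + ·) rfl h6
    _ ≤ A * ‖u‖ ^ 2 + A' * ‖w‖ ^ 2 := add_le_add h1.2 h2.2
    _ ≤ max A A' * ‖u‖ ^ 2 + max A A' * ‖w‖ ^ 2 := by
        gcongr
        · exact le_max_left _ _
        · exact le_max_right _ _
    _ = _ := by ring

end Form

/-! ### The nonlocal part of Λ -/

section AdvectionOp

variable {𝕜 : Type*} [RCLike 𝕜]

theorem integrable_formIntegrand (u w : X 𝕜) :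
    Integrable (formIntegrand u w) ((volume : Measure Plane).prod volume) := by
  obtain ⟨K, hK⟩ := exists_bound_formIntegrand (𝕜 := 𝕜)
  exact (hK u w).1

/-- The form `(u, w) ↦ ∬ \bar u(ξ) κ(ξ, η) w(η) dξ dη`. -/
def swirlForm (u w : X 𝕜) : 𝕜 :=
  ∫ z, formIntegrand u w z ∂((volume : Measure Plane).prod volume)

theorem swirlForm_add_left (u v w : X 𝕜) : swirlForm (u + v) w = swirlForm u w + swirlForm v w := by
  rw [swirlForm, swirlForm, swirlForm,
    ← integral_add (integrable_formIntegrand u w) (integrable_formIntegrand v w)]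
  refine integral_congr_ae ?_
  filter_upwards [Measure.quasiMeasurePreserving_fst.ae
    (volume_ac_gaussMeasure.ae_le (Lp.coeFn_add u v))] with z h
  rw [formIntegrand, h, Pi.add_apply, inner_add_left, smul_add]
  rfl

theorem swirlForm_add_right (u v w : X 𝕜) :
    swirlForm u (v + w) = swirlForm u v + swirlForm u w := by
  rw [swirlForm, swirlForm, swirlForm,
    ← integral_add (integrable_formIntegrand u v) (integrable_formIntegrand u w)]
  refine integral_congr_ae ?_
  filter_upwards [Measure.quasiMeasurePreserving_snd.ae
    (volume_ac_gaussMeasure.ae_le (Lp.coeFn_add v w))] with z h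
  rw [formIntegrand, h, Pi.add_apply, inner_add_right, smul_add]
  rfl

theorem swirlForm_smul_left (c : 𝕜) (u w : X 𝕜) :
    swirlForm (c • u) w = starRingEnd 𝕜 c • swirlForm u w := by
  rw [swirlForm, swirlForm, ← integral_smul]
  refine integral_congr_ae ?_
  filter_upwards [Measure.quasiMeasurePreserving_fst.ae
    (volume_ac_gaussMeasure.ae_le (Lp.coeFn_smul c u))] with z h
  rw [formIntegrand, h, Pi.smul_apply, inner_smul_left, ← smul_eq_mul, smul_comm]
  rfl

theorem swirlForm_smul_right (c : 𝕜) (u w : X 𝕜) :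
    swirlForm u (c • w) = c • swirlForm u w := by
  rw [swirlForm, swirlForm, ← integral_smul]
  refine integral_congr_ae ?_
  filter_upwards [Measure.quasiMeasurePreserving_snd.ae
    (volume_ac_gaussMeasure.ae_le (Lp.coeFn_smul c w))] with z h
  rw [formIntegrand, h, Pi.smul_apply, inner_smul_right, ← smul_eq_mul, smul_comm]
  rfl

/-- The form is skew-Hermitian, because the kernel is antisymmetric. -/
theorem swirlForm_skew (u w : X 𝕜) : starRingEnd 𝕜 (swirlForm w u) = -swirlForm u w := by
  rw [swirlForm, swirlForm, ← integral_conj, ← integral_neg, ← integral_prod_swap]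
  refine integral_congr_ae (Eventually.of_forall fun z => ?_)
  simp only [formIntegrand, Prod.fst_swap, Prod.snd_swap, RCLike.real_smul_eq_coe_mul, map_mul,
    inner_conj_symm, RCLike.conj_ofReal]
  rw [swirl_antisymm, RCLike.ofReal_neg, neg_mul]

variable (𝕜) in
theorem exists_norm_swirlForm_le : ∃ C : ℝ, ∀ u w : X 𝕜,
    ‖swirlForm u w‖ ≤ C * ‖u‖ * ‖w‖ := by
  obtain ⟨K, hK⟩ := exists_bound_formIntegrand (𝕜 := 𝕜)
  refine ⟨K * 2, fun u w => ?_⟩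
  rcases eq_or_ne u 0 with rfl | hu
  · have h : swirlForm (0 : X 𝕜) w = 0 := by simpa using swirlForm_smul_left (0 : 𝕜) 0 w
    simp [h]
  rcases eq_or_ne w 0 with rfl | hw
  · have h : swirlForm u (0 : X 𝕜) = 0 := by simpa using swirlForm_smul_right (0 : 𝕜) u 0
    simp [h]
  have hu' := norm_pos_iff.2 hu
  have hw' := norm_pos_iff.2 hw
  -- Homogeneity: the quadratic bound on normalized vectors gives the bilinear one, whence the
  -- constant 2K.
  have h := (hK (((‖u‖⁻¹ : ℝ) : 𝕜) • u) (((‖w‖⁻¹ : ℝ) : 𝕜) • w)).2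
  have e1 : ∀ v : X 𝕜, v ≠ 0 → ‖((‖v‖⁻¹ : ℝ) : 𝕜) • v‖ = 1 := fun v hv => by
    have := norm_pos_iff.2 hv
    rw [norm_smul, RCLike.norm_ofReal, abs_of_pos (inv_pos.2 this), inv_mul_cancel₀ this.ne']
  rw [e1 u hu, e1 w hw] at h
  change ‖swirlForm _ _‖ ≤ _ at h
  rw [swirlForm_smul_left, swirlForm_smul_right, norm_smul, norm_smul, RCLike.norm_conj,
    RCLike.norm_ofReal, RCLike.norm_ofReal, abs_of_pos (inv_pos.2 hu'),
    abs_of_pos (inv_pos.2 hw')] at h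
  have e2 : ‖swirlForm u w‖ = ‖u‖ * ‖w‖ * (‖u‖⁻¹ * (‖w‖⁻¹ * ‖swirlForm u w‖)) := by
    field_simp
  rw [e2]
  calc _ ≤ ‖u‖ * ‖w‖ * (K * (1 ^ 2 + 1 ^ 2)) := mul_le_mul_of_nonneg_left h (by positivity)
    _ = _ := by ring

variable (𝕜) in
/-- The form as a bounded sesquilinear form. -/
def swirlFormL : X 𝕜 →L⋆[𝕜] X 𝕜 →L[𝕜] 𝕜 :=
  LinearMap.mkContinuous₂
    (LinearMap.mk₂'ₛₗ (starRingEnd 𝕜) (RingHom.id 𝕜) swirlForm swirlForm_add_left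
      swirlForm_smul_left swirlForm_add_right swirlForm_smul_right)
    (exists_norm_swirlForm_le 𝕜).choose (exists_norm_swirlForm_le 𝕜).choose_spec

theorem swirlFormL_apply (u w : X 𝕜) : swirlFormL 𝕜 u w = swirlForm u w := rfl

variable (𝕜) in
/-- The bounded operator `w ↦ (K * w) · ∇ G`. -/
def advectG : X 𝕜 →L[𝕜] X 𝕜 :=
  ((1 / (4 * Real.pi) : ℝ) : 𝕜) •
    InnerProductSpace.continuousLinearMapOfBilin (swirlFormL 𝕜)

theorem inner_advectG_left (u w : X 𝕜) :
    inner 𝕜 (advectG 𝕜 u) w = ((1 / (4 * Real.pi) : ℝ) : 𝕜) * swirlForm u w := by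
  rw [advectG, _root_.smul_apply, inner_smul_left, RCLike.conj_ofReal,
    InnerProductSpace.continuousLinearMapOfBilin_apply, swirlFormL_apply]

theorem inner_advectG_right (u w : X 𝕜) :
    inner 𝕜 u (advectG 𝕜 w) = -(((1 / (4 * Real.pi) : ℝ) : 𝕜) * swirlForm u w) := by
  rw [← inner_conj_symm, inner_advectG_left, map_mul, swirlForm_skew, RCLike.conj_ofReal, mul_neg]

theorem inner_advectG_skew (u w : X 𝕜) :
    inner 𝕜 u (advectG 𝕜 w) = -inner 𝕜 (advectG 𝕜 u) w := by
  rw [inner_advectG_left, inner_advectG_right]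

theorem swirlForm_gvec {φ : Plane → ℝ} (hφ : Adm φ) (w : X 𝕜) :
    swirlForm (gvec 𝕜 hφ) w = ∫ ξ, (φ ξ * oseenG ξ) • ∫ η, swirl ξ η • w η := by
  rw [swirlForm, integral_prod _ (integrable_formIntegrand _ _)]
  refine integral_congr_ae ?_
  filter_upwards [gvec_ae 𝕜 hφ] with ξ h
  rw [← integral_smul]
  refine integral_congr_ae (Eventually.of_forall fun η => ?_)
  simp only [formIntegrand, h]
  rw [RCLike.inner_apply, RCLike.conj_ofReal, mul_comm, ← RCLike.real_smul_eq_coe_mul, smul_comm]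

theorem ae_integrable_riesz (w : X 𝕜) :
    ∀ᵐ ξ ∂(volume : Measure Plane), Integrable fun η => ‖ξ - η‖⁻¹ • w η := by
  obtain ⟨A, hA⟩ := exists_bound_riesz_oseenG (Adm.const 1) fun _ => zero_le_one
  have hw : Integrable fun η => ‖w η‖ := by simpa using ((Adm.const 1).integrable_smul w).norm
  -- G serves only as a positive weight that makes the double integral finite; it is divided out
  -- after fixing ξ.
  have h1 := (integrable_riesz_prod (continuous_const.mul continuous_oseenG)
    (fun ξ => mul_nonneg zero_le_one (oseenG_pos ξ).le) hA hw fun ξ => norm_nonneg _).1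
  rw [Measure.volume_eq_prod] at h1
  filter_upwards [h1.swap.prod_right_ae] with ξ h2
  have h3 := h2.const_mul (oseenG ξ)⁻¹
  refine h3.mono' ?_ (Eventually.of_forall fun η => ?_)
  · have h4 : Measurable fun η : Plane => ‖ξ - η‖⁻¹ := by fun_prop
    exact h4.aestronglyMeasurable.smul (aestronglyMeasurable_X w)
  · have := (oseenG_pos ξ).ne'
    simp only [Function.comp_apply, Prod.swap_prod_mk]
    rw [norm_smul, norm_inv, norm_norm, norm_sub_rev η ξ]
    apply le_of_eq
    simp only [Pi.mul_apply, one_mul]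
    field_simp

/-- ∇G = -(ξ/2)G contracts the Biot-Savart kernel with ξ, which produces κ; the constant is
-½·(2π)⁻¹. -/
theorem sum_partialD_oseenG_biotSavart (w : X 𝕜) :
    ∀ᵐ ξ ∂(volume : Measure Plane), ∑ i, partialD i oseenG ξ • biotSavart w i ξ =
      (-(1 / (4 * Real.pi)) * oseenG ξ) • ∫ η, swirl ξ η • w η := by
  filter_upwards [ae_integrable_riesz w] with ξ h
  have h1 : ∀ i, Integrable fun η => (perp (ξ - η) i / ‖ξ - η‖ ^ 2) • w η := fun i => by
    refine h.norm.mono' ?_ (Eventually.of_forall fun η => ?_)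
    · have h4 : Measurable fun η : Plane => perp (ξ - η) i / ‖ξ - η‖ ^ 2 := by
        fin_cases i <;> simp only [perp] <;> simp <;> fun_prop
      exact h4.aestronglyMeasurable.smul (aestronglyMeasurable_X w)
    · rw [norm_smul, norm_smul, Real.norm_eq_abs, norm_inv, norm_norm]
      exact mul_le_mul_of_nonneg_right (abs_perp_div_le _ _) (norm_nonneg _)
  have h2 : ∫ η, swirl ξ η • w η =
      ∑ i, ξ i • ∫ η, (perp (ξ - η) i / ‖ξ - η‖ ^ 2) • w η := by
    simp only [← integral_smul]
    refine Eq.trans ?_ (integral_finsetSum _ fun i _ => (h1 i).smul (ξ i))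
    refine integral_congr_ae (Eventually.of_forall fun η => ?_)
    simp only [smul_smul, ← Finset.sum_smul, sum_coord_mul_perp]
  rw [h2, Finset.smul_sum]
  refine Finset.sum_congr rfl fun i _ => ?_
  rw [partialD_oseenG, biotSavart, smul_smul, smul_smul]
  congr 1
  have := Real.pi_pos.ne'
  field_simp
  ring

/-- `advectG` is defined by Riesz representation, so boundedness is built in; here it is matched
with the concrete expression. The minus sign in `inner_advectG_right` is that of ∇G. -/
theorem eqFun_advectG (w : X 𝕜) :
    EqFun (ofFun fun ξ => ∑ i, partialD i oseenG ξ • biotSavart w i ξ) (advectG 𝕜 w) := by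
  intro φ hφ
  rw [ofFun_eq_inner hφ.adm, inner_advectG_right, swirlForm_gvec, ← RCLike.real_smul_eq_coe_mul,
    ← integral_smul, ← integral_neg, ofFun]
  refine integral_congr_ae ?_
  filter_upwards [sum_partialD_oseenG_biotSavart w] with ξ h
  rw [h, smul_smul, smul_smul, ← neg_smul]
  congr 1
  ring

end AdvectionOp

/-! ### The velocity field of the Gaussian and of its derivatives -/

theorem hermSq_zero : hermSq 0 = 1 := by
  have h := GaussianFourier.integral_rexp_neg_mul_sq_norm (V := Plane) (b := 1 / 4) (by norm_num)
  simp only [hermSq, hermP_zero, one_mul, oseenG]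
  rw [integral_const_mul]
  have h1 : ∀ ξ : Plane, -‖ξ‖ ^ 2 / 4 = -(1 / 4) * ‖ξ‖ ^ 2 := fun ξ => by ring
  simp only [h1]
  rw [h]
  have := Real.pi_pos.ne'
  simp
  field_simp

/-- `ξ₁ η₂ - ξ₂ η₁`. -/
def cross (ξ η : Plane) : ℝ := ξ 0 * η 1 - ξ 1 * η 0

theorem integral_coord_mul_oseenG (i : Fin 2) : ∫ x : Plane, x i * oseenG x = 0 := by
  have h := integral_hermP_mul_of_ne (k := Pi.single i 1) (l := 0) (by simp)
  simp only [hermP_single, hermP_zero, mul_one] at h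
  have h2 : ∫ x : Plane, x i * oseenG x = 2 * ∫ x : Plane, x i / 2 * oseenG x := by
    rw [← integral_const_mul]
    exact integral_congr_ae (Eventually.of_forall fun x => by simp only; ring)
  rw [h2, h, mul_zero]

theorem integral_coord_mul_coord_mul_oseenG (i j : Fin 2) :
    ∫ x : Plane, x i * x j * oseenG x = if i = j then 2 else 0 := by
  have h2 : ∫ x : Plane, x i * x j * oseenG x =
      4 * ∫ x, hermP (Pi.single i 1) x * hermP (Pi.single j 1) x * oseenG x := by
    rw [← integral_const_mul]
    refine integral_congr_ae (Eventually.of_forall fun x => ?_)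
    simp only [hermP_single]
    ring
  rw [h2]
  split_ifs with h
  · subst h
    have h3 := hermSq_add_single i 0
    rw [hermSq_zero, zero_add, hermSq] at h3
    rw [h3]
    norm_num
  · rw [integral_hermP_mul_of_ne, mul_zero]
    intro h'
    have h4 := congrFun h' i
    rw [Pi.single_eq_same, Pi.single_eq_of_ne h] at h4
    exact one_ne_zero h4

/-- First moments of G vanish and its second moments are 2δᵢⱼ, so only the linear part of the affine
factor survives. -/
theorem integral_cross_mul_affine (ξ : Plane) (i : Fin 2) (a c : ℝ) :
    ∫ x : Plane, cross ξ x * (a + c * x i) * oseenG x = 2 * c * perp ξ i := by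
  have hI1 : ∀ j : Fin 2, Integrable fun x : Plane => x j * oseenG x := fun j =>
    (Adm.coord j).integrable_mul_oseenG
  have hI2 : ∀ j : Fin 2, Integrable fun x : Plane => x i * x j * oseenG x := fun j =>
    ((Adm.coord i).mul (Adm.coord j)).integrable_mul_oseenG
  have h1 : ∀ x : Plane, cross ξ x * (a + c * x i) * oseenG x =
      (a * ξ 0 * (x 1 * oseenG x) - a * ξ 1 * (x 0 * oseenG x)) +
      (c * ξ 0 * (x i * x 1 * oseenG x) - c * ξ 1 * (x i * x 0 * oseenG x)) := fun x => by
    rw [cross]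
    ring
  simp only [h1]
  refine (integral_add (((hI1 1).const_mul (a * ξ 0)).sub ((hI1 0).const_mul (a * ξ 1)))
    (((hI2 1).const_mul (c * ξ 0)).sub ((hI2 0).const_mul (c * ξ 1)))).trans ?_
  refine (congrArg₂ (· + ·) (integral_sub ((hI1 1).const_mul (a * ξ 0))
    ((hI1 0).const_mul (a * ξ 1))) (integral_sub ((hI2 1).const_mul (c * ξ 0))
    ((hI2 0).const_mul (c * ξ 1)))).trans ?_
  simp only [integral_const_mul, integral_coord_mul_oseenG, integral_coord_mul_coord_mul_oseenG]
  fin_cases i <;> simp [perp] <;> ring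

/-- Completing the square. -/
theorem integral_cross_mul_exp (ξ : Plane) (i : Fin 2) (a c : ℝ) {t : ℝ} (ht : 0 < t) :
    ∫ η : Plane, cross ξ η * (a + c * η i) * oseenG η * Real.exp (-t * ‖ξ - η‖ ^ 2) =
      2 * c * perp ξ i * ((1 / (1 + 4 * t) ^ 2) * Real.exp (-(t / (1 + 4 * t)) * ‖ξ‖ ^ 2)) := by
  -- The substitution η = sx + v with v = 4ts²ξ centers and rescales the product of the two
  -- Gaussians. As v is parallel to ξ, it drops out of the cross product.
  set s := (Real.sqrt (1 + 4 * t))⁻¹ with hs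
  have hs2 : s ^ 2 = (1 + 4 * t)⁻¹ := by
    rw [hs, inv_pow, Real.sq_sqrt (by positivity)]
  have hs0 : 0 < s := by positivity
  set v : Plane := (4 * t * s ^ 2) • ξ with hv
  set F : Plane → ℝ := fun η =>
    cross ξ η * (a + c * η i) * oseenG η * Real.exp (-t * ‖ξ - η‖ ^ 2) with hF
  have h1 : ∫ η, F η = s ^ 2 * ∫ x : Plane, F (s • x + v) := by
    have h2 := Measure.integral_comp_smul (volume : Measure Plane) (fun y => F (y + v)) s
    rw [h2, integral_add_right_eq_self]
    simp only [finrank_euclideanSpace, Fintype.card_fin, smul_eq_mul]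
    rw [abs_of_pos (by positivity)]
    field_simp
  have h3 : ∀ x : Plane, F (s • x + v) = s * Real.exp (-(t / (1 + 4 * t)) * ‖ξ‖ ^ 2) *
      (cross ξ x * ((a + c * v i) + (c * s) * x i) * oseenG x) := by
    intro x
    have e1 : cross ξ (s • x + v) = s * cross ξ x := by
      simp [cross, hv]
      ring
    have e2 : oseenG (s • x + v) * Real.exp (-t * ‖ξ - (s • x + v)‖ ^ 2) =
        oseenG x * Real.exp (-(t / (1 + 4 * t)) * ‖ξ‖ ^ 2) := by
      rw [oseenG, oseenG, mul_assoc, mul_assoc, ← Real.exp_add, ← Real.exp_add]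
      congr 2
      have e3 : t / (1 + 4 * t) = t * s ^ 2 := by rw [hs2]; rfl
      have e4 : s ^ 2 * (1 + 4 * t) = 1 := by rw [hs2]; field_simp
      rw [e3]
      simp only [norm_sq_plane, hv, PiLp.sub_apply, PiLp.add_apply, PiLp.smul_apply, smul_eq_mul]
      linear_combination (-(1 / 4) * (x 0 ^ 2 + x 1 ^ 2) - 4 * t ^ 2 * s ^ 2 * (ξ 0 ^ 2 + ξ 1 ^ 2)
        + t * (ξ 0 ^ 2 + ξ 1 ^ 2) - 2 * s * t * (x 0 * ξ 0 + x 1 * ξ 1)) * e4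
    simp only [hF]
    rw [mul_assoc, e2, e1]
    simp only [PiLp.add_apply, PiLp.smul_apply, smul_eq_mul]
    ring
  change ∫ η, F η = _
  rw [h1]
  simp only [h3]
  rw [integral_const_mul, integral_cross_mul_affine]
  -- Four powers of s are collected: two from the Jacobian, one from the cross product, one from the
  -- linear factor.
  have e5 : 1 / (1 + 4 * t) ^ 2 = s ^ 2 * s ^ 2 := by rw [hs2]; field_simp
  rw [e5]
  ring

/-- The factor (1 + 4t)⁻² is the derivative of t/(1 + 4t), which increases from 0 to the limit 1/4.
-/
theorem integral_exp_div (ρ : ℝ) (hρ : 0 < ρ) :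
    ∫ t in Set.Ioi (0 : ℝ), (1 / (1 + 4 * t) ^ 2) * Real.exp (-(t / (1 + 4 * t)) * ρ) =
      (1 - Real.exp (-ρ / 4)) / ρ := by
  set g : ℝ → ℝ := fun t => -Real.exp (-(t / (1 + 4 * t)) * ρ) / ρ with hg
  have hd : ∀ t ∈ Set.Ici (0 : ℝ), HasDerivAt g
      ((1 / (1 + 4 * t) ^ 2) * Real.exp (-(t / (1 + 4 * t)) * ρ)) t := by
    intro t ht
    have ht0 : (0 : ℝ) ≤ t := ht
    have hne : 1 + 4 * t ≠ 0 := by positivity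
    have h1 : HasDerivAt (fun t : ℝ => 1 + 4 * t) 4 t := by
      simpa using ((hasDerivAt_id t).const_mul 4).const_add 1
    have h2 := ((((hasDerivAt_id t).div h1 hne).neg.mul_const ρ).exp.neg).div_const ρ
    refine h2.congr_deriv ?_
    simp only [id, Pi.neg_apply, Pi.div_apply]
    field_simp
    ring
  have ht : Tendsto g atTop (𝓝 (-Real.exp (-(1 / 4) * ρ) / ρ)) := by
    have h1 : Tendsto (fun t : ℝ => t / (1 + 4 * t)) atTop (𝓝 (1 / 4)) := by
      have h2 : Tendsto (fun t : ℝ => 1 / 4 - 1 / 4 * (1 + 4 * t)⁻¹) atTop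
          (𝓝 (1 / 4 - 1 / 4 * 0)) := by
        refine (Tendsto.const_mul _ (tendsto_inv_atTop_zero.comp ?_)).const_sub _
        exact tendsto_atTop_add_const_left _ _ (tendsto_id.const_mul_atTop (by norm_num))
      rw [mul_zero, sub_zero] at h2
      refine h2.congr' ?_
      filter_upwards [eventually_ge_atTop 0] with t ht
      have hne : 1 + 4 * t ≠ 0 := by positivity
      field_simp
      ring
    exact ((Real.continuous_exp.tendsto _).comp (h1.neg.mul_const ρ)).neg.div_const ρ
  have hint := integrableOn_Ioi_deriv_of_nonneg' hd (fun t _ => by positivity) ht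
  rw [integral_Ioi_of_hasDerivAt_of_tendsto' hd hint ht]
  simp only [hg]
  have : -(1 / 4) * ρ = -ρ / 4 := by ring
  rw [this]
  simp
  ring

theorem integral_exp_neg_mul_Ioi_zero {b : ℝ} (hb : 0 < b) :
    ∫ t in Set.Ioi (0 : ℝ), Real.exp (-t * b) = b⁻¹ := by
  have h := integral_exp_mul_Ioi (a := -b) (by linarith) 0
  simp only [mul_zero, Real.exp_zero, neg_div_neg_eq, one_div] at h
  rw [← h]
  exact integral_congr_ae (Eventually.of_forall fun t => by simp only; congr 1; ring)

/-- The denominator is written as ρ⁻¹ = ∫₀^∞ exp(-tρ) dt with ρ = ‖ξ - η‖², which reduces the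
singular integral to Gaussian ones. Fubini is justified by |κ| ≤ ‖ξ‖‖ξ - η‖⁻¹. -/
theorem integral_swirl_mul {p : Plane → ℝ} (hp : Adm p) (ξ : Plane) :
    ∫ η, swirl ξ η * (p η * oseenG η) =
      ∫ t in Set.Ioi (0 : ℝ), ∫ η, cross ξ η * p η * oseenG η * Real.exp (-t * ‖ξ - η‖ ^ 2) := by
  obtain ⟨A, hA⟩ := exists_bound_riesz_oseenG (q := fun ξ => |p ξ|)
    hp.abs fun _ => abs_nonneg _
  have hη : ∀ᵐ η ∂(volume : Measure Plane), 0 < ‖ξ - η‖ ^ 2 := by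
    have h : ∀ᵐ η ∂(volume : Measure Plane), η ≠ ξ := by
      simp [ae_iff]
    filter_upwards [h] with η h'
    have := norm_pos_iff.2 (sub_ne_zero.2 h'.symm)
    positivity
  have hm : AEStronglyMeasurable (fun z : Plane × ℝ =>
      cross ξ z.1 * p z.1 * oseenG z.1 * Real.exp (-z.2 * ‖ξ - z.1‖ ^ 2))
      ((volume : Measure Plane).prod (volume.restrict (Set.Ioi (0 : ℝ)))) := by
    refine Continuous.aestronglyMeasurable ?_
    have h1 : Continuous fun z : Plane × ℝ => p z.1 := hp.1.comp continuous_fst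
    have h2 : Continuous fun z : Plane × ℝ => oseenG z.1 := continuous_oseenG.comp continuous_fst
    have h3 : Continuous fun z : Plane × ℝ => cross ξ z.1 := by unfold cross; fun_prop
    have h4 : Continuous fun z : Plane × ℝ => Real.exp (-z.2 * ‖ξ - z.1‖ ^ 2) := by fun_prop
    exact ((h3.mul h1).mul h2).mul h4
  have hi : Integrable (fun z : Plane × ℝ =>
      cross ξ z.1 * p z.1 * oseenG z.1 * Real.exp (-z.2 * ‖ξ - z.1‖ ^ 2))
      ((volume : Measure Plane).prod (volume.restrict (Set.Ioi (0 : ℝ)))) := by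
    rw [integrable_prod_iff hm]
    constructor
    · filter_upwards [hη] with η h
      have h1 := integrableOn_exp_mul_Ioi (a := -‖ξ - η‖ ^ 2) (by linarith) 0
      refine (h1.const_mul (cross ξ η * p η * oseenG η)).congr (Eventually.of_forall fun t => ?_)
      simp only
      congr 2
      ring
    · refine ((hA ξ).1.const_mul ‖ξ‖).mono' hm.norm.integral_prod_right' ?_
      filter_upwards [hη] with η h
      rw [Real.norm_eq_abs, abs_of_nonneg (integral_nonneg fun η => norm_nonneg _)]
      simp only [norm_mul, Real.norm_eq_abs, Real.abs_exp, abs_of_pos (oseenG_pos η)]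
      rw [integral_const_mul, integral_exp_neg_mul_Ioi_zero h]
      have h2 := abs_swirl_le ξ η
      rw [swirl, abs_div, abs_of_pos h, div_eq_mul_inv] at h2
      have h3 : 0 ≤ |p η| * oseenG η := mul_nonneg (abs_nonneg _) (oseenG_pos η).le
      calc _ = (|cross ξ η| * (‖ξ - η‖ ^ 2)⁻¹) * (|p η| * oseenG η) := by ring
        _ ≤ (‖ξ‖ * ‖ξ - η‖⁻¹) * (|p η| * oseenG η) := mul_le_mul_of_nonneg_right h2 h3
        _ = _ := by ring
  have hsw := integral_integral_swap (f := fun η t =>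
    cross ξ η * p η * oseenG η * Real.exp (-t * ‖ξ - η‖ ^ 2)) hi
  refine Eq.trans (integral_congr_ae ?_) hsw
  filter_upwards [hη] with η h
  rw [integral_const_mul, integral_exp_neg_mul_Ioi_zero h, swirl, cross]
  ring

theorem adm_affine (i : Fin 2) (a c : ℝ) : Adm fun η : Plane => a + c * η i :=
  (Adm.const a).add ((Adm.coord i).const_mul c)

theorem integral_swirl_mul_affine (ξ : Plane) (i : Fin 2) (a c : ℝ) :
    ∫ η : Plane, swirl ξ η * ((a + c * η i) * oseenG η) = 4 * Real.pi * c * velo i ξ := by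
  rcases eq_or_ne ξ 0 with rfl | h
  · have h1 : ∀ η, swirl 0 η = 0 := fun η => by simp [swirl]
    have h2 : velo i 0 = 0 := by fin_cases i <;> simp [velo, oseenV, perp]
    simp [h1, h2]
  have h1 : 0 < ‖ξ‖ ^ 2 := by
    have := norm_pos_iff.2 h
    positivity
  rw [integral_swirl_mul (adm_affine i a c), setIntegral_congr_fun measurableSet_Ioi
    (fun t (ht : 0 < t) => integral_cross_mul_exp ξ i a c ht), integral_const_mul,
    integral_exp_div _ h1, velo, oseenV, PiLp.smul_apply, smul_eq_mul]
  have := Real.pi_pos.ne'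
  field_simp
  ring

/-! ### The operator `Λ` -/

section LambdaOp

variable {𝕜 : Type*} [RCLike 𝕜]

variable (𝕜) in
/-- The operator `Λ` on the domain of `𝓛`. -/
def lambdaOp : hermDomain 𝕜 →ₗ[𝕜] X 𝕜 :=
  transportOp 𝕜 + (advectG 𝕜).toLinearMap ∘ₗ (hermDomain 𝕜).subtype

theorem lambdaOp_apply (w : hermDomain 𝕜) :
    lambdaOp 𝕜 w = transportOp 𝕜 w + advectG 𝕜 (w : X 𝕜) := rfl

theorem eqFun_opΛ (w : hermDomain 𝕜) : EqFun (opΛ (w : X 𝕜)) (lambdaOp 𝕜 w) := by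
  intro φ hφ
  rw [lambdaOp_apply, opΛ, Pi.add_apply, eqFun_transportD w φ hφ, eqFun_advectG (w : X 𝕜) φ hφ,
    ← ofFun_add_X hφ.adm]

theorem inner_lambdaOp_skew (u w : hermDomain 𝕜) :
    inner 𝕜 (u : X 𝕜) (lambdaOp 𝕜 w) = -inner 𝕜 (lambdaOp 𝕜 u) (w : X 𝕜) := by
  rw [lambdaOp_apply, lambdaOp_apply, inner_add_right, inner_add_left, inner_transportOp_skew,
    inner_advectG_skew, neg_add]

theorem re_inner_lambdaOp (w : hermDomain 𝕜) :
    RCLike.re (inner 𝕜 (w : X 𝕜) (lambdaOp 𝕜 w)) = 0 := by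
  have h1 := congrArg RCLike.re (inner_lambdaOp_skew w w)
  rw [_root_.map_neg, inner_re_symm (𝕜 := 𝕜) (lambdaOp 𝕜 w)] at h1
  linarith

variable (𝕜) in
-- Transport obeys the half-power bound and the nonlocal part is bounded on `X`, hence controlled by
-- the same sum.
theorem exists_norm_sq_lambdaOp_le : ∃ C : ℝ, 0 ≤ C ∧ ∀ w : hermDomain 𝕜,
    ‖lambdaOp 𝕜 w‖ ^ 2 ≤ C * ∑' k, (1 + deg k) * ‖(hermBasis 𝕜).repr (w : X 𝕜) k‖ ^ 2 := by
  refine ⟨2 * (2 + ‖advectG 𝕜‖ ^ 2), by positivity, fun w => ?_⟩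
  have h1 := norm_sq_transportOp_le w
  have h2 : ‖(w : X 𝕜)‖ ^ 2 ≤ ∑' k, (1 + deg k) * ‖(hermBasis 𝕜).repr (w : X 𝕜) k‖ ^ 2 := by
    refine hasSum_le (fun k => ?_) (hasSum_norm_sq_repr (hermBasis 𝕜) (w : X 𝕜))
      (summable_linear_weight deg_nonneg w).hasSum
    nlinarith [mul_nonneg (deg_nonneg k) (sq_nonneg ‖(hermBasis 𝕜).repr (w : X 𝕜) k‖)]
  have h3 : ‖advectG 𝕜 (w : X 𝕜)‖ ^ 2 ≤ ‖advectG 𝕜‖ ^ 2 * ‖(w : X 𝕜)‖ ^ 2 := by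
    rw [← mul_pow]
    gcongr
    exact (advectG 𝕜).le_opNorm _
  have h4 : ‖lambdaOp 𝕜 w‖ ^ 2 ≤ 2 * (‖transportOp 𝕜 w‖ ^ 2 + ‖advectG 𝕜 (w : X 𝕜)‖ ^ 2) := by
    rw [lambdaOp_apply]
    calc _ ≤ (‖transportOp 𝕜 w‖ + ‖advectG 𝕜 (w : X 𝕜)‖) ^ 2 := by
          gcongr
          exact norm_add_le _ _
      _ ≤ _ := add_sq_le
  have h5 := mul_le_mul_of_nonneg_left h2 (sq_nonneg ‖advectG 𝕜‖)
  linarith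

theorem transp_affine (i : Fin 2) (a c : ℝ) (ξ : Plane) :
    transp (fun η => a + c * η i) ξ = c * velo i ξ := by
  have h1 : ∀ j, partialD j (fun η : Plane => a + c * η i) = fun _ => if i = j then c else 0 := by
    intro j
    have h2 : (fun η : Plane => a + c * η i) = (fun _ => a) + fun η => c * η i := rfl
    rw [h2, partialD_add (by fun_prop) (by fun_prop), partialD_const_mul (by fun_prop),
      partialD_coord]
    ext ξ
    simp [partialD]
  simp only [transp, h1]
  fin_cases i <;> simp [mul_comm]

theorem inner_gvec_advectG_hermFun {φ : Plane → ℝ} (hφ : Adm φ) {k : MIdx} {i : Fin 2} {a c : ℝ}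
    (hk : hermP k = fun η => a + c * η i) :
    inner 𝕜 (gvec 𝕜 hφ) (advectG 𝕜 (hermFun 𝕜 k)) =
      -(((Real.sqrt (hermSq k))⁻¹ * ∫ ξ, φ ξ * transp (hermP k) ξ * oseenG ξ : ℝ) : 𝕜) := by
  have h1 : ∀ ξ, ∫ η, swirl ξ η • gvec 𝕜 (adm_hermP k) η =
      ((4 * Real.pi * transp (hermP k) ξ : ℝ) : 𝕜) := by
    intro ξ
    have h2 := integral_swirl_mul_affine ξ i a c
    have e : transp (hermP k) ξ = c * velo i ξ := by rw [hk, transp_affine]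
    rw [e, ← mul_assoc, ← h2, ← integral_ofReal]
    refine integral_congr_ae ?_
    filter_upwards [gvec_ae 𝕜 (adm_hermP k)] with η h
    rw [h, RCLike.real_smul_eq_coe_mul, ← RCLike.ofReal_mul, congrFun hk η]
  have h3 : swirlForm (gvec 𝕜 hφ) (gvec 𝕜 (adm_hermP k)) =
      ((4 * Real.pi * ∫ ξ, φ ξ * transp (hermP k) ξ * oseenG ξ : ℝ) : 𝕜) := by
    rw [swirlForm_gvec, ← integral_const_mul, ← integral_ofReal]
    refine integral_congr_ae (Eventually.of_forall fun ξ => ?_)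
    simp only
    rw [h1, RCLike.real_smul_eq_coe_mul, ← RCLike.ofReal_mul]
    congr 1
    ring
  rw [inner_advectG_right, hermFun, swirlForm_smul_right, h3, smul_eq_mul, ← RCLike.ofReal_mul,
    ← RCLike.ofReal_mul]
  congr 2
  have := Real.pi_pos.ne'
  field_simp

/-- For p = a + cηᵢ, transport of pG gives c vᵢ^G G, and the nonlocal term gives exactly its
opposite. This expresses that translates of the vortex, and its multiples, are again stationary for
the advection. -/
theorem lambdaOp_hermFun {k : MIdx} {i : Fin 2} {a c : ℝ} (hk : hermP k = fun η => a + c * η i) :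
    lambdaOp 𝕜 ⟨hermFun 𝕜 k, hermFun_mem k⟩ = 0 := by
  refine EqFun.unique (T := 0) (fun φ hφ => ?_) (fun φ hφ => ?_)
  · rw [ofFun_eq_inner hφ.adm, lambdaOp_apply, inner_add_right,
      inner_gvec_transportOp_hermFun hφ.adm1, inner_gvec_advectG_hermFun hφ.adm hk, add_neg_cancel]
    rfl
  · rw [ofFun_eq_inner hφ.adm, inner_zero_right]
    rfl

theorem hermP_zero_affine : hermP 0 = fun η => 1 + 0 * η 0 := by
  ext η
  rw [hermP_zero]
  ring

theorem hermP_single_affine (i : Fin 2) :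
    hermP (Pi.single i 1) = fun η => 0 + 1 / 2 * η i := by
  ext η
  rw [hermP_single]
  ring

/-- Conservation of the moments of order at most one. -/
theorem inner_hermFun_lambdaOp {k : MIdx} (hk : k = 0 ∨ ∃ i, k = Pi.single i 1)
    (w : hermDomain 𝕜) : inner 𝕜 (hermBasis 𝕜 k) (lambdaOp 𝕜 w) = 0 := by
  rw [coe_hermBasis]
  have h : lambdaOp 𝕜 ⟨hermFun 𝕜 k, hermFun_mem k⟩ = 0 := by
    rcases hk with rfl | ⟨i, rfl⟩
    · exact lambdaOp_hermFun hermP_zero_affine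
    · exact lambdaOp_hermFun (hermP_single_affine i)
  have h1 := inner_lambdaOp_skew ⟨hermFun 𝕜 k, hermFun_mem k⟩ w
  rwa [h, inner_zero_left, neg_zero] at h1

/-! ### The linearized operator and its semigroup -/

theorem eqFun_linearized (α : ℝ) (w : hermDomain 𝕜) :
    EqFun (opL (w : X 𝕜) - α • opΛ (w : X 𝕜)) (hermL 𝕜 w - (α : 𝕜) • lambdaOp 𝕜 w : X 𝕜) := by
  intro φ hφ
  rw [Pi.sub_apply, Pi.smul_apply, eqFun_opL w φ hφ, eqFun_opΛ w φ hφ,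
    ofFun_eq_inner hφ.adm, ofFun_eq_inner hφ.adm, ofFun_eq_inner hφ.adm, inner_sub_right,
    inner_smul_right, RCLike.real_smul_eq_coe_mul]

/-- Reduces the distributional operator to Hermite coordinates, where the abstract theory of
diagonal operators with skew perturbation applies. -/
theorem linearizedGraph_eq (α : ℝ) : linearizedGraph 𝕜 α =
    {p | ∃ w : hermDomain 𝕜, p = ((w : X 𝕜), hermL 𝕜 w - (α : 𝕜) • lambdaOp 𝕜 w)} := by
  ext p
  constructor
  · rintro ⟨h1, h2⟩
    exact ⟨⟨p.1, mem_domL_iff.1 h1⟩,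
      Prod.ext rfl (h2.unique (eqFun_linearized α ⟨p.1, mem_domL_iff.1 h1⟩))⟩
  · rintro ⟨w, rfl⟩
    exact ⟨mem_domL_iff.2 w.2, eqFun_linearized α w⟩

theorem one_le_deg {k : MIdx} (h : ¬(k = 0 ∨ ∃ i, k = Pi.single i 1)) : 1 ≤ deg k := by
  have h1 : 2 ≤ k 0 + k 1 := by
    by_contra! h2
    refine h ?_
    rcases Nat.eq_zero_or_pos (k 0) with h3 | h3 <;> rcases Nat.eq_zero_or_pos (k 1) with h4 | h4
    · exact Or.inl (funext fun j => by fin_cases j <;> simp [h3, h4])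
    · refine Or.inr ⟨1, funext fun j => ?_⟩
      fin_cases j <;> simp <;> omega
    · refine Or.inr ⟨0, funext fun j => ?_⟩
      fin_cases j <;> simp <;> omega
    · omega
  have h2 : (2 : ℝ) ≤ k 0 + k 1 := by exact_mod_cast h1
  rw [deg]
  linarith

theorem half_le_deg {k : MIdx} (h : k ≠ 0) : 1 / 2 ≤ deg k := by
  by_cases h1 : ∃ i, k = Pi.single i 1
  · obtain ⟨i, rfl⟩ := h1
    have := deg_add_single i 0
    rw [zero_add] at this
    rw [this]
    linarith [deg_nonneg 0]
  · have := one_le_deg (k := k) (by tauto)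
    linarith

theorem mem_X0_iff (w : X 𝕜) : w ∈ X0 𝕜 ↔ inner 𝕜 (hermBasis 𝕜 0) w = 0 := by
  rw [coe_hermBasis, inner_hermFun_eq_zero_iff]
  simp only [hermP_zero, one_smul]
  rfl

theorem inner_hermBasis_single_eq_zero_iff (i : Fin 2) (w : X 𝕜) :
    inner 𝕜 (hermBasis 𝕜 (Pi.single i 1)) w = 0 ↔ ∫ ξ : Plane, ξ i • w ξ = 0 := by
  rw [coe_hermBasis, inner_hermFun_eq_zero_iff]
  have h : ∫ ξ, hermP (Pi.single i 1) ξ • w ξ = (1 / 2 : ℝ) • ∫ ξ : Plane, ξ i • w ξ := by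
    rw [← integral_smul]
    refine integral_congr_ae (Eventually.of_forall fun ξ => ?_)
    simp only [hermP_single, smul_smul]
    congr 1
    ring
  rw [h, smul_eq_zero, or_iff_right (by norm_num)]

theorem mem_X1_iff (w : X 𝕜) : w ∈ X1 𝕜 ↔
    ∀ k ∈ {k : MIdx | k = 0 ∨ ∃ i, k = Pi.single i 1}, inner 𝕜 (hermBasis 𝕜 k) w = 0 := by
  have h : w ∈ X1 𝕜 ↔ w ∈ X0 𝕜 ∧ ∀ i : Fin 2, ∫ ξ : Plane, ξ i • w ξ = 0 := Iff.rfl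
  rw [h, mem_X0_iff]
  constructor
  · rintro ⟨h0, h1⟩ k (rfl | ⟨i, rfl⟩)
    · exact h0
    · exact (inner_hermBasis_single_eq_zero_iff i w).2 (h1 i)
  · intro h
    exact ⟨h 0 (Or.inl rfl), fun i =>
      (inner_hermBasis_single_eq_zero_iff i w).1 (h _ (Or.inr ⟨i, rfl⟩))⟩

theorem exists_semigroup_linearizedGraph (α : ℝ) :
    ∃ S : C0Semigroup 𝕜 (X 𝕜), S.generatorGraph = linearizedGraph 𝕜 α := by
  obtain ⟨C, hC, h⟩ := exists_norm_sq_lambdaOp_le 𝕜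
  rw [linearizedGraph_eq]
  exact exists_semigroup_diagOp_sub (lambdaOp 𝕜) deg_nonneg hC h re_inner_lambdaOp α

theorem eq_of_generatorGraph_eq_linearizedGraph {α : ℝ} {S T : C0Semigroup 𝕜 (X 𝕜)}
    (hS : S.generatorGraph = linearizedGraph 𝕜 α) (hT : T.generatorGraph = linearizedGraph 𝕜 α) :
    S = T := by
  refine C0Semigroup.eq_of_generatorGraph_eq (hS.trans hT.symm) ?_ ?_
  · rw [hS, linearizedGraph_eq]
    rintro _ ⟨w, rfl⟩
    rw [inner_sub_right, _root_.map_sub, inner_smul_right, RCLike.re_ofReal_mul,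
      re_inner_lambdaOp, mul_zero, sub_zero]
    have := re_inner_diagOp_le (b := hermBasis 𝕜) deg_nonneg w (μ := 0)
      fun k => Or.inl (deg_nonneg k)
    rw [neg_zero, zero_mul] at this
    exact this
  · refine (dense_diagDomain (hermBasis 𝕜) deg).mono fun w hw => ?_
    rw [hS, linearizedGraph_eq]
    exact ⟨_, ⟨⟨w, hw⟩, rfl⟩, rfl⟩

theorem decaysOn_linearized {α : ℝ} {S : C0Semigroup 𝕜 (X 𝕜)}
    (hS : S.generatorGraph = linearizedGraph 𝕜 α) :
    S.DecaysOn ⊤ 0 ∧ S.DecaysOn (X0 𝕜) (1 / 2) ∧ S.DecaysOn (X1 𝕜) 1 := by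
  rw [linearizedGraph_eq] at hS
  refine ⟨?_, ?_, ?_⟩
  · exact decaysOn_diagOp_sub (lambdaOp 𝕜) deg_nonneg re_inner_lambdaOp α hS (s := ∅)
      (fun k _ => deg_nonneg k) (by simp) (by simp)
  · refine decaysOn_diagOp_sub (lambdaOp 𝕜) deg_nonneg re_inner_lambdaOp α hS (s := {0})
      (fun k hk => half_le_deg hk) ?_ (fun w => by simpa using mem_X0_iff w)
    rintro k rfl w
    exact inner_hermFun_lambdaOp (Or.inl rfl) w
  · exact decaysOn_diagOp_sub (lambdaOp 𝕜) deg_nonneg re_inner_lambdaOp α hS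
      (s := {k | k = 0 ∨ ∃ i, k = Pi.single i 1}) (fun k hk => one_le_deg hk)
      (fun k hk w => inner_hermFun_lambdaOp hk w) mem_X1_iff

end LambdaOp

end OseenVortex

end

open OseenVortex in
theorem mainTheorem10 (𝕜 : Type*) [RCLike 𝕜] (α : ℝ) :
    (∀ w ∈ domL 𝕜, ∃! g : X 𝕜, (w, g) ∈ linearizedGraph 𝕜 α) ∧
    (∃! S : C0Semigroup 𝕜 (X 𝕜), S.generatorGraph = linearizedGraph 𝕜 α) ∧
    ∀ S : C0Semigroup 𝕜 (X 𝕜), S.generatorGraph = linearizedGraph 𝕜 α →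
      S.DecaysOn ⊤ 0 ∧ S.DecaysOn (X0 𝕜) (1 / 2) ∧ S.DecaysOn (X1 𝕜) 1 := by
  refine ⟨fun w hw => ?_, ?_, fun S hS => decaysOn_linearized hS⟩
  · exact ⟨_, ⟨hw, eqFun_linearized α ⟨w, mem_domL_iff.1 hw⟩⟩, fun g hg =>
      EqFun.unique hg.2 (eqFun_linearized α ⟨w, mem_domL_iff.1 hw⟩)⟩
  · obtain ⟨S, hS⟩ := exists_semigroup_linearizedGraph (𝕜 := 𝕜) α
    exact ⟨S, hS, fun T hT => eq_of_generatorGraph_eq_linearizedGraph hT hS⟩
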